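/- **Theorem (Full bound of the single index model).** Fix constants $L_f, L_{f'}, M, C_{\max}, \mu_0, A, B>0$ and $\sigma\ge 0$. There is a constant $C$, depending only on these, such that the following holds for all $n,d$ with $d^6\le A\,n$. *Model.* Let $f:\mathbb R\to\mathbb R$ be continuously differentiable with $|f|\le L_f$ and $|f'|\le L_{f'}$ on $\mathbb R$. Let $\mathcal D=N(\mu_X,\Sigma_X)$ on $\mathbb R^d$ with $\Sigma_X$ positive definite, density $p$ and score $S=-\nabla p/p$, and assume $\lambda_{\max}(\Sigma_X)\le C_{\max}$ and $\mathbb E_{X\sim\mathcal D}[S_j(X)^2]\le M$ for all $j\le d$. Let $\theta_*\in\mathbb R^d$ satisfy $\|\Sigma_X^{1/2}\theta_*\|_1=1$ and $\mu_*=\mathbb E_{X\sim\mathcal D}[f'(X^\top\theta_*)]\ge\mu_0$. We observe two batches of $n$ samples $(x_i,y_i)$, with $y_i=f(x_i^\top\theta_*)+\eta_i$, where the $2n$ pairs $(x_i,\eta_i)$ are independent, $x_i\sim\mathcal D$, and $\eta_i$ is independent of $x_i$ with mean zero and variance at most $\sigma^2$. Let $X\sim\mathcal D$ be independent of all the samples.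 *Estimators.* Let $\delta\in(0,1)$ with $\log(1/\delta)\le B\,n^{1/3}$ (for instance a fixed $\delta$), and $\tau=\sqrt{3(\sigma^2+L_f^2)Mn/\log(2d/\delta)}$. With the first batch let $\hat\theta$ be the minimizer over $\theta\in\mathbb R^d$ of $$\|\theta\|_2^2-\frac2n\sum_{i=1}^n\phi_\tau\bigl(y_iS(x_i)\bigr)^\top\theta,\qquad \phi_\tau(v)=\bigl(\operatorname{sign}(v_j)(|v_j|\wedge\tau)\bigr)_{j=1}^d,$$ and let $\hat\theta_0=\hat\theta/\|\Sigma_X^{1/2}\hat\theta\|_1$ (and $\hat\theta_0=0$ if $\hat\theta=0$). With the second batch let, for $h=n^{-1/3}$, $W=2\sqrt{\log n}$ and $K_h(v)=\frac1h 1_{\{|v|\le h\}}$, $$\hat f(z)=\frac{\sum_{i=1}^n y_iK_h(z-x_i^\top\hat\theta_0)}{\sum_{i=1}^nK_h(z-x_i^\top\hat\theta_0)}\ \text{ if } |z-\mu_X^\top\hat\theta_0|\le W,\qquad \hat f(z)=0\ \text{ otherwise},$$ with the convention $0/0=0$. *Conclusion.* With probability at least $1-\delta$ over the first batch, the expectation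 over $X$ and the second batch, given the first batch, satisfies $$\mathbb E\bigl|\hat f(X^\top\hat\theta_0)-f(X^\top\theta_*)\bigr|\le C\,\frac{\sqrt d}{n^{1/3}},$$ and the same bound holds for the expectation over $X$ and both batches. (In both cases the integrand is integrable.) -/

import Mathlib

open MeasureTheory ProbabilityTheory
open scoped Matrix MatrixOrder

noncomputable section

namespace SingleIndex

/-- The density of the Gaussian distribution `N(m, Q)` on `ℝ^d` (with `Q` positive definite). -/
def gaussianDensity {d : ℕ} (m : EuclideanSpace ℝ (Fin d)) (Q : Matrix (Fin d) (Fin d) ℝ)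
    (x : EuclideanSpace ℝ (Fin d)) : ℝ :=
  (2 * Real.pi) ^ (-(d : ℝ) / 2) * (Real.sqrt Q.det)⁻¹ *
    Real.exp (-((x - m).ofLp ⬝ᵥ (Q⁻¹ *ᵥ (x - m).ofLp)) / 2)

/-- The score function `S^p(x) = -∇p(x) / p(x)` of a density `p` on `ℝ^d`. -/
def score {d : ℕ} (p : EuclideanSpace ℝ (Fin d) → ℝ) (x : EuclideanSpace ℝ (Fin d)) :
    EuclideanSpace ℝ (Fin d) :=
  -((p x)⁻¹ • gradient p x)

/-- The `ℓ¹` norm of a vector of `ℝ^d`. -/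
def l1norm {d : ℕ} (v : EuclideanSpace ℝ (Fin d)) : ℝ := ∑ j, |v j|

/-- The vector `Q^{1/2} v`, where `Q^{1/2}` is the positive semidefinite square root of `Q`. -/
def sqrtMul {d : ℕ} (Q : Matrix (Fin d) (Fin d) ℝ) (v : EuclideanSpace ℝ (Fin d)) :
    EuclideanSpace ℝ (Fin d) :=
  WithLp.toLp 2 (CFC.sqrt Q *ᵥ v.ofLp)

/-- Elementwise truncation: `φ_τ(v)_j = sign(v_j) (|v_j| ∧ τ)`. -/
def trunc {d : ℕ} (τ : ℝ) (v : EuclideanSpace ℝ (Fin d)) : EuclideanSpace ℝ (Fin d) :=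
  WithLp.toLp 2 fun j => Real.sign (v j) * min |v j| τ

/-- The regularized Stein objective
`‖θ‖₂² - (2/n) ∑ᵢ ⟨φ_τ(yᵢ S(xᵢ)), θ⟩ + lam ‖θ‖₁` built from the samples `(xᵢ, yᵢ)`, `i < n`. -/
def steinObjective {n d : ℕ} (S : EuclideanSpace ℝ (Fin d) → EuclideanSpace ℝ (Fin d))
    (τ lam : ℝ) (x : Fin n → EuclideanSpace ℝ (Fin d)) (y : Fin n → ℝ)
    (θ : EuclideanSpace ℝ (Fin d)) : ℝ :=
  ‖θ‖ ^ 2 - 2 / (n : ℝ) * ∑ i, inner ℝ (trunc τ (y i • S (x i))) θ + lam * l1norm θ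

/-- The normalization `θ / ‖Q^{1/2} θ‖₁` (equal to `0` if `θ = 0`). -/
def normalize {d : ℕ} (Q : Matrix (Fin d) (Fin d) ℝ) (θ : EuclideanSpace ℝ (Fin d)) :
    EuclideanSpace ℝ (Fin d) :=
  (l1norm (sqrtMul Q θ))⁻¹ • θ

/-- The uniform kernel `K_h(v) = h⁻¹ 1{|v| ≤ h}`. -/
def uniformKernel (h v : ℝ) : ℝ := if |v| ≤ h then 1 / h else 0

/-- The truncated kernel regression estimator of the link function, computed in direction `ϑ`
from the samples `(xᵢ, yᵢ)`, `i < n`, with bandwidth `h` and truncation level `W` around `mᵀϑ`;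
the convention `0 / 0 = 0` is that of Lean. -/
def kernelRegression {n d : ℕ} (m : EuclideanSpace ℝ (Fin d)) (h W : ℝ)
    (ϑ : EuclideanSpace ℝ (Fin d)) (x : Fin n → EuclideanSpace ℝ (Fin d)) (y : Fin n → ℝ)
    (z : ℝ) : ℝ :=
  if |z - inner ℝ m ϑ| ≤ W then
    (∑ i, y i * uniformKernel h (z - inner ℝ (x i) ϑ)) /
      ∑ i, uniformKernel h (z - inner ℝ (x i) ϑ)
  else 0

/-- The absolute prediction error `|f̂(uᵀϑ) - f(uᵀθ)|` at the context `u`, where `f̂` is the kernel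
regression estimator in direction `ϑ` from `n` samples `(xᵢ, yᵢ)`, with bandwidth `h = n^{-1/3}`
and truncation level `W = 2 √(log n)`. -/
def predictionError {n d : ℕ} (f : ℝ → ℝ) (θ m : EuclideanSpace ℝ (Fin d))
    (ϑ : EuclideanSpace ℝ (Fin d)) (x : Fin n → EuclideanSpace ℝ (Fin d)) (y : Fin n → ℝ)
    (u : EuclideanSpace ℝ (Fin d)) : ℝ :=
  |kernelRegression m ((n : ℝ) ^ (-(1 : ℝ) / 3)) (2 * Real.sqrt (Real.log n)) ϑ x y (inner ℝ u ϑ)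
    - f (inner ℝ u θ)|

end SingleIndex

end

/-
By Stein's identity `E[y S(x)] = μ θ` with `μ = E[f'(xᵀθ)]`, and the minimizer of the Stein
objective is the empirical mean of the truncated vectors `y S(x)`. Exponential moments of the
truncated coordinates and a union bound show that it is within order `√d n^{-1/3}` of `μ θ`, and
normalization preserves this rate because `μ ≥ μ₀`.

For kernel regression in a fixed direction `ϑ`, write `θ = a ϑ + r` with `Q^{1/2} r` orthogonal to
`Q^{1/2} ϑ`. The multiple of `ϑ` contributes a bias of order of the bandwidth `h`. The projections
on `r` are independent of those on `ϑ`, which determine the kernel weights, so `r` contributes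
`‖Q^{1/2} r‖` without a loss of `1 / h`. The noise contributes the inverse square root of `n`
times the Gaussian mass of the window, whose mean is of order `1 / √(n h)`. Since `h = n^{-1/3}`,
all the terms are of order `√d n^{-1/3}`; when this exceeds `1`, boundedness of `f` suffices.
-/

namespace SingleIndex

section LinearFunctionals

variable {d : ℕ} {m : EuclideanSpace ℝ (Fin d)} {Q : Matrix (Fin d) (Fin d) ℝ}

lemma sqrtMul_eq_toEuclideanCLM (v : EuclideanSpace ℝ (Fin d)) :
    sqrtMul Q v = Matrix.toEuclideanCLM (𝕜 := ℝ) (CFC.sqrt Q) v := rfl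

lemma inner_sqrtMul (hQ : Q.PosSemidef) (u v : EuclideanSpace ℝ (Fin d)) :
    inner ℝ (sqrtMul Q u) (sqrtMul Q v) = u.ofLp ⬝ᵥ (Q *ᵥ v.ofLp) := by
  have hS := ((CFC.sqrt_nonneg Q).isSelfAdjoint.map
    (Matrix.toEuclideanCLM (n := Fin d) (𝕜 := ℝ))).isSymmetric
  rw [sqrtMul_eq_toEuclideanCLM, sqrtMul_eq_toEuclideanCLM]
  refine (hS u _).trans ?_
  rw [ContinuousLinearMap.coe_coe, ← mul_apply_eq_comp, ← map_mul,
    CFC.sqrt_mul_sqrt_self _ hQ.nonneg, EuclideanSpace.inner_eq_star_dotProduct,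
    Matrix.ofLp_toEuclideanCLM, star_trivial, dotProduct_comm]

lemma sqrtMul_add (u v : EuclideanSpace ℝ (Fin d)) :
    sqrtMul Q (u + v) = sqrtMul Q u + sqrtMul Q v := by
  simp only [sqrtMul_eq_toEuclideanCLM, map_add]

lemma sqrtMul_smul (c : ℝ) (v : EuclideanSpace ℝ (Fin d)) :
    sqrtMul Q (c • v) = c • sqrtMul Q v := by
  simp only [sqrtMul_eq_toEuclideanCLM, map_smul]

lemma exists_eq_smul_add_inner_sqrtMul_eq_zero (Q : Matrix (Fin d) (Fin d) ℝ)
    (u v : EuclideanSpace ℝ (Fin d)) :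
    ∃ (c : ℝ) (r : EuclideanSpace ℝ (Fin d)), v = c • u + r ∧
      inner ℝ (sqrtMul Q u) (sqrtMul Q r) = 0 := by
  obtain hu | hu := eq_or_ne (sqrtMul Q u) 0
  · exact ⟨0, v, by simp, by simp [hu]⟩
  · refine ⟨inner ℝ (sqrtMul Q u) (sqrtMul Q v) / ‖sqrtMul Q u‖ ^ 2, _,
      (add_sub_cancel _ v).symm, ?_⟩
    have hu' : ‖sqrtMul Q u‖ ≠ 0 := norm_ne_zero_iff.2 hu
    rw [sub_eq_add_neg, ← neg_smul, sqrtMul_add, sqrtMul_smul, inner_add_right,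
      real_inner_smul_right, real_inner_self_eq_norm_sq]
    field_simp
    ring

lemma norm_sqrtMul_smul_add_sq {u r : EuclideanSpace ℝ (Fin d)}
    (hur : inner ℝ (sqrtMul Q u) (sqrtMul Q r) = 0) (c : ℝ) :
    ‖sqrtMul Q (c • u + r)‖ ^ 2 = (|c| * ‖sqrtMul Q u‖) ^ 2 + ‖sqrtMul Q r‖ ^ 2 := by
  have h := norm_add_sq_eq_norm_sq_add_norm_sq_real (x := c • sqrtMul Q u) (y := sqrtMul Q r)
    (by rw [real_inner_smul_left, hur, mul_zero])
  rw [sqrtMul_add, sqrtMul_smul, sq, h, norm_smul, Real.norm_eq_abs]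
  ring

lemma covariance_inner (hQ : Q.PosSemidef) (u v : EuclideanSpace ℝ (Fin d)) :
    cov[fun x => inner ℝ u x, fun x => inner ℝ v x; multivariateGaussian m Q] =
      inner ℝ (sqrtMul Q u) (sqrtMul Q v) := by
  rw [inner_sqrtMul hQ, ← covarianceBilin_multivariateGaussian (μ := m) hQ,
    covarianceBilin_apply_eq_cov IsGaussian.memLp_two_id]

lemma inner_sub_left_comm (x m v : EuclideanSpace ℝ (Fin d)) :
    inner ℝ (x - m) v = inner ℝ v x - inner ℝ v m := by
  rw [inner_sub_left, real_inner_comm, real_inner_comm m v]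

lemma map_inner_sub_eq_gaussianReal (hQ : Q.PosSemidef) (v : EuclideanSpace ℝ (Fin d)) :
    (multivariateGaussian m Q).map (fun x => inner ℝ (x - m) v) =
      gaussianReal 0 (‖sqrtMul Q v‖₊ ^ 2) := by
  have hvar : Var[fun x => inner ℝ v x; multivariateGaussian m Q] = ‖sqrtMul Q v‖ ^ 2 := by
    rw [← covariance_self (by fun_prop), covariance_inner hQ, real_inner_self_eq_norm_sq]
  have hlaw : (multivariateGaussian m Q).map (fun x => inner ℝ v x) =
      gaussianReal (inner ℝ v m) (‖sqrtMul Q v‖₊ ^ 2) := by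
    refine (IsGaussian.map_eq_gaussianReal (innerSL ℝ v)).trans ?_
    rw [ContinuousLinearMap.integral_comp_id_comm IsGaussian.integrable_id,
      integral_id_multivariateGaussian]
    congr 1
    exact NNReal.eq ((Real.coe_toNNReal _ (variance_nonneg _ _)).trans hvar)
  simp_rw [inner_sub_left_comm]
  refine (Measure.map_map (g := fun t : ℝ => t - inner ℝ v m) (f := fun x => inner ℝ v x)
    (by fun_prop) (by fun_prop)).symm.trans ?_
  rw [hlaw, gaussianReal_map_sub_const, sub_self]

lemma indepFun_inner_sub (hQ : Q.PosSemidef) {u v : EuclideanSpace ℝ (Fin d)}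
    (huv : inner ℝ (sqrtMul Q u) (sqrtMul Q v) = 0) :
    IndepFun (fun x => inner ℝ (x - m) u) (fun x => inner ℝ (x - m) v)
      (multivariateGaussian m Q) := by
  have hlaw : HasGaussianLaw (fun x => (inner ℝ u x, inner ℝ v x)) (multivariateGaussian m Q) :=
    (IsGaussian.hasGaussianLaw_id (μ := multivariateGaussian m Q)).map_fun
      ((innerSL ℝ u).prod (innerSL ℝ v))
  simp_rw [inner_sub_left_comm]
  exact (hlaw.indepFun_of_covariance_eq_zero ((covariance_inner hQ u v).trans huv)).comp
    (φ := fun t => t - inner ℝ u m) (ψ := fun t => t - inner ℝ v m) (by fun_prop) (by fun_prop)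

lemma memLp_inner_sub (v : EuclideanSpace ℝ (Fin d)) :
    MemLp (fun x => inner ℝ (x - m) v) 2 (multivariateGaussian m Q) :=
  (IsGaussian.memLp_two_id.sub (memLp_const m)).inner_const (𝕜 := ℝ) v

lemma integral_comp_inner_sub (hQ : Q.PosSemidef) (v : EuclideanSpace ℝ (Fin d)) {g : ℝ → ℝ}
    (hg : Measurable g) :
    ∫ x, g (inner ℝ (x - m) v) ∂multivariateGaussian m Q =
      ∫ t, g t ∂gaussianReal 0 (‖sqrtMul Q v‖₊ ^ 2) := by
  rw [← map_inner_sub_eq_gaussianReal (m := m) hQ,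
    integral_map (by fun_prop) hg.aestronglyMeasurable]

lemma integral_inner_sub (hQ : Q.PosSemidef) (v : EuclideanSpace ℝ (Fin d)) :
    ∫ x, inner ℝ (x - m) v ∂multivariateGaussian m Q = 0 :=
  (integral_comp_inner_sub hQ v measurable_id).trans integral_id_gaussianReal

lemma integral_inner_sub_sq (hQ : Q.PosSemidef) (v : EuclideanSpace ℝ (Fin d)) :
    ∫ x, (inner ℝ (x - m) v) ^ 2 ∂multivariateGaussian m Q = ‖sqrtMul Q v‖ ^ 2 := by
  have hvar := variance_fun_id_gaussianReal (μ := 0) (v := ‖sqrtMul Q v‖₊ ^ 2)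
  rw [variance_of_integral_eq_zero (by fun_prop) integral_id_gaussianReal] at hvar
  simpa using (integral_comp_inner_sub (m := m) hQ v (measurable_id.pow_const 2)).trans hvar

lemma lintegral_ofReal_abs_le {α : Type*} {mα : MeasurableSpace α} {μ : Measure α}
    [IsProbabilityMeasure μ] {g : α → ℝ} {C : ℝ} (hg : MemLp g 2 μ) (hC : 0 ≤ C)
    (h : ∫ a, g a ^ 2 ∂μ ≤ C ^ 2) :
    ∫⁻ a, ENNReal.ofReal |g a| ∂μ ≤ ENNReal.ofReal C := by
  rw [← ofReal_integral_eq_lintegral_ofReal (hg.integrable one_le_two).abs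
    (ae_of_all _ fun _ => abs_nonneg _)]
  refine ENNReal.ofReal_le_ofReal (abs_le_of_sq_le_sq' (le_trans ?_ h) hC).2
  have hvar := variance_nonneg |g| μ
  rw [variance_eq_sub hg.abs] at hvar
  simpa using hvar

lemma lintegral_abs_inner_sub_le (hQ : Q.PosSemidef) (v : EuclideanSpace ℝ (Fin d)) :
    ∫⁻ x, ENNReal.ofReal |inner ℝ (x - m) v| ∂multivariateGaussian m Q ≤
      ENNReal.ofReal ‖sqrtMul Q v‖ :=
  lintegral_ofReal_abs_le (memLp_inner_sub v) (norm_nonneg _) (integral_inner_sub_sq hQ v).le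

end LinearFunctionals

/-- The regularity class of the link functions: `C¹` functions bounded by `Lf` whose derivative is
bounded by `Lf'`. -/
structure IsLink (Lf Lf' : ℝ) (f : ℝ → ℝ) : Prop where
  contDiff : ContDiff ℝ 1 f
  abs_le : ∀ t, |f t| ≤ Lf
  abs_deriv_le : ∀ t, |deriv f t| ≤ Lf'

namespace IsLink

variable {Lf Lf' : ℝ} {f : ℝ → ℝ}

lemma measurable (hf : IsLink Lf Lf' f) : Measurable f := hf.contDiff.continuous.measurable

lemma nonneg (hf : IsLink Lf Lf' f) : 0 ≤ Lf := (abs_nonneg _).trans (hf.abs_le 0)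

lemma deriv_nonneg (hf : IsLink Lf Lf' f) : 0 ≤ Lf' := (abs_nonneg _).trans (hf.abs_deriv_le 0)

lemma comp_add_const (hf : IsLink Lf Lf' f) (a : ℝ) : IsLink Lf Lf' fun t => f (t + a) where
  contDiff := hf.contDiff.comp (contDiff_id.add contDiff_const)
  abs_le _ := hf.abs_le _
  abs_deriv_le t := by rw [deriv_comp_add_const]; exact hf.abs_deriv_le _

lemma abs_sub_le (hf : IsLink Lf Lf' f) (s t : ℝ) : |f s - f t| ≤ Lf' * |s - t| :=
  convex_univ.norm_image_sub_le_of_norm_deriv_le (fun _ _ => hf.contDiff.differentiable_one _)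
    (fun _ _ => hf.abs_deriv_le _) (Set.mem_univ t) (Set.mem_univ s)

end IsLink

section Stein

lemma hasDerivAt_gaussianPDFReal_zero (v : NNReal) (t : ℝ) :
    HasDerivAt (gaussianPDFReal 0 v) (-(t / v) * gaussianPDFReal 0 v t) t := by
  have hexp : HasDerivAt (fun x : ℝ => -(x - 0) ^ 2 / (2 * v)) (-(t / v)) t := by
    refine (((hasDerivAt_id t).sub_const 0).pow 2).neg.div_const (2 * (v : ℝ)) |>.congr_deriv ?_
    simp only [id, sub_zero, Nat.cast_ofNat, Nat.add_one_sub_one, pow_one, mul_one]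
    rw [neg_div, mul_div_mul_left _ _ two_ne_zero]
  rw [gaussianPDFReal_def]
  exact (hexp.exp.const_mul (√(2 * Real.pi * v))⁻¹).congr_deriv (by ring)

lemma integrable_deriv_gaussianPDFReal_zero {v : NNReal} (hv : v ≠ 0) :
    Integrable fun t : ℝ => -(t / v) * gaussianPDFReal 0 v t := by
  refine ((integrable_mul_exp_neg_mul_sq (b := (2 * (v : ℝ))⁻¹) (by positivity)).const_mul
    (-(√(2 * Real.pi * v))⁻¹ / v)).congr (ae_of_all _ fun t => ?_)
  simp only [gaussianPDFReal, show -(t - 0) ^ 2 / (2 * (v : ℝ)) = -(2 * (v : ℝ))⁻¹ * t ^ 2 by ring]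
  ring

lemma integral_mul_id_gaussianReal (v : NNReal) {K K' : ℝ} {g : ℝ → ℝ} (hg : IsLink K K' g) :
    ∫ t, g t * t ∂gaussianReal 0 v = v * ∫ t, deriv g t ∂gaussianReal 0 v := by
  obtain rfl | hv := eq_or_ne v 0
  · simp
  have hg_meas := hg.contDiff.continuous.aestronglyMeasurable (μ := volume)
  have hg' := (hg.contDiff.continuous_deriv le_rfl).aestronglyMeasurable (μ := volume)
  have hφ := integrable_gaussianPDFReal 0 v
  have hparts := integral_mul_deriv_eq_deriv_mul_of_integrable
    (fun t _ => (hg.contDiff.differentiable_one t).hasDerivAt)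
    (fun t _ => hasDerivAt_gaussianPDFReal_zero v t)
    ((integrable_deriv_gaussianPDFReal_zero hv).bdd_mul hg_meas (ae_of_all _ hg.abs_le))
    (hφ.bdd_mul hg' (ae_of_all _ hg.abs_deriv_le)) (hφ.bdd_mul hg_meas (ae_of_all _ hg.abs_le))
  have hv' : (v : ℝ) ≠ 0 := NNReal.coe_ne_zero.2 hv
  rw [integral_gaussianReal_eq_integral_smul hv, integral_gaussianReal_eq_integral_smul hv]
  calc ∫ t, gaussianPDFReal 0 v t • (g t * t)
      = ∫ t, -v * (g t * (-(t / v) * gaussianPDFReal 0 v t)) := by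
        congr 1 with t; simp only [smul_eq_mul]; field_simp
    _ = v * ∫ t, deriv g t * gaussianPDFReal 0 v t := by
        rw [integral_const_mul, hparts]; ring
    _ = v * ∫ t, gaussianPDFReal 0 v t • deriv g t := by simp only [smul_eq_mul, mul_comm]

variable {d : ℕ} {m : EuclideanSpace ℝ (Fin d)} {Q : Matrix (Fin d) (Fin d) ℝ} {K K' : ℝ}

lemma integrable_comp_inner_sub_mul_inner_sub {g : ℝ → ℝ} (hg : IsLink K K' g)
    (θ v : EuclideanSpace ℝ (Fin d)) :
    Integrable (fun x => g (inner ℝ (x - m) θ) * inner ℝ (x - m) v)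
      (multivariateGaussian m Q) :=
  ((memLp_inner_sub v).integrable one_le_two).bdd_mul
    (hg.measurable.comp (by fun_prop)).aestronglyMeasurable (ae_of_all _ fun _ => hg.abs_le _)

lemma integral_comp_inner_sub_mul_inner_sub (hQ : Q.PosSemidef) {g : ℝ → ℝ} (hg : IsLink K K' g)
    (θ v : EuclideanSpace ℝ (Fin d)) :
    ∫ x, g (inner ℝ (x - m) θ) * inner ℝ (x - m) v ∂multivariateGaussian m Q =
      inner ℝ (sqrtMul Q θ) (sqrtMul Q v) *
        ∫ x, deriv g (inner ℝ (x - m) θ) ∂multivariateGaussian m Q := by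
  obtain ⟨c, r, rfl, hr⟩ := exists_eq_smul_add_inner_sqrtMul_eq_zero Q θ v
  have hθ : ∫ x, g (inner ℝ (x - m) θ) * inner ℝ (x - m) θ ∂multivariateGaussian m Q =
      ‖sqrtMul Q θ‖ ^ 2 * ∫ x, deriv g (inner ℝ (x - m) θ) ∂multivariateGaussian m Q := by
    rw [integral_comp_inner_sub hQ θ (g := fun t => g t * t) (hg.measurable.mul measurable_id),
      integral_comp_inner_sub hQ θ (measurable_deriv g), integral_mul_id_gaussianReal _ hg]
    simp
  have hr0 : ∫ x, g (inner ℝ (x - m) θ) * inner ℝ (x - m) r ∂multivariateGaussian m Q = 0 := by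
    have hprod := ((indepFun_inner_sub (m := m) hQ hr).comp hg.measurable
      measurable_id).integral_fun_mul_eq_mul_integral
        (hg.measurable.comp (by fun_prop)).aestronglyMeasurable (by fun_prop)
    simp only [Function.comp_def, id] at hprod
    rw [hprod, integral_inner_sub hQ, mul_zero]
  have hsplit : ∀ x, g (inner ℝ (x - m) θ) * inner ℝ (x - m) (c • θ + r) =
      c * (g (inner ℝ (x - m) θ) * inner ℝ (x - m) θ) +
        g (inner ℝ (x - m) θ) * inner ℝ (x - m) r := fun x => by
    rw [inner_add_right, real_inner_smul_right]; ring
  simp_rw [hsplit]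
  rw [integral_add ((integrable_comp_inner_sub_mul_inner_sub hg θ θ).const_mul c)
    (integrable_comp_inner_sub_mul_inner_sub hg θ r), integral_const_mul, hr0, hθ, sqrtMul_add,
    sqrtMul_smul, inner_add_right, real_inner_smul_right, hr, real_inner_self_eq_norm_sq]
  ring

lemma integral_comp_inner_mul_inner_sub (hQ : Q.PosSemidef) {f : ℝ → ℝ} (hf : IsLink K K' f)
    (θ v : EuclideanSpace ℝ (Fin d)) :
    ∫ x, f (inner ℝ x θ) * inner ℝ (x - m) v ∂multivariateGaussian m Q =
      inner ℝ (sqrtMul Q θ) (sqrtMul Q v) *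
        ∫ x, deriv f (inner ℝ x θ) ∂multivariateGaussian m Q := by
  have h := integral_comp_inner_sub_mul_inner_sub (m := m) hQ (hf.comp_add_const (inner ℝ m θ)) θ v
  simpa only [deriv_comp_add_const, inner_sub_left, sub_add_cancel] using h

end Stein

section Score

variable {d : ℕ} {m : EuclideanSpace ℝ (Fin d)} {Q : Matrix (Fin d) (Fin d) ℝ}

lemma isSymmetric_toEuclideanCLM_inv (hQ : Q.PosDef) :
    (Matrix.toEuclideanCLM (n := Fin d) (𝕜 := ℝ) Q⁻¹).IsSymmetric :=
  (IsSelfAdjoint.map (R := Matrix (Fin d) (Fin d) ℝ) hQ.inv.isHermitian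
    (Matrix.toEuclideanCLM (n := Fin d) (𝕜 := ℝ))).isSymmetric

lemma hasGradientAt_gaussianDensity (hQ : Q.PosDef) (x : EuclideanSpace ℝ (Fin d)) :
    HasGradientAt (gaussianDensity m Q)
      (-(gaussianDensity m Q x • Matrix.toEuclideanCLM (n := Fin d) (𝕜 := ℝ) Q⁻¹ (x - m))) x := by
  set T := Matrix.toEuclideanCLM (n := Fin d) (𝕜 := ℝ) Q⁻¹
  have hdens : gaussianDensity m Q = fun y => (2 * Real.pi) ^ (-(d : ℝ) / 2) * (√Q.det)⁻¹ *
      Real.exp (-T.reApplyInnerSelf (y - m) * 2⁻¹) := by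
    ext y
    rw [gaussianDensity, div_eq_mul_inv (-(_ ⬝ᵥ _)), ContinuousLinearMap.reApplyInnerSelf_apply,
      RCLike.re_to_real, EuclideanSpace.inner_eq_star_dotProduct, Matrix.ofLp_toEuclideanCLM,
      star_trivial]
  have hform := ((isSymmetric_toEuclideanCLM_inv hQ).hasStrictFDerivAt_reApplyInnerSelf
    (x - m)).hasFDerivAt.comp x ((hasFDerivAt_id x).sub_const m)
  have hexp := ((hform.neg.mul_const 2⁻¹).exp.const_mul
    ((2 * Real.pi) ^ (-(d : ℝ) / 2) * (√Q.det)⁻¹))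
  rw [hasGradientAt_iff_hasFDerivAt, hdens]
  refine hexp.congr_fderiv ?_
  ext w
  simp
  ring

lemma score_gaussianDensity (hQ : Q.PosDef) (x : EuclideanSpace ℝ (Fin d)) :
    score (gaussianDensity m Q) x = Matrix.toEuclideanCLM (n := Fin d) (𝕜 := ℝ) Q⁻¹ (x - m) := by
  have hpos : 0 < gaussianDensity m Q x := by
    have := hQ.det_pos
    unfold gaussianDensity
    positivity
  rw [score, (hasGradientAt_gaussianDensity hQ x).gradient, smul_neg, neg_neg,
    inv_smul_smul₀ hpos.ne']

/-- The vector `Q⁻¹ eⱼ`, which represents the `j`-th coordinate of the score of `N(m, Q)` as a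
linear functional of `x - m`. -/
noncomputable def scoreVec (Q : Matrix (Fin d) (Fin d) ℝ) (j : Fin d) : EuclideanSpace ℝ (Fin d) :=
  Matrix.toEuclideanCLM (n := Fin d) (𝕜 := ℝ) Q⁻¹ (EuclideanSpace.single j 1)

lemma score_apply (hQ : Q.PosDef) (x : EuclideanSpace ℝ (Fin d)) (j : Fin d) :
    score (gaussianDensity m Q) x j = inner ℝ (x - m) (scoreVec Q j) := by
  rw [score_gaussianDensity hQ, scoreVec]
  refine .trans ?_ (isSymmetric_toEuclideanCLM_inv hQ (x - m) (EuclideanSpace.single j 1))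
  rw [EuclideanSpace.inner_single_right, one_mul, ContinuousLinearMap.coe_coe, conj_trivial]

lemma inner_sqrtMul_scoreVec (hQ : Q.PosDef) (θ : EuclideanSpace ℝ (Fin d)) (j : Fin d) :
    inner ℝ (sqrtMul Q θ) (sqrtMul Q (scoreVec Q j)) = θ j := by
  rw [inner_sqrtMul hQ.posSemidef, scoreVec, Matrix.ofLp_toEuclideanCLM, Matrix.mulVec_mulVec,
    Matrix.mul_nonsing_inv _ hQ.det_pos.ne'.isUnit, Matrix.one_mulVec, PiLp.ofLp_single,
    dotProduct_single_one]

end Score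

section WindowMass

variable {v : NNReal} {h : ℝ}

/-- The mass that the centred Gaussian law of variance `v` gives to the window of half-width `h`
around `p`: the expected fraction of the samples that kernel regression averages over at `p`. -/
noncomputable def windowMass (v : NNReal) (h p : ℝ) : ℝ := (gaussianReal 0 v).real {t | |p - t| ≤ h}

lemma gaussianPDFReal_zero_le_of_sq_le (v : NNReal) {h p t : ℝ} (ht : t ^ 2 ≤ p ^ 2 + h ^ 2) :
    Real.exp (-h ^ 2 / (2 * v)) * gaussianPDFReal 0 v p ≤ gaussianPDFReal 0 v t := by
  simp only [gaussianPDFReal]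
  rw [mul_left_comm, ← Real.exp_add, ← add_div]
  gcongr
  linarith

lemma exists_Icc_abs_sub_le_sq_le (hh : 0 ≤ h) (p : ℝ) :
    ∃ a : ℝ, ∀ t ∈ Set.Icc a (a + h), |p - t| ≤ h ∧ t ^ 2 ≤ p ^ 2 + h ^ 2 := by
  obtain hp | hp := le_total 0 p
  · refine ⟨p - h, fun t ⟨hat, hta⟩ => ⟨abs_le.2 ⟨by linarith, by linarith⟩, ?_⟩⟩
    rcases le_total 0 t <;> nlinarith
  · refine ⟨p, fun t ⟨hat, hta⟩ => ⟨abs_le.2 ⟨by linarith, by linarith⟩, ?_⟩⟩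
    rcases le_total 0 t <;> nlinarith

-- Half of the window, on the side of the origin, lies where the density is at least
-- `exp (-h² / (2v))` times its value at `p`.
lemma le_windowMass (hv : v ≠ 0) (hh : 0 ≤ h) (p : ℝ) :
    h * (Real.exp (-h ^ 2 / (2 * v)) * gaussianPDFReal 0 v p) ≤ windowMass v h p := by
  obtain ⟨a, ha⟩ := exists_Icc_abs_sub_le_sq_le hh p
  calc h * (Real.exp (-h ^ 2 / (2 * v)) * gaussianPDFReal 0 v p)
      = ∫ _ in Set.Icc a (a + h), Real.exp (-h ^ 2 / (2 * v)) * gaussianPDFReal 0 v p := by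
        simp [measureReal_def, hh]
    _ ≤ ∫ t in Set.Icc a (a + h), gaussianPDFReal 0 v t :=
        setIntegral_mono_on (integrableOn_const (by simp))
          (integrable_gaussianPDFReal 0 v).integrableOn measurableSet_Icc
          fun t ht => gaussianPDFReal_zero_le_of_sq_le v (ha t ht).2
    _ = (gaussianReal 0 v).real (Set.Icc a (a + h)) := by
        rw [measureReal_def, gaussianReal_apply_eq_integral 0 hv, ENNReal.toReal_ofReal]
        exact integral_nonneg fun _ => gaussianPDFReal_nonneg _ _ _
    _ ≤ windowMass v h p := measureReal_mono fun t ht => (ha t ht).1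

lemma windowMass_pos (hh : 0 < h) {p : ℝ} (hp : v = 0 → p = 0) : 0 < windowMass v h p := by
  obtain rfl | hv := eq_or_ne v 0
  · simp [windowMass, hp rfl, hh.le, measureReal_def]
  · have := gaussianPDFReal_pos 0 v p hv
    exact lt_of_lt_of_le (by positivity) (le_windowMass hv hh.le p)

lemma measurable_windowMass (v : NNReal) (h : ℝ) : Measurable (windowMass v h) :=
  (measurable_measure_prodMk_left (ν := gaussianReal 0 v) (s := {z : ℝ × ℝ | |z.1 - z.2| ≤ h})
    (measurableSet_le (by fun_prop) (by fun_prop))).ennreal_toReal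

lemma sqrt_gaussianPDFReal_zero (hv : v ≠ 0) (p : ℝ) :
    √(gaussianPDFReal 0 v p) =
      √((√(2 * Real.pi * v))⁻¹) * Real.exp (-(1 / (4 * v)) * p ^ 2) := by
  have : (0 : ℝ) < v := by positivity
  simp only [gaussianPDFReal]
  rw [Real.sqrt_mul (by positivity), Real.sqrt_eq_rpow (Real.exp _), ← Real.exp_mul]
  congr 2
  field_simp
  ring

lemma integrable_sqrt_gaussianPDFReal_zero (hv : v ≠ 0) :
    Integrable fun p => √(gaussianPDFReal 0 v p) := by
  simp_rw [sqrt_gaussianPDFReal_zero hv]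
  exact (integrable_exp_neg_mul_sq (by positivity)).const_mul _

lemma integral_sqrt_gaussianPDFReal_le (hv : v ≠ 0) (hv1 : v ≤ 1) :
    ∫ p, √(gaussianPDFReal 0 v p) ≤ 3 := by
  have : (0 : ℝ) < v := by positivity
  have : (v : ℝ) ≤ 1 := by exact_mod_cast hv1
  simp_rw [sqrt_gaussianPDFReal_zero hv]
  rw [integral_const_mul, integral_gaussian, ← Real.sqrt_mul (by positivity),
    show Real.pi / (1 / (4 * v)) = 4 * Real.pi * v by field_simp]
  refine Real.sqrt_le_iff.2 ⟨by norm_num, ?_⟩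
  rw [inv_mul_le_iff₀ (by positivity)]
  calc 4 * Real.pi * v = √(2 * Real.pi * v) * √(8 * Real.pi * v) := by
        rw [← Real.sqrt_mul (by positivity), eq_comm,
          Real.sqrt_eq_iff_eq_sq (by positivity) (by positivity)]
        ring
    _ ≤ √(2 * Real.pi * v) * 3 ^ 2 := by
        gcongr
        exact Real.sqrt_le_iff.2 ⟨by norm_num, by nlinarith [Real.pi_le_four, Real.pi_pos]⟩

lemma gaussianPDFReal_div_sqrt_windowMass_le (hv : v ≠ 0) (hh : 0 < h) {N : ℝ} (hN : 0 < N)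
    (p : ℝ) :
    gaussianPDFReal 0 v p / √(N * windowMass v h p) ≤
      Real.exp (h ^ 2 / (4 * v)) / √(N * h) * √(gaussianPDFReal 0 v p) := by
  have hφ := gaussianPDFReal_pos 0 v p hv
  have hmass := le_windowMass hv hh.le p
  set φ := gaussianPDFReal 0 v p
  have hexp : √(Real.exp (-h ^ 2 / (2 * v))) = (Real.exp (h ^ 2 / (4 * v)))⁻¹ := by
    rw [Real.sqrt_eq_rpow, ← Real.exp_mul, ← Real.exp_neg]
    ring_nf
  calc φ / √(N * windowMass v h p)
      ≤ φ / √(N * (h * (Real.exp (-h ^ 2 / (2 * v)) * φ))) := by gcongr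
    _ = √φ * √φ / (√(N * h) * ((Real.exp (h ^ 2 / (4 * v)))⁻¹ * √φ)) := by
        rw [Real.mul_self_sqrt hφ.le, ← mul_assoc N, Real.sqrt_mul (x := N * h) (by positivity),
          Real.sqrt_mul (Real.exp_nonneg _), hexp]
    _ = Real.exp (h ^ 2 / (4 * v)) / √(N * h) * √φ := by
        field_simp

lemma lintegral_inv_sqrt_windowMass_le (hv : v ≠ 0) (hv1 : v ≤ 1) (hh : 0 < h) {N : ℝ}
    (hN : 0 < N) :
    ∫⁻ p, ENNReal.ofReal (1 / √(N * windowMass v h p)) ∂gaussianReal 0 v ≤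
      ENNReal.ofReal (Real.exp (h ^ 2 / (4 * v)) / √(N * h) * 3) := by
  have hmeas := measurable_windowMass v h
  rw [gaussianReal_of_var_ne_zero 0 hv,
    lintegral_withDensity_eq_lintegral_mul _ (measurable_gaussianPDF 0 v) (by fun_prop)]
  calc ∫⁻ p, (gaussianPDF 0 v * fun p => ENNReal.ofReal (1 / √(N * windowMass v h p))) p
      ≤ ∫⁻ p, ENNReal.ofReal
          (Real.exp (h ^ 2 / (4 * v)) / √(N * h) * √(gaussianPDFReal 0 v p)) := by
        refine lintegral_mono fun p => ?_
        rw [Pi.mul_apply, gaussianPDF, ← ENNReal.ofReal_mul (gaussianPDFReal_nonneg _ _ _),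
          mul_one_div]
        exact ENNReal.ofReal_le_ofReal (gaussianPDFReal_div_sqrt_windowMass_le hv hh hN p)
    _ = ENNReal.ofReal (Real.exp (h ^ 2 / (4 * v)) / √(N * h) *
          ∫ p, √(gaussianPDFReal 0 v p)) := by
        rw [← ofReal_integral_eq_lintegral_ofReal
          ((integrable_sqrt_gaussianPDFReal_zero hv).const_mul _)
          (ae_of_all _ fun p => by positivity), integral_const_mul]
    _ ≤ _ := by
        gcongr
        exact integral_sqrt_gaussianPDFReal_le hv hv1

lemma hasSubgaussianMGF_id_gaussianReal {c : NNReal} (hvc : v ≤ c) :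
    HasSubgaussianMGF id c (gaussianReal 0 v) where
  integrable_exp_mul := integrable_exp_mul_gaussianReal
  mgf_le t := by
    rw [mgf_id_gaussianReal]
    simp only [zero_mul, zero_add]
    gcongr

lemma measureReal_abs_ge_le_of_hasSubgaussianMGF {Ω : Type*} {mΩ : MeasurableSpace Ω}
    {P : Measure Ω} [IsFiniteMeasure P] {X : Ω → ℝ} {c : NNReal} (hX : HasSubgaussianMGF X c P)
    {W : ℝ} (hW : 0 ≤ W) : P.real {ω | W ≤ |X ω|} ≤ 2 * Real.exp (-W ^ 2 / (2 * c)) := by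
  calc P.real {ω | W ≤ |X ω|} ≤ P.real ({ω | W ≤ X ω} ∪ {ω | W ≤ (-X) ω}) :=
        measureReal_mono fun ω hω => le_abs.1 (show W ≤ |X ω| from hω)
    _ ≤ P.real {ω | W ≤ X ω} + P.real {ω | W ≤ (-X) ω} := measureReal_union_le _ _
    _ ≤ _ := by rw [two_mul]; exact add_le_add (hX.measure_ge_le hW) (hX.neg.measure_ge_le hW)

end WindowMass

section KernelWeights

variable {ι : Type*} [Fintype ι] {h t : ℝ} {p : ι → ℝ}

/-- The number of design points `p i` within distance `h` of `t`, as a real number. -/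
noncomputable def windowCount (h t : ℝ) (p : ι → ℝ) : ℝ := ∑ i, {s | |t - s| ≤ h}.indicator 1 (p i)

/-- The weight of the `i`-th observation in the kernel regression estimate at `t` with design points
`p`. All the weights are `0` if no design point lies within distance `h` of `t`. -/
noncomputable def kernelWeight (h t : ℝ) (p : ι → ℝ) (i : ι) : ℝ :=
  {s | |t - s| ≤ h}.indicator 1 (p i) / windowCount h t p

lemma windowCount_nonneg : 0 ≤ windowCount h t p :=
  Finset.sum_nonneg fun _ _ => Set.indicator_nonneg (fun _ _ => zero_le_one) _

lemma measurable_windowCount (h t : ℝ) : Measurable fun p : ι → ℝ => windowCount h t p :=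
  Finset.measurable_sum _ fun i _ => (measurable_one.indicator
    (measurableSet_le (by fun_prop) (by fun_prop))).comp (measurable_pi_apply i)

lemma measurable_kernelWeight (h t : ℝ) (i : ι) :
    Measurable fun p : ι → ℝ => kernelWeight h t p i :=
  ((measurable_one.indicator (measurableSet_le (by fun_prop) (by fun_prop))).comp
    (measurable_pi_apply i)).div (measurable_windowCount h t)

lemma kernelWeight_nonneg (i : ι) : 0 ≤ kernelWeight h t p i :=
  div_nonneg (Set.indicator_nonneg (fun _ _ => zero_le_one) _) windowCount_nonneg

lemma sum_kernelWeight (hN : windowCount h t p ≠ 0) : ∑ i, kernelWeight h t p i = 1 := by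
  simp only [kernelWeight, ← Finset.sum_div]
  exact div_self hN

lemma kernelWeight_eq_zero (hN : windowCount h t p = 0) (i : ι) : kernelWeight h t p i = 0 := by
  rw [kernelWeight, hN, div_zero]

lemma sum_kernelWeight_le_one : ∑ i, kernelWeight h t p i ≤ 1 := by
  by_cases hN : windowCount h t p = 0
  · simp [kernelWeight_eq_zero hN]
  · exact (sum_kernelWeight hN).le

lemma sum_kernelWeight_sq_eq : ∑ i, kernelWeight h t p i ^ 2 = 1 / windowCount h t p := by
  by_cases hN : windowCount h t p = 0
  · simp [kernelWeight_eq_zero hN, hN]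
  have hsq : ∀ i, kernelWeight h t p i ^ 2 = kernelWeight h t p i / windowCount h t p := by
    intro i
    by_cases hi : |t - p i| ≤ h <;> simp [kernelWeight, hi]
    field_simp
  simp_rw [hsq, ← Finset.sum_div, sum_kernelWeight hN]

lemma sum_kernelWeight_sq_le_one : ∑ i, kernelWeight h t p i ^ 2 ≤ 1 := by
  refine le_trans (Finset.sum_le_sum fun i _ => ?_)
    (sum_kernelWeight_le_one (h := h) (t := t) (p := p))
  refine pow_le_of_le_one (kernelWeight_nonneg i) ?_ two_ne_zero
  exact (Finset.single_le_sum (fun j _ => kernelWeight_nonneg j) (Finset.mem_univ i)).trans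
    sum_kernelWeight_le_one

lemma sqrt_sum_kernelWeight_sq_le :
    √(∑ i, kernelWeight h t p i ^ 2) ≤ 1 / √(max 1 (windowCount h t p)) := by
  rw [← Real.sqrt_one, ← Real.sqrt_div zero_le_one, Real.sqrt_one]
  refine Real.sqrt_le_sqrt ?_
  obtain hN | hN := le_total (windowCount h t p) 1
  · simpa [hN] using sum_kernelWeight_sq_le_one
  · rw [max_eq_right hN, sum_kernelWeight_sq_eq]

lemma kernelWeight_mul_le_mul {i : ι} {a b : ℝ} (hab : |t - p i| ≤ h → a ≤ b) :
    kernelWeight h t p i * a ≤ kernelWeight h t p i * b := by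
  by_cases hi : |t - p i| ≤ h
  · exact mul_le_mul_of_nonneg_left (hab hi) (kernelWeight_nonneg i)
  · simp [kernelWeight, hi]

lemma abs_sum_kernelWeight_mul_le {g : ι → ℝ} {C : ℝ} (hC : 0 ≤ C)
    (hg : ∀ i, |t - p i| ≤ h → |g i| ≤ C) : |∑ i, kernelWeight h t p i * g i| ≤ C := by
  calc |∑ i, kernelWeight h t p i * g i| ≤ ∑ i, |kernelWeight h t p i * g i| :=
        Finset.abs_sum_le_sum_abs _ _
    _ ≤ ∑ i, kernelWeight h t p i * C := Finset.sum_le_sum fun i _ => by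
        rw [abs_mul, abs_of_nonneg (kernelWeight_nonneg i)]
        exact kernelWeight_mul_le_mul (hg i)
    _ ≤ C := by
        rw [← Finset.sum_mul]
        exact mul_le_of_le_one_left hC sum_kernelWeight_le_one

end KernelWeights

section KernelRegression

variable {n d : ℕ} {m θ ϑ r u : EuclideanSpace ℝ (Fin d)} {f : ℝ → ℝ} {Lf Lf' h W : ℝ}
  {x : Fin n → EuclideanSpace ℝ (Fin d)} {ε : Fin n → ℝ}

lemma kernelRegression_inner (hh : 0 < h) (y : Fin n → ℝ) :
    kernelRegression m h W ϑ x y (inner ℝ u ϑ) =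
      if |inner ℝ (u - m) ϑ| ≤ W then
        ∑ i, kernelWeight h (inner ℝ (u - m) ϑ) (fun i => inner ℝ (x i - m) ϑ) i * y i else 0 := by
  have hker : ∀ i, uniformKernel h (inner ℝ u ϑ - inner ℝ (x i) ϑ) =
      {s | |inner ℝ (u - m) ϑ - s| ≤ h}.indicator 1 (inner ℝ (x i - m) ϑ) * h⁻¹ := fun i => by
    simp [uniformKernel, Set.indicator_apply, inner_sub_left]
  rw [kernelRegression, ← inner_sub_left]
  refine if_congr Iff.rfl ?_ rfl
  simp_rw [hker, ← mul_assoc]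
  rw [← Finset.sum_mul, ← Finset.sum_mul, mul_div_mul_right _ _ (inv_ne_zero hh.ne'),
    Finset.sum_div]
  refine Finset.sum_congr rfl fun i _ => ?_
  rw [kernelWeight, windowCount, div_mul_eq_mul_div, mul_comm (y i)]

lemma abs_kernelRegression_sub_le_two_mul_add (hf : IsLink Lf Lf' f) (hh : 0 < h) :
    |kernelRegression m h W ϑ x (fun i => f (inner ℝ (x i) θ) + ε i) (inner ℝ u ϑ)
        - f (inner ℝ u θ)| ≤
      2 * Lf +
      |∑ i, kernelWeight h (inner ℝ (u - m) ϑ) (fun i => inner ℝ (x i - m) ϑ) i * ε i| := by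
  rw [kernelRegression_inner hh]
  set w := kernelWeight h (inner ℝ (u - m) ϑ) fun i => inner ℝ (x i - m) ϑ
  have hfu := hf.abs_le (inner ℝ u θ)
  split_ifs
  · have hmean : |∑ i, w i * f (inner ℝ (x i) θ)| ≤ Lf :=
      abs_sum_kernelWeight_mul_le hf.nonneg fun i _ => hf.abs_le _
    simp_rw [mul_add, Finset.sum_add_distrib]
    have := abs_sub (∑ i, w i * f (inner ℝ (x i) θ) + ∑ i, w i * ε i) (f (inner ℝ u θ))
    have := abs_add_le (∑ i, w i * f (inner ℝ (x i) θ)) (∑ i, w i * ε i)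
    linarith
  · rw [zero_sub, abs_neg]
    linarith [hf.nonneg, abs_nonneg (∑ i, w i * ε i)]

lemma IsLink.abs_sum_mul_add_sub_le {ι : Type*} [Fintype ι] (hf : IsLink Lf Lf' f) {w : ι → ℝ}
    (hw : ∀ i, 0 ≤ w i) (hw1 : ∑ i, w i = 1) (a ε : ι → ℝ) (b : ℝ) :
    |∑ i, w i * (f (a i) + ε i) - f b| ≤ |∑ i, w i * ε i| + Lf' * ∑ i, w i * |a i - b| := by
  have hsplit : ∑ i, w i * (f (a i) + ε i) - f b =
      ∑ i, w i * ε i + ∑ i, w i * (f (a i) - f b) := by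
    simp_rw [mul_sub, mul_add, Finset.sum_add_distrib, Finset.sum_sub_distrib, ← Finset.sum_mul,
      hw1]
    ring
  rw [hsplit, Finset.mul_sum]
  refine (abs_add_le _ _).trans (add_le_add_right ((Finset.abs_sum_le_sum_abs _ _).trans
    (Finset.sum_le_sum fun i _ => ?_)) _)
  rw [abs_mul, abs_of_nonneg (hw i), mul_left_comm]
  exact mul_le_mul_of_nonneg_left (hf.abs_sub_le _ _) (hw i)

lemma abs_kernelRegression_sub_le (hf : IsLink Lf Lf' f) (hh : 0 < h) :
    |kernelRegression m h W ϑ x (fun i => f (inner ℝ (x i) θ) + ε i) (inner ℝ u ϑ)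
        - f (inner ℝ u θ)| ≤
      {s : ℝ | W ≤ |s|}.indicator (fun _ => Lf) (inner ℝ (u - m) ϑ) +
      Lf / √(max 1 (windowCount h (inner ℝ (u - m) ϑ) fun i => inner ℝ (x i - m) ϑ)) +
      |∑ i, kernelWeight h (inner ℝ (u - m) ϑ) (fun i => inner ℝ (x i - m) ϑ) i * ε i| +
      Lf' * ∑ i, kernelWeight h (inner ℝ (u - m) ϑ) (fun i => inner ℝ (x i - m) ϑ) i *
        |inner ℝ (x i - u) θ| := by
  have hLf := hf.nonneg
  have hLf' := hf.deriv_nonneg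
  have hfu := hf.abs_le (inner ℝ u θ)
  rw [kernelRegression_inner hh]
  set p : Fin n → ℝ := fun i => inner ℝ (x i - m) ϑ
  set t : ℝ := inner ℝ (u - m) ϑ
  set w := kernelWeight h t p
  have hbias : 0 ≤ Lf' * ∑ i, w i * |inner ℝ (x i - u) θ| :=
    mul_nonneg hLf' (Finset.sum_nonneg fun i _ => mul_nonneg (kernelWeight_nonneg i) (abs_nonneg _))
  have hnoise := abs_nonneg (∑ i, w i * ε i)
  have hempty : 0 ≤ Lf / √(max 1 (windowCount h t p)) := by positivity
  have htrunc : 0 ≤ {s : ℝ | W ≤ |s|}.indicator (fun _ => Lf) t :=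
    Set.indicator_nonneg (fun _ _ => hLf) _
  split_ifs with ht
  · by_cases hN : windowCount h t p = 0
    · have hest : ∑ i, w i * (f (inner ℝ (x i) θ) + ε i) = 0 :=
        Finset.sum_eq_zero fun i _ => mul_eq_zero_of_left (kernelWeight_eq_zero hN i) _
      simp only [hest, zero_sub, abs_neg, hN, zero_le_one, sup_of_le_left, Real.sqrt_one, div_one]
      linarith
    · have hest := hf.abs_sum_mul_add_sub_le (w := w) (fun i => kernelWeight_nonneg i)
        (sum_kernelWeight hN) (fun i => inner ℝ (x i) θ) ε (inner ℝ u θ)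
      simp_rw [← inner_sub_left] at hest
      linarith
  · have hW : {s : ℝ | W ≤ |s|}.indicator (fun _ => Lf) t = Lf :=
      Set.indicator_of_mem (s := {s : ℝ | W ≤ |s|}) (not_le.1 ht).le _
    rw [zero_sub, abs_neg, hW]
    linarith

lemma sum_kernelWeight_mul_abs_inner_sub_le {a : ℝ} (hθ : θ = a • ϑ + r) (hh : 0 ≤ h) :
    ∑ i, kernelWeight h (inner ℝ (u - m) ϑ) (fun i => inner ℝ (x i - m) ϑ) i *
        |inner ℝ (x i - u) θ| ≤
      |a| * h + |inner ℝ (u - m) r| +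
      ∑ i, kernelWeight h (inner ℝ (u - m) ϑ) (fun i => inner ℝ (x i - m) ϑ) i *
        |inner ℝ (x i - m) r| := by
  set p : Fin n → ℝ := fun i => inner ℝ (x i - m) ϑ
  set t : ℝ := inner ℝ (u - m) ϑ
  have hinner : ∀ i, |t - p i| ≤ h → |(inner ℝ (x i - u) θ : ℝ)| ≤
      |a| * h + |inner ℝ (u - m) r| + |inner ℝ (x i - m) r| := fun i hi => by
    have hsplit : (inner ℝ (x i - u) θ : ℝ) =
        a * (p i - t) + (inner ℝ (x i - m) r - inner ℝ (u - m) r) := by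
      rw [hθ, ← sub_sub_sub_cancel_right (x i) u m, inner_sub_left, inner_add_right,
        inner_add_right, inner_smul_right, inner_smul_right]
      ring
    have hap : |a * (p i - t)| ≤ |a| * h := by
      rw [abs_mul, abs_sub_comm]
      gcongr
    rw [hsplit]
    linarith [abs_add_le (a * (p i - t)) (inner ℝ (x i - m) r - inner ℝ (u - m) r),
      abs_sub (inner ℝ (x i - m) r : ℝ) (inner ℝ (u - m) r)]
  refine (Finset.sum_le_sum fun i _ => kernelWeight_mul_le_mul (hinner i)).trans ?_
  simp_rw [mul_add _ (_ + _), Finset.sum_add_distrib, ← Finset.sum_mul]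
  gcongr
  exact mul_le_of_le_one_left (by positivity) sum_kernelWeight_le_one

end KernelRegression

section MeanBounds

variable {α : Type*} {mα : MeasurableSpace α} {μ : Measure α} {g₁ g₂ : α → ℝ} {a₁ a₂ : ℝ}

lemma lintegral_ofReal_add_le (hg₂ : Measurable g₂) (ha₁ : 0 ≤ a₁) (ha₂ : 0 ≤ a₂)
    (h₁ : ∫⁻ x, ENNReal.ofReal (g₁ x) ∂μ ≤ ENNReal.ofReal a₁)
    (h₂ : ∫⁻ x, ENNReal.ofReal (g₂ x) ∂μ ≤ ENNReal.ofReal a₂) :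
    ∫⁻ x, ENNReal.ofReal (g₁ x + g₂ x) ∂μ ≤ ENNReal.ofReal (a₁ + a₂) := by
  refine (lintegral_mono fun x => ENNReal.ofReal_add_le).trans ?_
  rw [lintegral_add_right _ hg₂.ennreal_ofReal, ENNReal.ofReal_add ha₁ ha₂]
  exact add_le_add h₁ h₂

lemma lintegral_ofReal_const_mul_le {c : ℝ} (hc : 0 ≤ c)
    (h₁ : ∫⁻ x, ENNReal.ofReal (g₁ x) ∂μ ≤ ENNReal.ofReal a₁) :
    ∫⁻ x, ENNReal.ofReal (c * g₁ x) ∂μ ≤ ENNReal.ofReal (c * a₁) := by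
  simp_rw [ENNReal.ofReal_mul hc]
  rw [lintegral_const_mul' _ _ ENNReal.ofReal_ne_top]
  gcongr

lemma lintegral_ofReal_const_le [IsProbabilityMeasure μ] (c : ℝ) :
    ∫⁻ _, ENNReal.ofReal c ∂μ ≤ ENNReal.ofReal c := by
  rw [lintegral_const, measure_univ, mul_one]

end MeanBounds

section Noise

/-- The laws of the admissible noises: centred, with variance at most `σ²`. -/
structure IsNoiseLaw (σ : ℝ) (ν : Measure ℝ) : Prop where
  memLp : MemLp id 2 ν
  integral_eq_zero : ∫ t, t ∂ν = 0
  variance_le : Var[id; ν] ≤ σ ^ 2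

variable {ι : Type*} [Fintype ι] {ν : ι → Measure ℝ} [∀ i, IsProbabilityMeasure (ν i)] {σ : ℝ}

lemma integral_sum_mul_noise_sq_le (hν : ∀ i, IsNoiseLaw σ (ν i)) (w : ι → ℝ) :
    ∫ ε, (∑ i, w i * ε i) ^ 2 ∂Measure.pi ν ≤ σ ^ 2 * ∑ i, w i ^ 2 := by
  have hL2 : ∀ i, MemLp (fun ε : ι → ℝ => w i * ε i) 2 (Measure.pi ν) := fun i =>
    ((hν i).memLp.comp_measurePreserving (measurePreserving_eval ν i)).const_mul (w i)
  have hmean : ∫ ε, ∑ i, w i * ε i ∂Measure.pi ν = 0 := by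
    rw [integral_finsetSum _ fun i _ => (hL2 i).integrable one_le_two]
    refine Finset.sum_eq_zero fun i _ => ?_
    rw [integral_const_mul, integral_comp_eval (μ := ν) (f := fun s : ℝ => s) (by fun_prop),
      (hν i).integral_eq_zero, mul_zero]
  have hvar := variance_sum_pi (μ := ν) (X := fun i t => w i * t)
    fun i => (hν i).memLp.const_mul (w i)
  rw [Finset.sum_fn, variance_of_integral_eq_zero
    (memLp_finsetSum _ fun i _ => hL2 i).aestronglyMeasurable.aemeasurable hmean] at hvar
  rw [hvar, Finset.mul_sum]
  refine Finset.sum_le_sum fun i _ => ?_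
  rw [variance_const_mul, mul_comm]
  exact mul_le_mul_of_nonneg_right (hν i).variance_le (sq_nonneg _)

lemma lintegral_abs_sum_mul_noise_le (hν : ∀ i, IsNoiseLaw σ (ν i)) (hσ : 0 ≤ σ) (w : ι → ℝ) :
    ∫⁻ ε, ENNReal.ofReal |∑ i, w i * ε i| ∂Measure.pi ν ≤
      ENNReal.ofReal (σ * √(∑ i, w i ^ 2)) := by
  refine lintegral_ofReal_abs_le (memLp_finsetSum _ fun i _ => ((hν i).memLp.comp_measurePreserving
    (measurePreserving_eval ν i)).const_mul (w i)) (by positivity) ?_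
  rw [mul_pow, Real.sq_sqrt (Finset.sum_nonneg fun i _ => sq_nonneg _)]
  exact integral_sum_mul_noise_sq_le hν w

end Noise

section Counts

lemma inv_sqrt_max_one_le {a N : ℝ} (ha : 0 < a) :
    1 / √(max 1 N) ≤ 2 / √a + 2 / (a * √a) * (N - a) ^ 2 := by
  have hs : 0 < √a := Real.sqrt_pos.2 ha
  have hN1 : 1 / √(max 1 N) ≤ 1 :=
    div_le_one_of_le₀ (Real.one_le_sqrt.2 (le_max_left _ _)) (Real.sqrt_nonneg _)
  obtain hN | hN := le_or_gt (a / 4) N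
  · have hhalf : √a / 2 ≤ √(max 1 N) := by
      refine Real.le_sqrt_of_sq_le ?_
      rw [div_pow, Real.sq_sqrt ha.le]
      exact le_max_of_le_right (by linarith)
    calc 1 / √(max 1 N) ≤ 1 / (√a / 2) := by gcongr
      _ = 2 / √a := by rw [one_div_div]
      _ ≤ _ := le_add_of_nonneg_right (by positivity)
  · have hdev : (9 / 16) * a ^ 2 ≤ (N - a) ^ 2 := by nlinarith
    have hsum : 1 ≤ 2 / √a + 9 / 8 * √a := by
      rw [← sub_le_iff_le_add, le_div_iff₀ hs]
      nlinarith [sq_nonneg (√a - 1)]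
    calc 1 / √(max 1 N) ≤ 2 / √a + 9 / 8 * √a := hN1.trans hsum
      _ = 2 / √a + 2 / (a * √a) * ((9 / 16) * a ^ 2) := by
          field_simp
          rw [Real.sq_sqrt ha.le]
          ring
      _ ≤ _ := by gcongr

lemma lintegral_inv_sqrt_max_one_le {Ω : Type*} {mΩ : MeasurableSpace Ω} {P : Measure Ω}
    [IsProbabilityMeasure P] {N : Ω → ℝ} (hN : MemLp N 2 P) (hpos : 0 < P[N])
    (hvar : Var[N; P] ≤ P[N]) :
    ∫⁻ ω, ENNReal.ofReal (1 / √(max 1 (N ω))) ∂P ≤ ENNReal.ofReal (4 / √(P[N])) := by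
  set a := P[N]
  have hsq : ∫⁻ ω, ENNReal.ofReal ((N ω - a) ^ 2) ∂P ≤ ENNReal.ofReal a := by
    have hint : Integrable (fun ω => (N ω - a) ^ 2) P := (hN.sub (memLp_const a)).integrable_sq
    rw [← ofReal_integral_eq_lintegral_ofReal hint (ae_of_all _ fun ω => sq_nonneg _),
      ← variance_eq_integral hN.aestronglyMeasurable.aemeasurable]
    exact ENNReal.ofReal_le_ofReal hvar
  calc ∫⁻ ω, ENNReal.ofReal (1 / √(max 1 (N ω))) ∂P
      ≤ ∫⁻ ω, ENNReal.ofReal (2 / (a * √a) * (N ω - a) ^ 2 + 2 / √a) ∂P :=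
        lintegral_mono fun ω => ENNReal.ofReal_le_ofReal
          ((inv_sqrt_max_one_le hpos).trans_eq (add_comm _ _))
    _ ≤ ENNReal.ofReal (2 / (a * √a) * a + 2 / √a) :=
        lintegral_ofReal_add_le measurable_const (by positivity) (by positivity)
          (lintegral_ofReal_const_mul_le (by positivity) hsq) (lintegral_ofReal_const_le _)
    _ = ENNReal.ofReal (4 / √a) := by
        congr 1
        field_simp
        norm_num

variable {ι α : Type*} [Fintype ι] {mα : MeasurableSpace α} {D : Measure α} [IsProbabilityMeasure D]

lemma integral_sum_indicator_one {B : Set α} (hB : MeasurableSet B) :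
    ∫ x : ι → α, ∑ i, B.indicator 1 (x i) ∂Measure.pi (fun _ => D) =
      Fintype.card ι * D.real B := by
  have hind : Integrable (B.indicator (1 : α → ℝ)) D := (integrable_const 1).indicator hB
  have hint : ∀ i, Integrable (fun x : ι → α => B.indicator (1 : α → ℝ) (x i))
      (Measure.pi fun _ => D) := fun i =>
    (measurePreserving_eval (fun _ => D) i).integrable_comp_of_integrable hind
  rw [integral_finsetSum _ fun i _ => hint i]
  simp_rw [integral_comp_eval (μ := fun _ : ι => D) hind.aestronglyMeasurable,
    integral_indicator_one hB]
  simp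

lemma memLp_indicator_one {B : Set α} (hB : MeasurableSet B) :
    MemLp (B.indicator (1 : α → ℝ)) 2 D := (memLp_const 1).indicator hB

lemma variance_sum_indicator_one_le {B : Set α} (hB : MeasurableSet B) :
    Var[fun x : ι → α => ∑ i, B.indicator 1 (x i); Measure.pi fun _ => D] ≤
      Fintype.card ι * D.real B := by
  have hvar := variance_sum_pi (μ := fun _ : ι => D) (X := fun _ => B.indicator (1 : α → ℝ))
    fun _ => memLp_indicator_one hB
  rw [Finset.sum_fn] at hvar
  rw [hvar, Finset.sum_const, Finset.card_univ, nsmul_eq_mul]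
  gcongr
  refine (variance_le_expectation_sq
    (memLp_indicator_one hB).aestronglyMeasurable).trans_eq ?_
  rw [← integral_indicator_one hB]
  congr 1 with x
  by_cases hx : x ∈ B <;> simp [hx]

lemma lintegral_inv_sqrt_max_one_sum_indicator_le [Nonempty ι] {B : Set α} (hB : MeasurableSet B)
    (hDB : 0 < D.real B) :
    ∫⁻ x : ι → α, ENNReal.ofReal (1 / √(max 1 (∑ i, B.indicator 1 (x i))))
        ∂Measure.pi (fun _ => D) ≤
      ENNReal.ofReal (4 / √(Fintype.card ι * D.real B)) := by
  have hmean := integral_sum_indicator_one (ι := ι) (D := D) hB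
  have : (0 : ℝ) < Fintype.card ι := by exact_mod_cast Fintype.card_pos
  rw [← hmean]
  refine lintegral_inv_sqrt_max_one_le (memLp_finsetSum _ fun i _ =>
    (memLp_indicator_one hB).comp_measurePreserving (measurePreserving_eval (fun _ => D) i)) ?_ ?_
  · rw [hmean]
    positivity
  · rw [hmean]
    exact variance_sum_indicator_one_le hB

end Counts

section RandomWeights

variable {ι α β γ : Type*} [Fintype ι] {mα : MeasurableSpace α} {mβ : MeasurableSpace β}
  {mγ : MeasurableSpace γ} {D : Measure α} [IsProbabilityMeasure D]

lemma indepFun_pi_of_indepFun {p : α → β} {q : α → γ} (hp : Measurable p) (hq : Measurable q)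
    (hpq : IndepFun p q D) :
    IndepFun (fun (x : ι → α) i => p (x i)) (fun (x : ι → α) i => q (x i))
      (Measure.pi fun _ => D) := by
  have := Measure.isProbabilityMeasure_map (μ := D) hp.aemeasurable
  have := Measure.isProbabilityMeasure_map (μ := D) hq.aemeasurable
  have := Measure.isProbabilityMeasure_map (μ := D) (hp.prodMk hq).aemeasurable
  have hpi : Measurable fun (x : ι → α) i => p (x i) := by fun_prop
  have hqi : Measurable fun (x : ι → α) i => q (x i) := by fun_prop
  rw [indepFun_iff_map_prod_eq_prod_map_map hpi.aemeasurable hqi.aemeasurable,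
    Measure.pi_map_pi (f := fun _ => p) (fun _ => hp.aemeasurable),
    Measure.pi_map_pi (f := fun _ => q) (fun _ => hq.aemeasurable),
    ← (measurePreserving_arrowProdEquivProdArrow β γ ι (fun _ => D.map p)
      (fun _ => D.map q)).map_eq,
    ← (indepFun_iff_map_prod_eq_prod_map_map hp.aemeasurable hq.aemeasurable).1 hpq,
    ← Measure.pi_map_pi (f := fun _ : ι => fun x => (p x, q x))
      (fun _ => (hp.prodMk hq).aemeasurable),
    Measure.map_map (MeasurableEquiv.measurable _) (by fun_prop)]
  rfl

lemma lintegral_sum_mul_le_of_indepFun {w : (ι → β) → ι → ENNReal}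
    (hw : ∀ i, Measurable fun b => w b i) (hw1 : ∀ b, ∑ i, w b i ≤ 1) {p : α → β} {q : α → ENNReal}
    (hp : Measurable p) (hq : Measurable q) (hpq : IndepFun p q D) :
    ∫⁻ x, ∑ i, w (fun j => p (x j)) i * q (x i) ∂Measure.pi (fun _ => D) ≤ ∫⁻ a, q a ∂D := by
  have hpm : Measurable fun (x : ι → α) j => p (x j) := by fun_prop
  have hterm : ∀ i, ∫⁻ x, w (fun j => p (x j)) i * q (x i) ∂Measure.pi (fun _ => D) =
      (∫⁻ x, w (fun j => p (x j)) i ∂Measure.pi (fun _ => D)) * ∫⁻ a, q a ∂D := fun i => by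
    have hind := (indepFun_pi_of_indepFun (ι := ι) hp hq hpq).comp (hw i) (measurable_pi_apply i)
    rw [← (measurePreserving_eval (fun _ => D) i).lintegral_comp hq]
    exact lintegral_mul_eq_lintegral_mul_lintegral_of_indepFun ((hw i).comp hpm) (by fun_prop) hind
  have hwm : ∀ i, Measurable fun x : ι → α => w (fun j => p (x j)) i := fun i => (hw i).comp hpm
  have hwq : ∀ i, Measurable fun x : ι → α => w (fun j => p (x j)) i * q (x i) := fun i =>
    (hwm i).mul (by fun_prop)
  rw [lintegral_finsetSum _ fun i _ => hwq i]
  simp_rw [hterm, ← Finset.sum_mul]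
  rw [← lintegral_finsetSum _ fun i _ => hwm i]
  refine mul_le_of_le_one_left zero_le ((lintegral_mono fun x => hw1 _).trans ?_)
  rw [lintegral_one, measure_univ]

end RandomWeights

section FixedDirection

variable {n d : ℕ} {m θ ϑ r u : EuclideanSpace ℝ (Fin d)} {Q : Matrix (Fin d) (Fin d) ℝ}
  {f : ℝ → ℝ} {Lf Lf' σ a h W : ℝ} {ν : Fin n → Measure ℝ} [∀ i, IsProbabilityMeasure (ν i)]

/-- The mean absolute prediction error of kernel regression in a fixed direction `ϑ`, when the true
direction is `θ`, over a new context `u`, the design `x` and the noise `ε`. It is a Lebesgue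
integral, so that no integrability has to be known beforehand. -/
noncomputable def risk (f : ℝ → ℝ) (θ m : EuclideanSpace ℝ (Fin d)) (Q : Matrix (Fin d) (Fin d) ℝ)
    (h W : ℝ) (ν : Fin n → Measure ℝ) (ϑ : EuclideanSpace ℝ (Fin d)) : ENNReal :=
  ∫⁻ u, ∫⁻ x, ∫⁻ ε, ENNReal.ofReal
    |kernelRegression m h W ϑ x (fun i => f (inner ℝ (x i) θ) + ε i) (inner ℝ u ϑ)
      - f (inner ℝ u θ)|
    ∂Measure.pi ν ∂Measure.pi (fun _ => multivariateGaussian m Q) ∂multivariateGaussian m Q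

lemma risk_le_two_mul_add (hf : IsLink Lf Lf' f) (hν : ∀ i, IsNoiseLaw σ (ν i)) (hσ : 0 ≤ σ)
    (hh : 0 < h) : risk f θ m Q h W ν ϑ ≤ ENNReal.ofReal (2 * Lf + σ) := by
  have hLf := hf.nonneg
  refine le_trans (lintegral_mono fun u => ?_) (lintegral_ofReal_const_le _)
  refine le_trans (lintegral_mono fun x => ?_) (lintegral_ofReal_const_le _)
  refine (lintegral_mono fun ε => ENNReal.ofReal_le_ofReal
    (abs_kernelRegression_sub_le_two_mul_add hf hh)).trans ?_
  refine lintegral_ofReal_add_le (by fun_prop) (by positivity) hσ (lintegral_ofReal_const_le _)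
    ((lintegral_abs_sum_mul_noise_le hν hσ _).trans (ENNReal.ofReal_le_ofReal ?_))
  exact mul_le_of_le_one_right hσ (Real.sqrt_le_one.2 sum_kernelWeight_sq_le_one)

lemma lintegral_noise_abs_kernelRegression_sub_le (hf : IsLink Lf Lf' f)
    (hν : ∀ i, IsNoiseLaw σ (ν i)) (hσ : 0 ≤ σ) (hh : 0 < h) (hθ : θ = a • ϑ + r)
    (x : Fin n → EuclideanSpace ℝ (Fin d)) :
    ∫⁻ ε, ENNReal.ofReal |kernelRegression m h W ϑ x (fun i => f (inner ℝ (x i) θ) + ε i)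
        (inner ℝ u ϑ) - f (inner ℝ u θ)| ∂Measure.pi ν ≤
      ENNReal.ofReal ({s : ℝ | W ≤ |s|}.indicator (fun _ => Lf) (inner ℝ (u - m) ϑ) +
        Lf' * (|a| * h + |inner ℝ (u - m) r|) +
        (Lf + σ) * (1 / √(max 1 (windowCount h (inner ℝ (u - m) ϑ)
          fun i => inner ℝ (x i - m) ϑ))) +
        Lf' * ∑ i, kernelWeight h (inner ℝ (u - m) ϑ) (fun i => inner ℝ (x i - m) ϑ) i *
          |inner ℝ (x i - m) r|) := by
  have hLf := hf.nonneg
  have hLf' := hf.deriv_nonneg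
  have herr := fun ε => abs_kernelRegression_sub_le (m := m) (θ := θ) (ϑ := ϑ) (u := u) (W := W)
    (x := x) (ε := ε) hf hh
  have hbias := sum_kernelWeight_mul_abs_inner_sub_le (m := m) (u := u) (x := x) hθ hh.le
  set p : Fin n → ℝ := fun i => inner ℝ (x i - m) ϑ
  set t : ℝ := inner ℝ (u - m) ϑ
  set w := kernelWeight h t p
  set T := {s : ℝ | W ≤ |s|}.indicator (fun _ => Lf) t
  set ψ := 1 / √(max 1 (windowCount h t p))
  set B := ∑ i, w i * |inner ℝ (x i - m) r|
  have hT : 0 ≤ T := Set.indicator_nonneg (fun _ _ => hLf) _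
  have hB : 0 ≤ B := Finset.sum_nonneg fun i _ => mul_nonneg (kernelWeight_nonneg i) (abs_nonneg _)
  have : 0 ≤ ψ := by positivity
  calc _ ≤ ∫⁻ ε, ENNReal.ofReal (T + Lf * ψ + Lf' * (|a| * h + |inner ℝ (u - m) r| + B) +
        |∑ i, w i * ε i|) ∂Measure.pi ν := lintegral_mono fun ε => ENNReal.ofReal_le_ofReal <| by
        have hψ_eq : Lf / √(max 1 (windowCount h t p)) = Lf * ψ := div_eq_mul_one_div _ _
        linarith [herr ε, mul_le_mul_of_nonneg_left hbias hLf']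
    _ ≤ ENNReal.ofReal (T + Lf * ψ + Lf' * (|a| * h + |inner ℝ (u - m) r| + B) + σ * ψ) :=
        lintegral_ofReal_add_le (by fun_prop) (by positivity) (by positivity)
          (lintegral_ofReal_const_le _) ((lintegral_abs_sum_mul_noise_le hν hσ w).trans
            (ENNReal.ofReal_le_ofReal (by gcongr; exact sqrt_sum_kernelWeight_sq_le)))
    _ = _ := by congr 1; ring

lemma lintegral_inv_sqrt_max_one_windowCount_le (hQ : Q.PosSemidef) (hn : 0 < n) (t : ℝ)
    (ht : 0 < windowMass (‖sqrtMul Q ϑ‖₊ ^ 2) h t) :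
    ∫⁻ x : Fin n → EuclideanSpace ℝ (Fin d), ENNReal.ofReal
        (1 / √(max 1 (windowCount h t fun i => inner ℝ (x i - m) ϑ)))
        ∂Measure.pi (fun _ => multivariateGaussian m Q) ≤
      ENNReal.ofReal (4 * (1 / √(n * windowMass (‖sqrtMul Q ϑ‖₊ ^ 2) h t))) := by
  have hproj : Measurable fun x : EuclideanSpace ℝ (Fin d) => (inner ℝ (x - m) ϑ : ℝ) := by fun_prop
  have hwin : MeasurableSet {s : ℝ | |t - s| ≤ h} := measurableSet_le (by fun_prop) (by fun_prop)
  have hmass : windowMass (‖sqrtMul Q ϑ‖₊ ^ 2) h t =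
      (multivariateGaussian m Q).real {x | |t - inner ℝ (x - m) ϑ| ≤ h} := by
    rw [windowMass, ← map_inner_sub_eq_gaussianReal (m := m) hQ, map_measureReal_apply hproj hwin]
    rfl
  have : Nonempty (Fin n) := Fin.pos_iff_nonempty.1 hn
  rw [hmass] at ht ⊢
  rw [mul_one_div]
  have hcount := lintegral_inv_sqrt_max_one_sum_indicator_le (ι := Fin n) (hproj hwin) ht
  rw [Fintype.card_fin] at hcount
  exact hcount

lemma lintegral_sum_kernelWeight_mul_abs_inner_le (hQ : Q.PosSemidef)
    (hϑr : inner ℝ (sqrtMul Q ϑ) (sqrtMul Q r) = 0) (t : ℝ) :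
    ∫⁻ x : Fin n → EuclideanSpace ℝ (Fin d), ENNReal.ofReal (∑ i,
        kernelWeight h t (fun i => inner ℝ (x i - m) ϑ) i * |inner ℝ (x i - m) r|)
        ∂Measure.pi (fun _ => multivariateGaussian m Q) ≤ ENNReal.ofReal ‖sqrtMul Q r‖ := by
  have hsum : ∀ x : Fin n → EuclideanSpace ℝ (Fin d), ENNReal.ofReal (∑ i,
      kernelWeight h t (fun i => inner ℝ (x i - m) ϑ) i * |inner ℝ (x i - m) r|) =
      ∑ i, ENNReal.ofReal (kernelWeight h t (fun i => inner ℝ (x i - m) ϑ) i) *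
        ENNReal.ofReal |inner ℝ (x i - m) r| := fun x => by
    rw [ENNReal.ofReal_sum_of_nonneg fun i _ => mul_nonneg (kernelWeight_nonneg i) (abs_nonneg _)]
    exact Finset.sum_congr rfl fun i _ => ENNReal.ofReal_mul (kernelWeight_nonneg i)
  simp_rw [hsum]
  refine (lintegral_sum_mul_le_of_indepFun (w := fun p i => ENNReal.ofReal (kernelWeight h t p i))
    (p := fun x => (inner ℝ (x - m) ϑ : ℝ)) (q := fun x => ENNReal.ofReal |inner ℝ (x - m) r|)
    (fun i => (measurable_kernelWeight h t i).ennreal_ofReal) (fun p => ?_) (by fun_prop)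
    (by fun_prop) ?_).trans (lintegral_abs_inner_sub_le hQ r)
  · rw [← ENNReal.ofReal_sum_of_nonneg fun i _ => kernelWeight_nonneg i, ENNReal.ofReal_le_one]
    exact sum_kernelWeight_le_one
  · exact (indepFun_inner_sub hQ hϑr).comp (φ := id) (ψ := fun s => ENNReal.ofReal |s|)
      measurable_id (by fun_prop)

lemma lintegral_sample_abs_kernelRegression_sub_le (hQ : Q.PosSemidef) (hn : 0 < n)
    (hf : IsLink Lf Lf' f) (hν : ∀ i, IsNoiseLaw σ (ν i)) (hσ : 0 ≤ σ) (hh : 0 < h)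
    (hθ : θ = a • ϑ + r) (hϑr : inner ℝ (sqrtMul Q ϑ) (sqrtMul Q r) = 0)
    (hu : 0 < windowMass (‖sqrtMul Q ϑ‖₊ ^ 2) h (inner ℝ (u - m) ϑ)) :
    ∫⁻ x, ∫⁻ ε, ENNReal.ofReal |kernelRegression m h W ϑ x (fun i => f (inner ℝ (x i) θ) + ε i)
        (inner ℝ u ϑ) - f (inner ℝ u θ)| ∂Measure.pi ν
        ∂Measure.pi (fun _ => multivariateGaussian m Q) ≤
      ENNReal.ofReal ({s : ℝ | W ≤ |s|}.indicator (fun _ => Lf) (inner ℝ (u - m) ϑ) +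
        Lf' * (|a| * h + |inner ℝ (u - m) r|) +
        (Lf + σ) * (4 * (1 / √(n * windowMass (‖sqrtMul Q ϑ‖₊ ^ 2) h (inner ℝ (u - m) ϑ)))) +
        Lf' * ‖sqrtMul Q r‖) := by
  have hLf := hf.nonneg
  have hLf' := hf.deriv_nonneg
  have htrunc : 0 ≤ {s : ℝ | W ≤ |s|}.indicator (fun _ => Lf) (inner ℝ (u - m) ϑ) :=
    Set.indicator_nonneg (fun _ _ => hLf) _
  have hproj : Measurable fun (x : Fin n → EuclideanSpace ℝ (Fin d)) i =>
      (inner ℝ (x i - m) ϑ : ℝ) := by fun_prop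
  have hcount : Measurable fun x : Fin n → EuclideanSpace ℝ (Fin d) =>
      windowCount h (inner ℝ (u - m) ϑ) fun i => inner ℝ (x i - m) ϑ :=
    (measurable_windowCount _ _).comp hproj
  have hweight : ∀ i, Measurable fun x : Fin n → EuclideanSpace ℝ (Fin d) =>
      kernelWeight h (inner ℝ (u - m) ϑ) (fun i => inner ℝ (x i - m) ϑ) i := fun i =>
    (measurable_kernelWeight _ _ i).comp hproj
  refine (lintegral_mono fun x =>
    lintegral_noise_abs_kernelRegression_sub_le hf hν hσ hh hθ x).trans ?_
  refine lintegral_ofReal_add_le (by fun_prop) (by positivity) (by positivity)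
    (lintegral_ofReal_add_le (by fun_prop) (by positivity) (by positivity)
      (lintegral_ofReal_const_le _) (lintegral_ofReal_const_mul_le (by positivity) ?_))
    (lintegral_ofReal_const_mul_le hLf' ?_)
  · exact lintegral_inv_sqrt_max_one_windowCount_le hQ hn _ hu
  · exact lintegral_sum_kernelWeight_mul_abs_inner_le hQ hϑr _

lemma lintegral_indicator_le_abs_inner_sub_le (hQ : Q.PosSemidef) (hϑ1 : ‖sqrtMul Q ϑ‖ ≤ 1)
    (hW : 0 ≤ W) {C : ℝ} (hC : 0 ≤ C) :
    ∫⁻ u, ENNReal.ofReal ({s : ℝ | W ≤ |s|}.indicator (fun _ => C) (inner ℝ (u - m) ϑ))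
        ∂multivariateGaussian m Q ≤ ENNReal.ofReal (C * (2 * Real.exp (-W ^ 2 / 2))) := by
  have hmeas : MeasurableSet {s : ℝ | W ≤ |s|} := measurableSet_le (by fun_prop) (by fun_prop)
  have htail := measureReal_abs_ge_le_of_hasSubgaussianMGF
    (hasSubgaussianMGF_id_gaussianReal (v := ‖sqrtMul Q ϑ‖₊ ^ 2) (pow_le_one₀ zero_le hϑ1)) hW
  have hind : ∀ s : ℝ, ENNReal.ofReal ({s : ℝ | W ≤ |s|}.indicator (fun _ => C) s) =
      ENNReal.ofReal C * {s : ℝ | W ≤ |s|}.indicator 1 s := fun s => by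
    by_cases hs : W ≤ |s| <;> simp [hs]
  simp_rw [hind]
  rw [lintegral_const_mul' _ _ ENNReal.ofReal_ne_top, ENNReal.ofReal_mul hC,
    ← lintegral_map (μ := multivariateGaussian m Q) (measurable_one.indicator hmeas)
      (by fun_prop : Measurable fun u => (inner ℝ (u - m) ϑ : ℝ)),
    map_inner_sub_eq_gaussianReal hQ, lintegral_indicator_one hmeas, ← ofReal_measureReal]
  gcongr
  simpa using htail

lemma lintegral_inv_sqrt_windowMass_inner_le (hQ : Q.PosSemidef) (hn : 0 < n) (hh : 0 < h)
    (hh1 : h ≤ 1) (hϑ1 : ‖sqrtMul Q ϑ‖ ≤ 1) (hϑ : ϑ = 0 ∨ h ≤ ‖sqrtMul Q ϑ‖) :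
    ∫⁻ u, ENNReal.ofReal (1 / √(n * windowMass (‖sqrtMul Q ϑ‖₊ ^ 2) h (inner ℝ (u - m) ϑ)))
        ∂multivariateGaussian m Q ≤ ENNReal.ofReal (4 / √(n * h)) := by
  have hn' : (0 : ℝ) < n := by exact_mod_cast hn
  obtain rfl | hϑ := hϑ
  · have hmass : windowMass 0 h 0 = 1 := by simp [windowMass, hh.le, measureReal_def]
    have hzero : sqrtMul Q (0 : EuclideanSpace ℝ (Fin d)) = 0 := by
      rw [sqrtMul_eq_toEuclideanCLM, map_zero]
    simp only [inner_zero_right, hzero, nnnorm_zero, ne_eq, OfNat.ofNat_ne_zero, not_false_eq_true,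
      zero_pow, hmass, mul_one]
    refine (lintegral_ofReal_const_le _).trans (ENNReal.ofReal_le_ofReal ?_)
    gcongr
    · norm_num
    · exact mul_le_of_le_one_right hn'.le hh1
  · set v : NNReal := ‖sqrtMul Q ϑ‖₊ ^ 2 with hv_def
    have hv : v ≠ 0 := pow_ne_zero _ (nnnorm_ne_zero_iff.2 (norm_pos_iff.1 (hh.trans_le hϑ)))
    have hmass := measurable_windowMass v h
    have hexp : Real.exp (h ^ 2 / (4 * v)) ≤ 4 / 3 := by
      have hhv : h ^ 2 ≤ v := by
        rw [hv_def, NNReal.coe_pow, coe_nnnorm]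
        gcongr
      calc Real.exp (h ^ 2 / (4 * v)) ≤ Real.exp (1 / 4) :=
            Real.exp_le_exp.2 ((div_le_div_iff₀ (by positivity) (by norm_num)).2 (by linarith))
        _ = (Real.exp (-(1 / 4)))⁻¹ := by rw [Real.exp_neg, inv_inv]
        _ ≤ (3 / 4)⁻¹ := by gcongr; linarith [Real.add_one_le_exp (-(1 / 4))]
        _ = 4 / 3 := by norm_num
    rw [← lintegral_map (μ := multivariateGaussian m Q)
      (f := fun t => ENNReal.ofReal (1 / √(n * windowMass v h t))) (by fun_prop)
      (by fun_prop : Measurable fun u => (inner ℝ (u - m) ϑ : ℝ)), map_inner_sub_eq_gaussianReal hQ]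
    refine (lintegral_inv_sqrt_windowMass_le hv (pow_le_one₀ zero_le hϑ1) hh hn').trans
      (ENNReal.ofReal_le_ofReal ?_)
    calc _ ≤ 4 / 3 / √(n * h) * 3 := by gcongr
      _ = 4 / √(n * h) := by ring

lemma risk_le_of_inner_eq_zero (hQ : Q.PosSemidef) (hn : 0 < n) (hf : IsLink Lf Lf' f)
    (hν : ∀ i, IsNoiseLaw σ (ν i)) (hσ : 0 ≤ σ) (hh : 0 < h) (hh1 : h ≤ 1) (hW : 0 ≤ W)
    (hϑ1 : ‖sqrtMul Q ϑ‖ ≤ 1) (hϑ : ϑ = 0 ∨ h ≤ ‖sqrtMul Q ϑ‖) (hθ : θ = a • ϑ + r)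
    (hϑr : inner ℝ (sqrtMul Q ϑ) (sqrtMul Q r) = 0) :
    risk f θ m Q h W ν ϑ ≤ ENNReal.ofReal (Lf * (2 * Real.exp (-W ^ 2 / 2)) +
      Lf' * (|a| * h + ‖sqrtMul Q r‖) + (Lf + σ) * (4 * (4 / √(n * h))) + Lf' * ‖sqrtMul Q r‖) := by
  have hLf := hf.nonneg
  have hLf' := hf.deriv_nonneg
  have hmass := measurable_windowMass (‖sqrtMul Q ϑ‖₊ ^ 2) h
  have hpos : ∀ u, 0 < windowMass (‖sqrtMul Q ϑ‖₊ ^ 2) h (inner ℝ (u - m) ϑ) := fun u =>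
    windowMass_pos hh fun hv => hϑ.elim (fun h0 => by rw [h0, inner_zero_right]) fun hle =>
      absurd (pow_eq_zero_iff two_ne_zero |>.1 hv) (nnnorm_ne_zero_iff.2
        (norm_pos_iff.1 (hh.trans_le hle)))
  refine (lintegral_mono fun u => lintegral_sample_abs_kernelRegression_sub_le hQ hn hf hν hσ hh
    hθ hϑr (hpos u)).trans ?_
  refine lintegral_ofReal_add_le measurable_const (by positivity) (by positivity)
    (lintegral_ofReal_add_le (by fun_prop) (by positivity) (by positivity)
      (lintegral_ofReal_add_le (by fun_prop) (by positivity) (by positivity) ?_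
        (lintegral_ofReal_const_mul_le hLf' ?_))
      (lintegral_ofReal_const_mul_le (by positivity)
        (lintegral_ofReal_const_mul_le (by positivity) ?_))) (lintegral_ofReal_const_le _)
  · exact lintegral_indicator_le_abs_inner_sub_le hQ hϑ1 hW hLf
  · exact lintegral_ofReal_add_le (by fun_prop) (by positivity) (norm_nonneg _)
      (lintegral_ofReal_const_le _) (lintegral_abs_inner_sub_le hQ r)
  · exact lintegral_inv_sqrt_windowMass_inner_le hQ hn hh hh1 hϑ1 hϑ

/-- The direction error splits into a multiple of `ϑ`, absorbed into the bandwidth term, and a part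
`Q`-orthogonal to `ϑ`, which is independent of the windows and hence is not divided by `h`. -/
lemma risk_le (hQ : Q.PosSemidef) (hn : 0 < n) (hf : IsLink Lf Lf' f)
    (hν : ∀ i, IsNoiseLaw σ (ν i)) (hσ : 0 ≤ σ) (hh : 0 < h) (hh1 : h ≤ 1) (hW : 0 ≤ W)
    (hϑ1 : ‖sqrtMul Q ϑ‖ ≤ 1) (hϑ : ϑ = 0 ∨ h ≤ ‖sqrtMul Q ϑ‖) {κ : ℝ} (hκ : 0 ≤ κ) :
    risk f θ m Q h W ν ϑ ≤ ENNReal.ofReal (2 * Lf * Real.exp (-W ^ 2 / 2) +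
      Lf' * (κ * h + 3 * ‖sqrtMul Q (θ - κ • ϑ)‖) + 16 * (Lf + σ) / √(n * h)) := by
  obtain ⟨c, r, hcr, hϑr, hch⟩ : ∃ (c : ℝ) (r : EuclideanSpace ℝ (Fin d)), θ - κ • ϑ = c • ϑ + r ∧
      inner ℝ (sqrtMul Q ϑ) (sqrtMul Q r) = 0 ∧ |c| * h ≤ |c| * ‖sqrtMul Q ϑ‖ := by
    obtain rfl | hϑ := hϑ
    · exact ⟨0, θ, by simp, by simp [sqrtMul_eq_toEuclideanCLM], by simp⟩
    · obtain ⟨c, r, hcr, hϑr⟩ := exists_eq_smul_add_inner_sqrtMul_eq_zero Q ϑ (θ - κ • ϑ)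
      exact ⟨c, r, hcr, hϑr, by gcongr⟩
  have hθ : θ = (κ + c) • ϑ + r := by rw [add_smul, add_assoc, ← hcr, add_sub_cancel]
  have hpyth := norm_sqrtMul_smul_add_sq hϑr c
  rw [← hcr] at hpyth
  set E := ‖sqrtMul Q (θ - κ • ϑ)‖
  have hE : 0 ≤ E := norm_nonneg _
  have hcE : |c| * ‖sqrtMul Q ϑ‖ ≤ E :=
    (sq_le_sq₀ (by positivity) hE).1 (by linarith [sq_nonneg ‖sqrtMul Q r‖])
  have hrE : ‖sqrtMul Q r‖ ≤ E :=
    (sq_le_sq₀ (norm_nonneg _) hE).1 (by linarith [sq_nonneg (|c| * ‖sqrtMul Q ϑ‖)])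
  have hbias : |κ + c| * h + 2 * ‖sqrtMul Q r‖ ≤ κ * h + 3 * E := by
    have hκc : |κ + c| * h ≤ (κ + |c|) * h := by
      gcongr
      exact (abs_add_le κ c).trans_eq (by rw [abs_of_nonneg hκ])
    linarith
  refine (risk_le_of_inner_eq_zero hQ hn hf hν hσ hh hh1 hW hϑ1 hϑ hθ hϑr).trans
    (ENNReal.ofReal_le_ofReal ?_)
  calc _ = 2 * Lf * Real.exp (-W ^ 2 / 2) + Lf' * (|κ + c| * h + 2 * ‖sqrtMul Q r‖) +
        16 * (Lf + σ) / √(n * h) := by ring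
    _ ≤ _ := by
        have := mul_le_mul_of_nonneg_left hbias hf.deriv_nonneg
        linarith

end FixedDirection

section TruncatedMean

/-- The truncation of the real number `v` at level `τ`: the coordinates of `trunc τ` are given by
this function. -/
noncomputable def clamp (τ v : ℝ) : ℝ := Real.sign v * min |v| τ

variable {τ : ℝ}

lemma clamp_eq_max_min (hτ : 0 ≤ τ) (v : ℝ) : clamp τ v = max (-τ) (min v τ) := by
  rcases lt_trichotomy v 0 with hv | rfl | hv
  · rw [clamp, Real.sign_of_neg hv, abs_of_neg hv, min_eq_left (hv.le.trans hτ), neg_one_mul,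
      ← max_neg_neg, neg_neg, max_comm]
  · simp [clamp, hτ]
  · rw [clamp, Real.sign_of_pos hv, abs_of_pos hv, one_mul,
      max_eq_right (le_min (by linarith) (by linarith))]

lemma measurable_clamp (hτ : 0 ≤ τ) : Measurable (clamp τ) := by
  simp_rw [funext (clamp_eq_max_min hτ)]
  fun_prop

lemma clamp_neg (τ v : ℝ) : clamp τ (-v) = -clamp τ v := by
  rw [clamp, Real.sign_neg, abs_neg, neg_mul, clamp]

lemma abs_clamp (hτ : 0 ≤ τ) (v : ℝ) : |clamp τ v| = min |v| τ := by
  rcases eq_or_ne v 0 with rfl | hv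
  · simp [clamp, hτ]
  · rw [clamp, abs_mul, abs_of_nonneg (le_min (abs_nonneg v) hτ)]
    rcases Real.sign_apply_eq_of_ne_zero v hv with h | h <;> simp [h]

lemma clamp_sq_le (hτ : 0 ≤ τ) (v : ℝ) : clamp τ v ^ 2 ≤ v ^ 2 := by
  rw [sq_le_sq, abs_clamp hτ]
  exact min_le_left _ _

lemma abs_clamp_sub_le (hτ : 0 < τ) (v : ℝ) : |clamp τ v - v| ≤ v ^ 2 / τ := by
  have hle : ∀ w, clamp τ w ≤ w + w ^ 2 / τ := fun w => by
    rw [clamp_eq_max_min hτ.le]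
    refine max_le ?_ ((min_le_left _ _).trans (le_add_of_nonneg_right (by positivity)))
    rw [← sub_le_iff_le_add', le_div_iff₀ hτ]
    nlinarith [sq_nonneg (w + τ), sq_nonneg w]
  have hneg := hle (-v)
  rw [clamp_neg, neg_sq] at hneg
  exact abs_le.2 ⟨by linarith, by linarith [hle v]⟩

variable {Ω : Type*} [MeasurableSpace Ω] {P : Measure Ω} {b β V : ℝ} {Z : Ω → ℝ}

lemma integral_clamp_sq_le (hτ : 0 ≤ τ) (hZ : MemLp Z 2 P) (hV : ∫ ω, Z ω ^ 2 ∂P ≤ V) :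
    ∫ ω, clamp τ (Z ω) ^ 2 ∂P ≤ V :=
  (integral_mono_of_nonneg (ae_of_all _ fun _ => sq_nonneg _) hZ.integrable_sq
    (ae_of_all _ fun ω => clamp_sq_le hτ (Z ω))).trans hV

variable [IsProbabilityMeasure P]

lemma memLp_clamp (hτ : 0 ≤ τ) (hZ : AEMeasurable Z P) (p : ENNReal) :
    MemLp (fun ω => clamp τ (Z ω)) p P :=
  MemLp.of_bound ((measurable_clamp hτ).comp_aemeasurable hZ).aestronglyMeasurable τ
    (ae_of_all _ fun ω => by rw [Real.norm_eq_abs, abs_clamp hτ]; exact min_le_right _ _)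

lemma abs_integral_clamp_sub_le (hτ : 0 < τ) (hZ : MemLp Z 2 P) (hb : ∫ ω, Z ω ∂P = b)
    (hV : ∫ ω, Z ω ^ 2 ∂P ≤ V) : |∫ ω, clamp τ (Z ω) ∂P - b| ≤ V / τ := by
  have hclamp := (memLp_clamp hτ.le hZ.aestronglyMeasurable.aemeasurable 1).integrable le_rfl
  calc |∫ ω, clamp τ (Z ω) ∂P - b| = |∫ ω, (clamp τ (Z ω) - Z ω) ∂P| := by
        rw [integral_sub hclamp (hZ.integrable one_le_two), hb]
    _ ≤ ∫ ω, |clamp τ (Z ω) - Z ω| ∂P := abs_integral_le_integral_abs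
    _ ≤ ∫ ω, Z ω ^ 2 / τ ∂P := integral_mono_of_nonneg (ae_of_all _ fun _ => abs_nonneg _)
        (hZ.integrable_sq.div_const τ) (ae_of_all _ fun ω => abs_clamp_sub_le hτ (Z ω))
    _ ≤ V / τ := by rw [integral_div]; gcongr

lemma integral_sub_sq_eq_variance_add_sq (hZ : MemLp Z 2 P) (b : ℝ) :
    ∫ ω, (Z ω - b) ^ 2 ∂P = Var[Z; P] + (∫ ω, Z ω ∂P - b) ^ 2 := by
  have hvar := variance_eq_sub (hZ.sub (memLp_const b))
  have hint := integral_sub (hZ.integrable one_le_two) (integrable_const b)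
  simp only [integral_const, probReal_univ, smul_eq_mul, one_mul] at hint
  change Var[fun ω => Z ω - b; P] = ∫ ω, (Z ω - b) ^ 2 ∂P - (∫ ω, (Z ω - b) ∂P) ^ 2 at hvar
  rw [variance_sub_const hZ.aestronglyMeasurable, hint] at hvar
  linarith

lemma mgf_clamp_sub_le (hτ : 0 < τ) (hZ : MemLp Z 2 P) (hb : ∫ ω, Z ω ∂P = b)
    (hV : ∫ ω, Z ω ^ 2 ∂P ≤ V) :
    mgf (fun ω => clamp τ (Z ω) - b) P τ⁻¹ ≤ Real.exp (2 * V / τ ^ 2) := by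
  have hZm := hZ.aestronglyMeasurable.aemeasurable
  have hint : Integrable (fun ω => clamp τ (Z ω)) P := (memLp_clamp hτ.le hZm 1).integrable le_rfl
  have hsq : Integrable (fun ω => clamp τ (Z ω) ^ 2) P := (memLp_clamp hτ.le hZm 2).integrable_sq
  have hlin : Integrable (fun ω => 1 + τ⁻¹ * clamp τ (Z ω)) P :=
    (integrable_const 1).add (hint.const_mul _)
  have hexp : ∀ ω, Real.exp (τ⁻¹ * clamp τ (Z ω)) ≤
      1 + τ⁻¹ * clamp τ (Z ω) + τ⁻¹ ^ 2 * clamp τ (Z ω) ^ 2 := fun ω => by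
    have hle : |τ⁻¹ * clamp τ (Z ω)| ≤ 1 := by
      rw [abs_mul, abs_of_pos (inv_pos.2 hτ), abs_clamp hτ.le, inv_mul_le_one₀ hτ]
      exact min_le_right _ _
    linarith [(abs_le.1 (Real.abs_exp_sub_one_sub_id_le hle)).2,
      mul_pow τ⁻¹ (clamp τ (Z ω)) 2]
  have hmean := (abs_le.1 (abs_integral_clamp_sub_le hτ hZ hb hV)).2
  have hmgf : mgf (fun ω => clamp τ (Z ω)) P τ⁻¹ ≤ Real.exp (τ⁻¹ * (b + V / τ) + τ⁻¹ ^ 2 * V) :=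
    calc _ ≤ ∫ ω, (1 + τ⁻¹ * clamp τ (Z ω) + τ⁻¹ ^ 2 * clamp τ (Z ω) ^ 2) ∂P :=
          integral_mono_of_nonneg (ae_of_all _ fun _ => Real.exp_nonneg _)
            (hlin.add (hsq.const_mul _)) (ae_of_all _ hexp)
      _ = τ⁻¹ * ∫ ω, clamp τ (Z ω) ∂P + τ⁻¹ ^ 2 * ∫ ω, clamp τ (Z ω) ^ 2 ∂P + 1 := by
          rw [integral_add hlin (hsq.const_mul _), integral_add (integrable_const 1)
            (hint.const_mul _), integral_const_mul, integral_const_mul]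
          simp only [integral_const, probReal_univ, smul_eq_mul, mul_one]
          ring
      _ ≤ τ⁻¹ * (b + V / τ) + τ⁻¹ ^ 2 * V + 1 := by
          gcongr
          · linarith
          · exact integral_clamp_sq_le hτ.le hZ hV
      _ ≤ _ := Real.add_one_le_exp _
  calc mgf (fun ω => clamp τ (Z ω) - b) P τ⁻¹
      = mgf (fun ω => clamp τ (Z ω)) P τ⁻¹ * Real.exp (τ⁻¹ * -b) := by
        simp_rw [sub_eq_add_neg]
        exact mgf_add_const _
    _ ≤ Real.exp (τ⁻¹ * (b + V / τ) + τ⁻¹ ^ 2 * V) * Real.exp (τ⁻¹ * -b) := by gcongr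
    _ = Real.exp (2 * V / τ ^ 2) := by
        rw [← Real.exp_add]
        congr 1
        field_simp
        ring

variable {ι : Type*} [Fintype ι] {Y : ι → Ω → ℝ}

lemma integral_average_sub_sq_le [Nonempty ι] (hY : ∀ i, MemLp (Y i) 2 P) (hind : iIndepFun Y P)
    (hβ : ∀ i, |∫ ω, Y i ω ∂P - b| ≤ β) (hV : ∀ i, Var[Y i; P] ≤ V) :
    ∫ ω, ((Fintype.card ι : ℝ)⁻¹ * ∑ i, Y i ω - b) ^ 2 ∂P ≤ V / Fintype.card ι + β ^ 2 := by
  have hcard : (0 : ℝ) < Fintype.card ι := by exact_mod_cast Fintype.card_pos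
  have hsum : MemLp (fun ω => ∑ i, Y i ω) 2 P := memLp_finsetSum _ fun i _ => hY i
  have hvar : Var[fun ω => ∑ i, Y i ω; P] ≤ Fintype.card ι * V :=
    calc Var[fun ω => ∑ i, Y i ω; P] = ∑ i, Var[Y i; P] := by
          rw [← IndepFun.variance_sum (fun i _ => hY i) fun i _ j _ hij => hind.indepFun hij]
          congr 1
          ext ω
          simp
      _ ≤ ∑ _i : ι, V := Finset.sum_le_sum fun i _ => hV i
      _ = Fintype.card ι * V := by simp
  have hbias : |(Fintype.card ι : ℝ)⁻¹ * ∫ ω, ∑ i, Y i ω ∂P - b| ≤ β :=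
    calc _ = |(Fintype.card ι : ℝ)⁻¹ * ∑ i, (∫ ω, Y i ω ∂P - b)| := by
          rw [integral_finsetSum _ fun i _ => (hY i).integrable one_le_two,
            Finset.sum_sub_distrib, mul_sub]
          simp [hcard.ne']
      _ ≤ (Fintype.card ι : ℝ)⁻¹ * ∑ _i : ι, β := by
          rw [abs_mul, abs_of_pos (inv_pos.2 hcard)]
          gcongr
          exact (Finset.abs_sum_le_sum_abs _ _).trans (Finset.sum_le_sum fun i _ => hβ i)
      _ = β := by simp [hcard.ne']
  rw [integral_sub_sq_eq_variance_add_sq (hsum.const_mul _), variance_const_mul,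
    integral_const_mul]
  have hsq := (sq_abs _).symm.trans_le (pow_le_pow_left₀ (abs_nonneg _) hbias 2)
  have hscaled : (Fintype.card ι : ℝ)⁻¹ ^ 2 * Var[fun ω => ∑ i, Y i ω; P] ≤ V / Fintype.card ι :=
    calc _ ≤ (Fintype.card ι : ℝ)⁻¹ ^ 2 * (Fintype.card ι * V) := by gcongr
      _ = V / Fintype.card ι := by field_simp
  exact add_le_add hscaled hsq

lemma integral_average_clamp_sub_sq_le [Nonempty ι] (hτ : 0 < τ) (hY : ∀ i, MemLp (Y i) 2 P)
    (hind : iIndepFun Y P) (hb : ∀ i, ∫ ω, Y i ω ∂P = b) (hV : ∀ i, ∫ ω, Y i ω ^ 2 ∂P ≤ V) :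
    ∫ ω, ((Fintype.card ι : ℝ)⁻¹ * ∑ i, clamp τ (Y i ω) - b) ^ 2 ∂P ≤
      V / Fintype.card ι + (V / τ) ^ 2 := by
  have hclamp : ∀ i, MemLp (fun ω => clamp τ (Y i ω)) 2 P := fun i =>
    memLp_clamp hτ.le (hY i).aestronglyMeasurable.aemeasurable 2
  exact integral_average_sub_sq_le hclamp (hind.comp (fun _ => clamp τ) fun _ =>
    measurable_clamp hτ.le) (fun i => abs_integral_clamp_sub_le hτ (hY i) (hb i) (hV i))
    fun i => (variance_le_expectation_sq (hclamp i).aestronglyMeasurable).trans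
      (integral_clamp_sq_le hτ.le (hY i) (hV i))

lemma measureReal_average_clamp_sub_ge_le [Nonempty ι] (hτ : 0 < τ) (hY : ∀ i, MemLp (Y i) 2 P)
    (hind : iIndepFun Y P) (hb : ∀ i, ∫ ω, Y i ω ∂P = b) (hV : ∀ i, ∫ ω, Y i ω ^ 2 ∂P ≤ V)
    (s : ℝ) :
    P.real {ω | s ≤ (Fintype.card ι : ℝ)⁻¹ * ∑ i, clamp τ (Y i ω) - b} ≤
      Real.exp (Fintype.card ι * (2 * V / τ ^ 2 - s / τ)) := by
  have hcard : (0 : ℝ) < Fintype.card ι := by exact_mod_cast Fintype.card_pos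
  set D : ι → Ω → ℝ := fun i ω => clamp τ (Y i ω) - b with hD
  have hDm : ∀ i, AEMeasurable (D i) P := fun i =>
    ((measurable_clamp hτ.le).comp_aemeasurable
      (hY i).aestronglyMeasurable.aemeasurable).sub_const b
  have hDind : iIndepFun D P :=
    hind.comp (fun _ z => clamp τ z - b) fun _ => (measurable_clamp hτ.le).sub_const b
  have hDexp : Integrable (fun ω => Real.exp (τ⁻¹ * (∑ i, D i) ω)) P := by
    refine integrable_exp_mul_of_mem_Icc (a := ∑ _i : ι, (-τ - b)) (b := ∑ _i : ι, (τ - b))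
      (Finset.aemeasurable_sum _ fun i _ => hDm i) (ae_of_all _ fun ω => ?_)
    have hle := fun i => abs_le.1 ((abs_clamp hτ.le (Y i ω)).trans_le (min_le_right _ _))
    rw [Finset.sum_apply]
    exact ⟨Finset.sum_le_sum fun i _ => sub_le_sub_right (hle i).1 b,
      Finset.sum_le_sum fun i _ => sub_le_sub_right (hle i).2 b⟩
  have hset : {ω | s ≤ (Fintype.card ι : ℝ)⁻¹ * ∑ i, clamp τ (Y i ω) - b} =
      {ω | Fintype.card ι * s ≤ (∑ i, D i) ω} := by
    ext ω
    simp only [Set.mem_ofPred_eq, Finset.sum_apply, hD, Finset.sum_sub_distrib, Finset.sum_const,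
      Finset.card_univ, nsmul_eq_mul]
    rw [← mul_le_mul_iff_right₀ hcard, mul_sub, mul_inv_cancel_left₀ hcard.ne']
  rw [hset]
  calc _ ≤ Real.exp (-τ⁻¹ * (Fintype.card ι * s)) * mgf (∑ i, D i) P τ⁻¹ :=
        measure_ge_le_exp_mul_mgf _ (inv_nonneg.2 hτ.le) hDexp
    _ ≤ Real.exp (-τ⁻¹ * (Fintype.card ι * s)) * ∏ _i : ι, Real.exp (2 * V / τ ^ 2) := by
        rw [hDind.mgf_sum₀ hDm]
        gcongr with i
        · exact fun i _ => mgf_nonneg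
        · exact mgf_clamp_sub_le hτ (hY i) (hb i) (hV i)
    _ = Real.exp (Fintype.card ι * (2 * V / τ ^ 2 - s / τ)) := by
        rw [Finset.prod_const, Finset.card_univ, ← Real.exp_nat_mul, ← Real.exp_add]
        congr 1
        ring

lemma measureReal_abs_average_clamp_sub_ge_le [Nonempty ι] (hτ : 0 < τ)
    (hY : ∀ i, MemLp (Y i) 2 P) (hind : iIndepFun Y P) (hb : ∀ i, ∫ ω, Y i ω ∂P = b)
    (hV : ∀ i, ∫ ω, Y i ω ^ 2 ∂P ≤ V) (s : ℝ) :
    P.real {ω | s ≤ |(Fintype.card ι : ℝ)⁻¹ * ∑ i, clamp τ (Y i ω) - b|} ≤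
      2 * Real.exp (Fintype.card ι * (2 * V / τ ^ 2 - s / τ)) := by
  have hupper := measureReal_average_clamp_sub_ge_le hτ hY hind hb hV s
  have hlower := measureReal_average_clamp_sub_ge_le (b := -b) (V := V) (Y := fun i ω => -Y i ω) hτ
    (fun i => (hY i).neg) (hind.comp (fun _ z => -z) fun _ => measurable_neg)
    (fun i => by rw [integral_neg, hb]) (fun i => by simpa only [neg_sq] using hV i) s
  have hsub : {ω | s ≤ |(Fintype.card ι : ℝ)⁻¹ * ∑ i, clamp τ (Y i ω) - b|} ⊆
      {ω | s ≤ (Fintype.card ι : ℝ)⁻¹ * ∑ i, clamp τ (Y i ω) - b} ∪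
        {ω | s ≤ (Fintype.card ι : ℝ)⁻¹ * ∑ i, clamp τ (-Y i ω) - -b} := fun ω hω => by
    refine (le_abs.1 (Set.mem_ofPred_eq ▸ hω)).imp id fun h => ?_
    simp only [Set.mem_ofPred_eq, clamp_neg, Finset.sum_neg_distrib, mul_neg]
    linarith
  linarith [measureReal_mono (μ := P) hsub, measureReal_union_le (μ := P)
    {ω | s ≤ (Fintype.card ι : ℝ)⁻¹ * ∑ i, clamp τ (Y i ω) - b}
    {ω | s ≤ (Fintype.card ι : ℝ)⁻¹ * ∑ i, clamp τ (-Y i ω) - -b}]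

end TruncatedMean

section ResponseMoments

variable {Ω : Type*} [MeasurableSpace Ω] {P : Measure Ω} {g s η : Ω → ℝ} {K σ : ℝ}

lemma memLp_mul_of_indepFun (hs : MemLp s 2 P) (hη : MemLp η 2 P) (hind : IndepFun s η P) :
    MemLp (fun ω => s ω * η ω) 2 P := by
  refine (memLp_two_iff_integrable_sq (f := fun ω => s ω * η ω)
    (hs.aestronglyMeasurable.mul hη.aestronglyMeasurable)).2 ?_
  simp_rw [mul_pow]
  exact (hind.comp (φ := (· ^ 2)) (ψ := (· ^ 2)) (by fun_prop) (by fun_prop)).integrable_mul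
    hs.integrable_sq hη.integrable_sq

lemma memLp_mul_of_abs_le (hg : AEMeasurable g P) (hgK : ∀ ω, |g ω| ≤ K) (hs : MemLp s 2 P) :
    MemLp (fun ω => g ω * s ω) 2 P :=
  hs.of_le_mul (hg.aestronglyMeasurable.mul hs.aestronglyMeasurable) (ae_of_all _ fun ω => by
    rw [norm_mul]
    exact mul_le_mul_of_nonneg_right (hgK ω) (norm_nonneg _))

lemma memLp_add_mul_of_indepFun (hg : AEMeasurable g P) (hgK : ∀ ω, |g ω| ≤ K) (hs : MemLp s 2 P)
    (hη : MemLp η 2 P) (hind : IndepFun s η P) : MemLp (fun ω => (g ω + η ω) * s ω) 2 P := by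
  simp_rw [add_mul, mul_comm (η _)]
  exact (memLp_mul_of_abs_le hg hgK hs).add (memLp_mul_of_indepFun hs hη hind)

lemma integral_add_mul_of_indepFun [IsFiniteMeasure P] (hg : AEMeasurable g P)
    (hgK : ∀ ω, |g ω| ≤ K) (hs : MemLp s 2 P) (hη : MemLp η 2 P) (hη0 : ∫ ω, η ω ∂P = 0)
    (hind : IndepFun s η P) : ∫ ω, (g ω + η ω) * s ω ∂P = ∫ ω, g ω * s ω ∂P := by
  simp_rw [add_mul, mul_comm (η _)]
  rw [integral_add ((memLp_mul_of_abs_le hg hgK hs).integrable one_le_two)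
      ((memLp_mul_of_indepFun hs hη hind).integrable one_le_two),
    hind.integral_fun_mul_eq_mul_integral hs.aestronglyMeasurable hη.aestronglyMeasurable, hη0,
    mul_zero, add_zero]

lemma integral_add_mul_sq_le_of_indepFun (hg : AEMeasurable g P) (hgK : ∀ ω, |g ω| ≤ K)
    (hs : MemLp s 2 P) (hη : MemLp η 2 P) (hη0 : ∫ ω, η ω ∂P = 0) (hησ : Var[η; P] ≤ σ ^ 2)
    (hind : IndepFun (fun ω => (g ω, s ω)) η P) :
    ∫ ω, ((g ω + η ω) * s ω) ^ 2 ∂P ≤ (σ ^ 2 + K ^ 2) * ∫ ω, s ω ^ 2 ∂P := by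
  have hindsη : IndepFun s η P := hind.comp measurable_snd measurable_id
  have hindsq : IndepFun (fun ω => s ω ^ 2) (fun ω => η ω ^ 2) P :=
    hindsη.comp (φ := (· ^ 2)) (ψ := (· ^ 2)) (by fun_prop) (by fun_prop)
  have hindcross : IndepFun (fun ω => g ω * s ω ^ 2) η P :=
    hind.comp (φ := fun p : ℝ × ℝ => p.1 * p.2 ^ 2) (ψ := id) (by fun_prop) measurable_id
  have hgs : MemLp (fun ω => g ω * s ω) 2 P := memLp_mul_of_abs_le hg hgK hs
  have hsη : MemLp (fun ω => s ω * η ω) 2 P := memLp_mul_of_indepFun hs hη hindsη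
  have hcross : Integrable (fun ω => g ω * s ω ^ 2 * η ω) P :=
    (hgs.integrable_mul hsη).congr (ae_of_all _ fun ω => by simp only [Pi.mul_apply]; ring)
  have hsignal : ∫ ω, (g ω * s ω) ^ 2 ∂P ≤ K ^ 2 * ∫ ω, s ω ^ 2 ∂P := by
    rw [← integral_const_mul]
    refine integral_mono hgs.integrable_sq (hs.integrable_sq.const_mul _) fun ω => ?_
    simp only [mul_pow]
    exact mul_le_mul_of_nonneg_right (sq_le_sq.2 ((hgK ω).trans (le_abs_self K))) (sq_nonneg _)
  have hcross_eq : ∫ ω, g ω * s ω ^ 2 * η ω ∂P = 0 := by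
    rw [hindcross.integral_fun_mul_eq_mul_integral
      (hg.mul (hs.aestronglyMeasurable.aemeasurable.pow_const 2)).aestronglyMeasurable
      hη.aestronglyMeasurable, hη0, mul_zero]
  have hnoise : ∫ ω, (s ω * η ω) ^ 2 ∂P ≤ σ ^ 2 * ∫ ω, s ω ^ 2 ∂P := by
    simp_rw [mul_pow]
    rw [hindsq.integral_fun_mul_eq_mul_integral hs.integrable_sq.aestronglyMeasurable
      hη.integrable_sq.aestronglyMeasurable, mul_comm]
    rw [variance_of_integral_eq_zero hη.aestronglyMeasurable.aemeasurable hη0] at hησ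
    exact mul_le_mul_of_nonneg_right hησ (integral_nonneg fun _ => sq_nonneg _)
  have hexpand : ∀ ω, ((g ω + η ω) * s ω) ^ 2 =
      (g ω * s ω) ^ 2 + 2 * (g ω * s ω ^ 2 * η ω) + (s ω * η ω) ^ 2 := fun ω => by ring
  have hsum : Integrable (fun ω => (g ω * s ω) ^ 2 + 2 * (g ω * s ω ^ 2 * η ω)) P :=
    hgs.integrable_sq.add (hcross.const_mul 2)
  simp_rw [hexpand]
  rw [integral_add hsum hsη.integrable_sq,
    integral_add hgs.integrable_sq (hcross.const_mul 2), integral_const_mul, hcross_eq]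
  linarith

end ResponseMoments

section CoordinatewiseError

variable {Ω : Type*} [MeasurableSpace Ω] {P : Measure Ω} {d : ℕ}
  {Δ : Ω → EuclideanSpace ℝ (Fin d)} {c q s : ℝ}

lemma lintegral_norm_le_of_integral_sq_le [IsProbabilityMeasure P]
    (hΔ : ∀ j, MemLp (fun ω => Δ ω j) 2 P) (hc : 0 ≤ c) (h : ∀ j, ∫ ω, Δ ω j ^ 2 ∂P ≤ c) :
    ∫⁻ ω, ENNReal.ofReal ‖Δ ω‖ ∂P ≤ ENNReal.ofReal √(d * c) := by
  have hmeas : AEMeasurable Δ P := (WithLp.measurable_toLp 2 (Fin d → ℝ)).comp_aemeasurable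
    (aemeasurable_pi_lambda _ fun j => (hΔ j).aestronglyMeasurable.aemeasurable)
  have hsq : ∫ ω, ‖Δ ω‖ ^ 2 ∂P ≤ d * c := by
    simp_rw [EuclideanSpace.real_norm_sq_eq]
    rw [integral_finsetSum _ fun j _ => (hΔ j).integrable_sq]
    exact (Finset.sum_le_card_nsmul _ _ c fun j _ => h j).trans_eq (by simp)
  have hnorm : MemLp (fun ω => ‖Δ ω‖) 2 P := by
    rw [memLp_two_iff_integrable_sq hmeas.norm.aestronglyMeasurable]
    simp_rw [EuclideanSpace.real_norm_sq_eq]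
    exact integrable_finsetSum _ fun j _ => (hΔ j).integrable_sq
  simpa only [abs_norm] using lintegral_ofReal_abs_le hnorm (Real.sqrt_nonneg (d * c))
    (by rwa [Real.sq_sqrt (by positivity)])

lemma measureReal_sqrt_mul_lt_norm_le [IsFiniteMeasure P] (hs : 0 ≤ s)
    (h : ∀ j, P.real {ω | s ≤ |Δ ω j|} ≤ q) : P.real {ω | √d * s < ‖Δ ω‖} ≤ d * q := by
  have hsub : {ω | √d * s < ‖Δ ω‖} ⊆ ⋃ j, {ω | s ≤ |Δ ω j|} := fun ω hω => by
    contrapose! hω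
    simp only [Set.mem_iUnion, Set.mem_ofPred_eq, not_exists, not_le] at hω
    rw [Set.mem_ofPred_eq, not_lt, EuclideanSpace.norm_eq]
    calc √(∑ j, ‖Δ ω j‖ ^ 2) ≤ √(∑ _j : Fin d, s ^ 2) := by
          gcongr with j
          exact (hω j).le
      _ = √d * s := by simp [Real.sqrt_sq hs]
  calc P.real {ω | √d * s < ‖Δ ω‖} ≤ ∑ j, P.real {ω | s ≤ |Δ ω j|} :=
        (measureReal_mono hsub).trans (measureReal_iUnion_fintype_le _)
    _ ≤ d * q := (Finset.sum_le_card_nsmul _ _ q fun j _ => h j).trans_eq (by simp)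

end CoordinatewiseError

section SteinEstimator

variable {n d : ℕ} {m θ : EuclideanSpace ℝ (Fin d)} {Q : Matrix (Fin d) (Fin d) ℝ}
  {f : ℝ → ℝ} {Lf Lf' σ M τ : ℝ}

/-- The closed form of the Stein estimator, the average of the truncated vectors: it is the unique
minimizer of the unregularized Stein objective. -/
noncomputable def steinEstimator (S : EuclideanSpace ℝ (Fin d) → EuclideanSpace ℝ (Fin d)) (τ : ℝ)
    (x : Fin n → EuclideanSpace ℝ (Fin d)) (y : Fin n → ℝ) : EuclideanSpace ℝ (Fin d) :=
  (n : ℝ)⁻¹ • ∑ i, trunc τ (y i • S (x i))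

lemma steinObjective_zero_eq (S : EuclideanSpace ℝ (Fin d) → EuclideanSpace ℝ (Fin d)) (τ : ℝ)
    (x : Fin n → EuclideanSpace ℝ (Fin d)) (y : Fin n → ℝ) (t : EuclideanSpace ℝ (Fin d)) :
    steinObjective S τ 0 x y t =
      ‖t - steinEstimator S τ x y‖ ^ 2 - ‖steinEstimator S τ x y‖ ^ 2 := by
  rw [norm_sub_sq_real, steinObjective, ← sum_inner, real_inner_comm (steinEstimator S τ x y) t,
    steinEstimator, real_inner_smul_left]
  ring

lemma eq_steinEstimator_of_isMinOn {S : EuclideanSpace ℝ (Fin d) → EuclideanSpace ℝ (Fin d)}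
    {x : Fin n → EuclideanSpace ℝ (Fin d)} {y : Fin n → ℝ}
    (h : IsMinOn (steinObjective S τ 0 x y) Set.univ θ) : θ = steinEstimator S τ x y := by
  have hle := isMinOn_univ_iff.1 h (steinEstimator S τ x y)
  rw [steinObjective_zero_eq, steinObjective_zero_eq, sub_self, norm_zero] at hle
  have hsq : ‖θ - steinEstimator S τ x y‖ ^ 2 = 0 := le_antisymm (by linarith) (sq_nonneg _)
  exact sub_eq_zero.1 (norm_eq_zero.1 (pow_eq_zero_iff two_ne_zero |>.1 hsq))

lemma steinEstimator_apply (hQ : Q.PosDef) (x : Fin n → EuclideanSpace ℝ (Fin d)) (y : Fin n → ℝ)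
    (j : Fin d) :
    steinEstimator (score (gaussianDensity m Q)) τ x y j =
      (n : ℝ)⁻¹ * ∑ i, clamp τ (y i * inner ℝ (x i - m) (scoreVec Q j)) := by
  simp [steinEstimator, trunc, clamp, score_apply hQ, Finset.sum_apply]

variable {Ω : Type*} [MeasurableSpace Ω] {P : Measure Ω} {ι : Type*}

/-- A sample from the random design model: independent pairs of a Gaussian design point `x i` with
law `N(m, Q)` and an independent centred noise variable `η i` of variance at most `σ ^ 2`. -/
structure IsSample (m : EuclideanSpace ℝ (Fin d)) (Q : Matrix (Fin d) (Fin d) ℝ) (σ : ℝ)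
    (x : ι → Ω → EuclideanSpace ℝ (Fin d)) (η : ι → Ω → ℝ) (P : Measure Ω) : Prop where
  hasLaw : ∀ i, HasLaw (x i) (multivariateGaussian m Q) P
  noise : ∀ i, MemLp (η i) 2 P ∧ ∫ ω, η i ω ∂P = 0 ∧ Var[η i; P] ≤ σ ^ 2
  indepFun : ∀ i, IndepFun (x i) (η i) P
  iIndepFun_pair : iIndepFun (fun i ω => (x i ω, η i ω)) P

namespace IsSample

lemma precomp {κ : Type*} {x : ι → Ω → EuclideanSpace ℝ (Fin d)} {η : ι → Ω → ℝ}
    (h : IsSample m Q σ x η P) {e : κ → ι} (he : Function.Injective e) :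
    IsSample m Q σ (fun k => x (e k)) (fun k => η (e k)) P where
  hasLaw k := h.hasLaw (e k)
  noise k := h.noise (e k)
  indepFun k := h.indepFun (e k)
  iIndepFun_pair := h.iIndepFun_pair.precomp he

variable {x : ι → Ω → EuclideanSpace ℝ (Fin d)} {η : ι → Ω → ℝ} (h : IsSample m Q σ x η P)
  (hf : IsLink Lf Lf' f)
include h

lemma memLp_inner_sub (v : EuclideanSpace ℝ (Fin d)) (i : ι) :
    MemLp (fun ω => (inner ℝ (x i ω - m) v : ℝ)) 2 P :=
  ((h.hasLaw i).map_eq ▸ SingleIndex.memLp_inner_sub (m := m) (Q := Q) v).comp_of_map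
    (h.hasLaw i).aemeasurable

lemma indepFun_inner_sub (v : EuclideanSpace ℝ (Fin d)) (i : ι) :
    IndepFun (fun ω => (inner ℝ (x i ω - m) v : ℝ)) (η i) P :=
  (h.indepFun i).comp (φ := fun z => (inner ℝ (z - m) v : ℝ)) (by fun_prop) measurable_id

include hf

lemma aemeasurable_comp_inner (θ : EuclideanSpace ℝ (Fin d)) (i : ι) :
    AEMeasurable (fun ω => f (inner ℝ (x i ω) θ)) P :=
  (hf.measurable.comp (by fun_prop : Measurable fun z => (inner ℝ z θ : ℝ))).comp_aemeasurable
    (h.hasLaw i).aemeasurable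

lemma memLp_response_mul (θ v : EuclideanSpace ℝ (Fin d)) (i : ι) :
    MemLp (fun ω => (f (inner ℝ (x i ω) θ) + η i ω) * inner ℝ (x i ω - m) v) 2 P :=
  memLp_add_mul_of_indepFun (h.aemeasurable_comp_inner hf θ i) (fun _ => hf.abs_le _)
    (h.memLp_inner_sub v i) (h.noise i).1 (h.indepFun_inner_sub v i)

lemma integral_response_mul [IsFiniteMeasure P] (hQ : Q.PosSemidef)
    (θ v : EuclideanSpace ℝ (Fin d)) (i : ι) :
    ∫ ω, (f (inner ℝ (x i ω) θ) + η i ω) * inner ℝ (x i ω - m) v ∂P =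
      inner ℝ (sqrtMul Q θ) (sqrtMul Q v) *
        ∫ u, deriv f (inner ℝ u θ) ∂multivariateGaussian m Q := by
  have hfm := hf.measurable
  rw [integral_add_mul_of_indepFun (h.aemeasurable_comp_inner hf θ i) (fun _ => hf.abs_le _)
    (h.memLp_inner_sub v i) (h.noise i).1 (h.noise i).2.1 (h.indepFun_inner_sub v i),
    ← integral_comp_inner_mul_inner_sub hQ hf]
  exact (h.hasLaw i).integral_comp (f := fun z => f (inner ℝ z θ) * (inner ℝ (z - m) v : ℝ))
    (by fun_prop)

lemma integral_response_mul_sq_le (θ : EuclideanSpace ℝ (Fin d)) {v : EuclideanSpace ℝ (Fin d)}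
    (hv : ∫ u, (inner ℝ (u - m) v) ^ 2 ∂multivariateGaussian m Q ≤ M) (i : ι) :
    ∫ ω, ((f (inner ℝ (x i ω) θ) + η i ω) * inner ℝ (x i ω - m) v) ^ 2 ∂P ≤
      (σ ^ 2 + Lf ^ 2) * M := by
  have hfm := hf.measurable
  refine (integral_add_mul_sq_le_of_indepFun (h.aemeasurable_comp_inner hf θ i)
    (fun _ => hf.abs_le _) (h.memLp_inner_sub v i) (h.noise i).1 (h.noise i).2.1 (h.noise i).2.2
    ((h.indepFun i).comp (φ := fun z => (f (inner ℝ z θ), (inner ℝ (z - m) v : ℝ))) (by fun_prop)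
      measurable_id)).trans (mul_le_mul_of_nonneg_left ?_ (by positivity))
  refine le_of_eq_of_le ?_ hv
  exact (h.hasLaw i).integral_comp (f := fun z => (inner ℝ (z - m) v : ℝ) ^ 2) (by fun_prop)

lemma iIndepFun_response_mul (θ v : EuclideanSpace ℝ (Fin d)) :
    iIndepFun (fun i ω => (f (inner ℝ (x i ω) θ) + η i ω) * inner ℝ (x i ω - m) v) P := by
  have hfm := hf.measurable
  exact h.iIndepFun_pair.comp (fun _ z => (f (inner ℝ z.1 θ) + z.2) * inner ℝ (z.1 - m) v)
    fun _ => by fun_prop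

end IsSample

section SteinError

variable [IsProbabilityMeasure P] {x : Fin n → Ω → EuclideanSpace ℝ (Fin d)} {η : Fin n → Ω → ℝ}

lemma memLp_steinEstimator_sub_apply (h : IsSample m Q σ x η P) (hf : IsLink Lf Lf' f)
    (hQ : Q.PosDef) (hτ : 0 ≤ τ) (c : EuclideanSpace ℝ (Fin d)) (j : Fin d) :
    MemLp (fun ω => (steinEstimator (score (gaussianDensity m Q)) τ (fun i => x i ω)
      (fun i => f (inner ℝ (x i ω) θ) + η i ω) - c) j) 2 P := by
  simp_rw [PiLp.sub_apply, steinEstimator_apply hQ]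
  exact ((memLp_finsetSum _ fun i _ => memLp_clamp hτ
    (h.memLp_response_mul hf θ _ i).aestronglyMeasurable.aemeasurable 2).const_mul _).sub
    (memLp_const _)

lemma integral_response_mul_scoreVec (h : IsSample m Q σ x η P) (hf : IsLink Lf Lf' f)
    (hQ : Q.PosDef) (θ : EuclideanSpace ℝ (Fin d)) (j : Fin d) (i : Fin n) :
    ∫ ω, (f (inner ℝ (x i ω) θ) + η i ω) * inner ℝ (x i ω - m) (scoreVec Q j) ∂P =
      ((∫ u, deriv f (inner ℝ u θ) ∂multivariateGaussian m Q) • θ) j := by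
  rw [h.integral_response_mul hf hQ.posSemidef, inner_sqrtMul_scoreVec hQ, mul_comm,
    PiLp.smul_apply, smul_eq_mul]

lemma lintegral_norm_steinEstimator_sub_le (h : IsSample m Q σ x η P) (hf : IsLink Lf Lf' f)
    (hQ : Q.PosDef) (hn : 0 < n) (hτ : 0 < τ) (hM : 0 ≤ M)
    (hscore : ∀ j, ∫ u, score (gaussianDensity m Q) u j ^ 2 ∂multivariateGaussian m Q ≤ M) :
    ∫⁻ ω, ENNReal.ofReal ‖steinEstimator (score (gaussianDensity m Q)) τ (fun i => x i ω)
        (fun i => f (inner ℝ (x i ω) θ) + η i ω)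
        - (∫ u, deriv f (inner ℝ u θ) ∂multivariateGaussian m Q) • θ‖ ∂P ≤
      ENNReal.ofReal √(d * ((σ ^ 2 + Lf ^ 2) * M / n + ((σ ^ 2 + Lf ^ 2) * M / τ) ^ 2)) := by
  have : Nonempty (Fin n) := Fin.pos_iff_nonempty.1 hn
  simp_rw [score_apply hQ] at hscore
  refine lintegral_norm_le_of_integral_sq_le
    (fun j => memLp_steinEstimator_sub_apply h hf hQ hτ.le _ j) (by positivity) fun j => ?_
  have hmean := integral_average_clamp_sub_sq_le hτ (h.memLp_response_mul hf θ _)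
    (h.iIndepFun_response_mul hf θ _) (integral_response_mul_scoreVec h hf hQ θ j)
    (h.integral_response_mul_sq_le hf θ (hscore j))
  rw [Fintype.card_fin] at hmean
  simpa only [PiLp.sub_apply, steinEstimator_apply hQ] using hmean

lemma measureReal_norm_steinEstimator_sub_gt_le (h : IsSample m Q σ x η P)
    (hf : IsLink Lf Lf' f) (hQ : Q.PosDef) (hn : 0 < n) (hτ : 0 < τ)
    (hscore : ∀ j, ∫ u, score (gaussianDensity m Q) u j ^ 2 ∂multivariateGaussian m Q ≤ M)
    {s : ℝ} (hs : 0 ≤ s) :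
    P.real {ω | √d * s < ‖steinEstimator (score (gaussianDensity m Q)) τ (fun i => x i ω)
        (fun i => f (inner ℝ (x i ω) θ) + η i ω)
        - (∫ u, deriv f (inner ℝ u θ) ∂multivariateGaussian m Q) • θ‖} ≤
      d * (2 * Real.exp (n * (2 * ((σ ^ 2 + Lf ^ 2) * M) / τ ^ 2 - s / τ))) := by
  have : Nonempty (Fin n) := Fin.pos_iff_nonempty.1 hn
  simp_rw [score_apply hQ] at hscore
  refine measureReal_sqrt_mul_lt_norm_le hs fun j => ?_
  have htail := measureReal_abs_average_clamp_sub_ge_le hτ (h.memLp_response_mul hf θ _)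
    (h.iIndepFun_response_mul hf θ _) (integral_response_mul_scoreVec h hf hQ θ j)
    (h.integral_response_mul_sq_le hf θ (hscore j)) s
  rw [Fintype.card_fin] at htail
  simpa only [PiLp.sub_apply, steinEstimator_apply hQ] using htail

end SteinError

end SteinEstimator

section Normalization

variable {d : ℕ} {Q : Matrix (Fin d) (Fin d) ℝ} {μ : ℝ} {θ t v : EuclideanSpace ℝ (Fin d)}

lemma norm_sqrtMul_le (hQ : Q.PosSemidef) {K : ℝ} (hK : ∀ j, hQ.isHermitian.eigenvalues j ≤ K)
    (v : EuclideanSpace ℝ (Fin d)) : ‖sqrtMul Q v‖ ≤ √K * ‖v‖ := by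
  set b := hQ.isHermitian.eigenvectorBasis
  have hb : ∀ i, inner ℝ (b i) (WithLp.toLp 2 (Q *ᵥ v.ofLp)) =
      hQ.isHermitian.eigenvalues i * inner ℝ (b i) v := fun i => by
    have hsymm := Matrix.isSymmetric_toEuclideanLin_iff.2 hQ.isHermitian (b i) v
    rw [Matrix.toLpLin_apply, Matrix.toLpLin_apply, hQ.isHermitian.mulVec_eigenvectorBasis]
      at hsymm
    rw [← hsymm, WithLp.toLp_smul, real_inner_smul_left]
  rw [← Real.sqrt_sq (norm_nonneg v), ← Real.sqrt_mul' _ (sq_nonneg _)]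
  refine Real.le_sqrt_of_sq_le ?_
  calc ‖sqrtMul Q v‖ ^ 2 = inner ℝ v (WithLp.toLp 2 (Q *ᵥ v.ofLp)) := by
        rw [← real_inner_self_eq_norm_sq, inner_sqrtMul hQ, EuclideanSpace.inner_eq_star_dotProduct,
          star_trivial, dotProduct_comm]
    _ = ∑ i, hQ.isHermitian.eigenvalues i * inner ℝ (b i) v ^ 2 := by
        rw [← b.sum_inner_mul_inner]
        refine Finset.sum_congr rfl fun i _ => ?_
        rw [hb, real_inner_comm]
        ring
    _ ≤ ∑ i, K * inner ℝ (b i) v ^ 2 := by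
        gcongr with i
        exact hK i
    _ = K * ‖v‖ ^ 2 := by rw [← Finset.mul_sum, b.sum_sq_inner_right]

lemma eq_zero_of_sqrtMul_eq_zero (hQ : Q.PosDef) (hv : sqrtMul Q v = 0) : v = 0 := by
  by_contra h
  have hpos := hQ.dotProduct_mulVec_pos ((WithLp.ofLp_eq_zero 2).not.2 h)
  rw [star_trivial, ← inner_sqrtMul hQ.posSemidef, hv, inner_zero_left] at hpos
  exact hpos.false

lemma l1norm_nonneg (v : EuclideanSpace ℝ (Fin d)) : 0 ≤ l1norm v :=
  Finset.sum_nonneg fun _ _ => abs_nonneg _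

lemma l1norm_add_le (u v : EuclideanSpace ℝ (Fin d)) : l1norm (u + v) ≤ l1norm u + l1norm v := by
  simp only [l1norm, ← Finset.sum_add_distrib]
  exact Finset.sum_le_sum fun j _ => abs_add_le _ _

lemma l1norm_smul (c : ℝ) (v : EuclideanSpace ℝ (Fin d)) : l1norm (c • v) = |c| * l1norm v := by
  simp [l1norm, Finset.mul_sum, abs_mul]

lemma eq_zero_of_l1norm_eq_zero (h : l1norm v = 0) : v = 0 := by
  ext j
  simpa using (Finset.sum_eq_zero_iff_of_nonneg fun j _ => abs_nonneg (v j)).1 h j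
    (Finset.mem_univ j)

lemma l1norm_le_sqrt_mul_norm (v : EuclideanSpace ℝ (Fin d)) : l1norm v ≤ √d * ‖v‖ := by
  rw [← Real.sqrt_sq (norm_nonneg v), ← Real.sqrt_mul d.cast_nonneg, EuclideanSpace.real_norm_sq_eq]
  refine Real.le_sqrt_of_sq_le ?_
  simpa [l1norm] using sq_sum_le_card_mul_sum_sq (s := Finset.univ) (f := fun j => |v j|)

lemma norm_le_l1norm (v : EuclideanSpace ℝ (Fin d)) : ‖v‖ ≤ l1norm v := by
  refine (sq_le_sq₀ (norm_nonneg v) (l1norm_nonneg v)).1 ?_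
  rw [EuclideanSpace.real_norm_sq_eq]
  simpa [l1norm] using Finset.sum_sq_le_sq_sum_of_nonneg (s := Finset.univ)
    (f := fun j => |v j|) fun j _ => abs_nonneg (v j)

lemma pos_of_l1norm_sqrtMul_eq_one (hθ : l1norm (sqrtMul Q θ) = 1) : 0 < d := by
  rcases d.eq_zero_or_pos with rfl | hd
  · simp [l1norm] at hθ
  · exact hd

lemma l1norm_sqrtMul_le (hθ : l1norm (sqrtMul Q θ) = 1) (hμ : 0 ≤ μ)
    (t : EuclideanSpace ℝ (Fin d)) :
    l1norm (sqrtMul Q t) ≤ μ + √d * ‖sqrtMul Q (t - μ • θ)‖ := by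
  calc l1norm (sqrtMul Q t) = l1norm (μ • sqrtMul Q θ + sqrtMul Q (t - μ • θ)) := by
        rw [← sqrtMul_smul, ← sqrtMul_add, add_sub_cancel]
    _ ≤ μ + l1norm (sqrtMul Q (t - μ • θ)) := by
        refine (l1norm_add_le _ _).trans_eq ?_
        rw [l1norm_smul, hθ, mul_one, abs_of_nonneg hμ]
    _ ≤ _ := by
        gcongr
        exact l1norm_le_sqrt_mul_norm _

lemma l1norm_smul_normalize (hQ : Q.PosDef) (t : EuclideanSpace ℝ (Fin d)) :
    l1norm (sqrtMul Q t) • normalize Q t = t := by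
  obtain ht | ht := eq_or_ne (l1norm (sqrtMul Q t)) 0
  · rw [ht, zero_smul, eq_zero_of_sqrtMul_eq_zero hQ (eq_zero_of_l1norm_eq_zero ht)]
  · rw [normalize, smul_inv_smul₀ ht]

lemma sub_smul_normalize (hQ : Q.PosDef) (hμ : μ ≠ 0) (t : EuclideanSpace ℝ (Fin d)) :
    θ - (l1norm (sqrtMul Q t) / μ) • normalize Q t = (-μ⁻¹) • (t - μ • θ) := by
  rw [div_eq_inv_mul, mul_smul, l1norm_smul_normalize hQ, smul_sub, smul_smul, neg_mul,
    inv_mul_cancel₀ hμ, neg_smul, neg_smul, one_smul]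
  abel

lemma normalize_eq_zero_or_l1norm_eq_one (Q : Matrix (Fin d) (Fin d) ℝ)
    (t : EuclideanSpace ℝ (Fin d)) :
    normalize Q t = 0 ∨ l1norm (sqrtMul Q (normalize Q t)) = 1 := by
  obtain ht | ht := eq_or_ne (l1norm (sqrtMul Q t)) 0
  · exact .inl (by rw [normalize, ht, inv_zero, zero_smul])
  · exact .inr (by rw [normalize, sqrtMul_smul, l1norm_smul,
      abs_of_nonneg (inv_nonneg.2 (l1norm_nonneg _)), inv_mul_cancel₀ ht])

lemma norm_sqrtMul_normalize_le_one (Q : Matrix (Fin d) (Fin d) ℝ)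
    (t : EuclideanSpace ℝ (Fin d)) : ‖sqrtMul Q (normalize Q t)‖ ≤ 1 := by
  obtain h | h := normalize_eq_zero_or_l1norm_eq_one Q t
  · simp [h, sqrtMul_eq_toEuclideanCLM]
  · exact (norm_le_l1norm _).trans_eq h

lemma normalize_eq_zero_or_one_le_mul_norm (Q : Matrix (Fin d) (Fin d) ℝ)
    (t : EuclideanSpace ℝ (Fin d)) :
    normalize Q t = 0 ∨ 1 ≤ √d * ‖sqrtMul Q (normalize Q t)‖ :=
  (normalize_eq_zero_or_l1norm_eq_one Q t).imp_right fun h =>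
    h.symm.trans_le (l1norm_le_sqrt_mul_norm _)

lemma measurable_normalize : Measurable (normalize Q) := by
  have hnorm : Measurable fun t : EuclideanSpace ℝ (Fin d) => l1norm (sqrtMul Q t) := by
    simp only [l1norm, sqrtMul_eq_toEuclideanCLM]
    fun_prop
  exact hnorm.inv.smul measurable_id

end Normalization

lemma integrable_and_integral_le_of_lintegral_le {Ω : Type*} [MeasurableSpace Ω] {P : Measure Ω}
    {g : Ω → ℝ} (hg : AEMeasurable g P) (hg0 : 0 ≤ g) {c : ℝ} (hc : 0 ≤ c)
    (h : ∫⁻ ω, ENNReal.ofReal (g ω) ∂P ≤ ENNReal.ofReal c) :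
    Integrable g P ∧ ∫ ω, g ω ∂P ≤ c := by
  refine ⟨⟨hg.aestronglyMeasurable, ?_⟩, ?_⟩
  · rw [hasFiniteIntegral_iff_ofReal (ae_of_all _ hg0)]
    exact h.trans_lt ENNReal.ofReal_lt_top
  · rw [integral_eq_lintegral_of_nonneg_ae (ae_of_all _ hg0) hg.aestronglyMeasurable]
    exact ENNReal.toReal_le_of_le_ofReal hc h

section RandomSampling

variable {Ω α β γ : Type*} [MeasurableSpace Ω] {P : Measure Ω} [IsProbabilityMeasure P]
  [MeasurableSpace α] [MeasurableSpace β] [MeasurableSpace γ]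

lemma lintegral_comp_of_indepFun {U : Ω → α} {V : Ω → β} (hU : AEMeasurable U P)
    (hV : AEMeasurable V P) (hUV : IndepFun U V P) {G : α × β → ENNReal} (hG : Measurable G) :
    ∫⁻ ω, G (U ω, V ω) ∂P = ∫⁻ ω, ∫⁻ ω', G (U ω, V ω') ∂P ∂P := by
  have := Measure.isProbabilityMeasure_map hV
  rw [← lintegral_map' hG.aemeasurable (hU.prodMk hV), hUV.map_prod_eq_prod_map_map hU hV,
    lintegral_prod _ hG.aemeasurable,
    lintegral_map' hG.lintegral_prod_right'.aemeasurable hU]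
  refine lintegral_congr fun ω => ?_
  exact lintegral_map' (hG.comp measurable_prodMk_left).aemeasurable hV

lemma indepFun_prodMk_of_indepFun {X : Ω → α} {Y : Ω → β} {Z : Ω → γ} (hX : AEMeasurable X P)
    (hY : AEMeasurable Y P) (hZ : AEMeasurable Z P) (hYZ : IndepFun Y Z P)
    (hXYZ : IndepFun X (fun ω => (Y ω, Z ω)) P) : IndepFun Y (fun ω => (Z ω, X ω)) P := by
  have := Measure.isProbabilityMeasure_map hX
  have := Measure.isProbabilityMeasure_map hY
  have := Measure.isProbabilityMeasure_map hZ
  have hlawX : HasLaw X (P.map X) P := ⟨hX, rfl⟩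
  have hlawY : HasLaw Y (P.map Y) P := ⟨hY, rfl⟩
  have hlawZ : HasLaw Z (P.map Z) P := ⟨hZ, rfl⟩
  have hlawYZ := hYZ.hasLaw_prod hlawY hlawZ
  have hXZ : IndepFun X Z P := hXYZ.comp measurable_id measurable_snd
  refine (indepFun_iff_hasLaw_prodMk_prod hlawY (hXZ.symm.hasLaw_prod hlawZ hlawX)).2 ?_
  have hassoc : MeasurePreserving (MeasurableEquiv.prodAssoc : (β × γ) × α ≃ᵐ β × γ × α)
      (((P.map Y).prod (P.map Z)).prod (P.map X)) ((P.map Y).prod ((P.map Z).prod (P.map X))) :=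
    ⟨MeasurableEquiv.measurable _, Measure.prodAssoc_prod⟩
  exact hassoc.comp_hasLaw (hXYZ.symm.hasLaw_prod hlawYZ hlawX)

lemma indepFun_inl_inr {ι κ : Type*} [Finite ι] [Finite κ] {Y : ι ⊕ κ → Ω → α}
    (hY : ∀ i, AEMeasurable (Y i) P) (hind : iIndepFun Y P) :
    IndepFun (fun ω i => Y (Sum.inl i) ω) (fun ω k => Y (Sum.inr k) ω) P := by
  cases nonempty_fintype ι
  cases nonempty_fintype κ
  have := fun i => Measure.isProbabilityMeasure_map (hY i)
  have hlaw : ∀ i, HasLaw (Y i) (P.map (Y i)) P := fun i => ⟨hY i, rfl⟩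
  refine (indepFun_iff_hasLaw_prodMk_prod
    ((hind.precomp Sum.inl_injective).hasLaw_pi fun i => hlaw (Sum.inl i))
    ((hind.precomp Sum.inr_injective).hasLaw_pi fun k => hlaw (Sum.inr k))).2 ?_
  exact (measurePreserving_sumPiEquivProdPi fun i => P.map (Y i)).comp_hasLaw (hind.hasLaw_pi hlaw)

end RandomSampling

section PredictionError

variable {n d : ℕ} {m θ : EuclideanSpace ℝ (Fin d)} {Q : Matrix (Fin d) (Fin d) ℝ} {f : ℝ → ℝ}
  {τ : ℝ}

lemma measurable_steinEstimator (hQ : Q.PosDef) (hτ : 0 ≤ τ) :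
    Measurable fun z : (Fin n → EuclideanSpace ℝ (Fin d)) × (Fin n → ℝ) =>
      steinEstimator (score (gaussianDensity m Q)) τ z.1 z.2 := by
  have hclamp := measurable_clamp hτ
  have hcoord : Measurable fun z : (Fin n → EuclideanSpace ℝ (Fin d)) × (Fin n → ℝ) =>
      (steinEstimator (score (gaussianDensity m Q)) τ z.1 z.2).ofLp := by
    refine measurable_pi_lambda _ fun j => ?_
    simp_rw [steinEstimator_apply hQ]
    fun_prop
  exact (WithLp.measurable_toLp 2 (Fin d → ℝ)).comp hcoord

lemma measurable_uniformKernel (h : ℝ) : Measurable (uniformKernel h) :=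
  Measurable.ite (measurableSet_le (by fun_prop) (by fun_prop)) measurable_const measurable_const

lemma measurable_predictionError (hf : Measurable f) :
    Measurable fun z : EuclideanSpace ℝ (Fin d) × (Fin n → EuclideanSpace ℝ (Fin d) × ℝ) ×
      EuclideanSpace ℝ (Fin d) => predictionError f θ m z.1 (fun i => (z.2.1 i).1)
        (fun i => f (inner ℝ (z.2.1 i).1 θ) + (z.2.1 i).2) z.2.2 := by
  have hk := measurable_uniformKernel ((n : ℝ) ^ (-(1 : ℝ) / 3))
  unfold predictionError kernelRegression
  exact ((Measurable.ite (measurableSet_le (by fun_prop) measurable_const) (by fun_prop)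
    measurable_const).sub (by fun_prop)).abs

end PredictionError

section Transfer

variable {Ω : Type*} [MeasurableSpace Ω] {P : Measure Ω} {n d : ℕ}
  {m θ : EuclideanSpace ℝ (Fin d)} {Q : Matrix (Fin d) (Fin d) ℝ} {f : ℝ → ℝ} {σ : ℝ}

namespace IsSample

section Law

variable {ι : Type*} {x : ι → Ω → EuclideanSpace ℝ (Fin d)} {η : ι → Ω → ℝ}

lemma aemeasurable_noise (h : IsSample m Q σ x η P) (i : ι) : AEMeasurable (η i) P :=
  (h.noise i).1.aestronglyMeasurable.aemeasurable

lemma aemeasurable_pair [Countable ι] (h : IsSample m Q σ x η P) :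
    AEMeasurable (fun ω i => (x i ω, η i ω)) P :=
  aemeasurable_pi_lambda _ fun i => (h.hasLaw i).aemeasurable.prodMk (h.aemeasurable_noise i)

lemma isNoiseLaw (h : IsSample m Q σ x η P) (i : ι) : IsNoiseLaw σ (P.map (η i)) where
  memLp := (memLp_map_measure_iff (by fun_prop) (h.aemeasurable_noise i)).2 (h.noise i).1
  integral_eq_zero := by
    rw [integral_map (h.aemeasurable_noise i) (by fun_prop)]
    exact (h.noise i).2.1
  variance_le := by
    rw [variance_map (by fun_prop) (h.aemeasurable_noise i)]
    exact (h.noise i).2.2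

lemma hasLaw_design_noise [Fintype ι] [IsProbabilityMeasure P] (h : IsSample m Q σ x η P) :
    HasLaw (fun ω => ((fun i => x i ω), fun i => η i ω))
      ((Measure.pi fun _ => multivariateGaussian m Q).prod
        (Measure.pi fun i => P.map (η i))) P := by
  have := fun i => Measure.isProbabilityMeasure_map (h.aemeasurable_noise i)
  have hpair : HasLaw (fun ω i => (x i ω, η i ω))
      (Measure.pi fun i => (multivariateGaussian m Q).prod (P.map (η i))) P :=
    h.iIndepFun_pair.hasLaw_pi fun i =>
      (h.indepFun i).hasLaw_prod (h.hasLaw i) ⟨h.aemeasurable_noise i, rfl⟩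
  exact (measurePreserving_arrowProdEquivProdArrow _ _ ι (fun _ => multivariateGaussian m Q)
    fun i => P.map (η i)).comp_hasLaw hpair

end Law

variable {x : Fin n → Ω → EuclideanSpace ℝ (Fin d)} {η : Fin n → Ω → ℝ}
  {X : Ω → EuclideanSpace ℝ (Fin d)}

lemma aemeasurable_steinEstimator (h : IsSample m Q σ x η P) (hf : Measurable f)
    (hQ : Q.PosDef) {τ : ℝ} (hτ : 0 ≤ τ) :
    AEMeasurable (fun ω => steinEstimator (score (gaussianDensity m Q)) τ (fun i => x i ω)
        fun i => f (inner ℝ (x i ω) θ) + η i ω) P :=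
  (measurable_steinEstimator hQ hτ).comp_aemeasurable
    (f := fun ω => ((fun i => x i ω), fun i => f (inner ℝ (x i ω) θ) + η i ω))
    ((by fun_prop : Measurable fun w : Fin n → EuclideanSpace ℝ (Fin d) × ℝ =>
      ((fun i => (w i).1), fun i => f (inner ℝ (w i).1 θ) + (w i).2)).comp_aemeasurable
        h.aemeasurable_pair)

lemma aemeasurable_predictionError (h : IsSample m Q σ x η P) (hf : Measurable f)
    (hX : AEMeasurable X P) {ϑ : Ω → EuclideanSpace ℝ (Fin d)} (hϑ : AEMeasurable ϑ P) :
    AEMeasurable (fun ω => predictionError f θ m (ϑ ω) (fun i => x i ω)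
      (fun i => f (inner ℝ (x i ω) θ) + η i ω) (X ω)) P :=
  (measurable_predictionError (n := n) (θ := θ) (m := m) hf).comp_aemeasurable
    (f := fun ω => (ϑ ω, (fun i => (x i ω, η i ω)), X ω))
    (hϑ.prodMk (h.aemeasurable_pair.prodMk hX))

variable [IsProbabilityMeasure P]

lemma lintegral_predictionError_eq_risk (h : IsSample m Q σ x η P) (hf : Measurable f)
    (hX : HasLaw X (multivariateGaussian m Q) P) (hXind : IndepFun X (fun ω i => (x i ω, η i ω)) P)
    (ϑ : EuclideanSpace ℝ (Fin d)) :
    ∫⁻ ω, ENNReal.ofReal (predictionError f θ m ϑ (fun i => x i ω)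
        (fun i => f (inner ℝ (x i ω) θ) + η i ω) (X ω)) ∂P =
      risk f θ m Q ((n : ℝ) ^ (-(1 : ℝ) / 3)) (2 * √(Real.log n)) (fun i => P.map (η i)) ϑ := by
  have := fun i => Measure.isProbabilityMeasure_map (h.aemeasurable_noise i)
  have hind : IndepFun X (fun ω => ((fun i => x i ω), fun i => η i ω)) P :=
    hXind.comp (ψ := fun w : Fin n → EuclideanSpace ℝ (Fin d) × ℝ =>
      ((fun i => (w i).1), fun i => (w i).2)) measurable_id (by fun_prop)
  have hlaw := hind.hasLaw_prod hX h.hasLaw_design_noise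
  have hG : Measurable fun z : EuclideanSpace ℝ (Fin d) ×
      (Fin n → EuclideanSpace ℝ (Fin d)) × (Fin n → ℝ) => ENNReal.ofReal (predictionError f θ m ϑ
        z.2.1 (fun i => f (inner ℝ (z.2.1 i) θ) + z.2.2 i) z.1) :=
    ((measurable_predictionError hf).comp (f := fun z : EuclideanSpace ℝ (Fin d) ×
      (Fin n → EuclideanSpace ℝ (Fin d)) × (Fin n → ℝ) =>
        (ϑ, (fun i => (z.2.1 i, z.2.2 i)), z.1)) (by fun_prop)).ennreal_ofReal
  rw [hlaw.lintegral_comp hG.aemeasurable, lintegral_prod _ hG.aemeasurable]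
  refine lintegral_congr fun u => ?_
  exact lintegral_prod _ (hG.comp measurable_prodMk_left).aemeasurable

lemma lintegral_predictionError_eq_lintegral_risk (h : IsSample m Q σ x η P) (hf : Measurable f)
    (hX : HasLaw X (multivariateGaussian m Q) P) (hXind : IndepFun X (fun ω i => (x i ω, η i ω)) P)
    {ϑ : Ω → EuclideanSpace ℝ (Fin d)} (hϑ : AEMeasurable ϑ P)
    (hϑind : IndepFun ϑ (fun ω => ((fun i => (x i ω, η i ω)), X ω)) P) :
    ∫⁻ ω, ENNReal.ofReal (predictionError f θ m (ϑ ω) (fun i => x i ω)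
        (fun i => f (inner ℝ (x i ω) θ) + η i ω) (X ω)) ∂P =
      ∫⁻ ω, risk f θ m Q ((n : ℝ) ^ (-(1 : ℝ) / 3)) (2 * √(Real.log n))
        (fun i => P.map (η i)) (ϑ ω) ∂P := by
  simp_rw [← h.lintegral_predictionError_eq_risk hf hX hXind]
  exact lintegral_comp_of_indepFun hϑ (h.aemeasurable_pair.prodMk hX.aemeasurable) hϑind
    (measurable_predictionError hf).ennreal_ofReal

end IsSample

end Transfer

section NormalizedDirection

variable {n d : ℕ} {m θ : EuclideanSpace ℝ (Fin d)} {Q : Matrix (Fin d) (Fin d) ℝ} {f : ℝ → ℝ}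
  {Lf Lf' σ K μ₀ μ h W : ℝ} {ν : Fin n → Measure ℝ} [∀ i, IsProbabilityMeasure (ν i)]

lemma risk_normalize_le (hQ : Q.PosDef) (hK : ∀ j, hQ.isHermitian.eigenvalues j ≤ K) (hn : 0 < n)
    (hf : IsLink Lf Lf' f) (hν : ∀ i, IsNoiseLaw σ (ν i)) (hσ : 0 ≤ σ) (hh : 0 < h) (hh1 : h ≤ 1)
    (hdh : √d * h ≤ 1) (hW : 0 ≤ W) (hθ : l1norm (sqrtMul Q θ) = 1) (hμ₀ : 0 < μ₀) (hμ : μ₀ ≤ μ)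
    (t : EuclideanSpace ℝ (Fin d)) :
    risk f θ m Q h W ν (normalize Q t) ≤ ENNReal.ofReal (2 * Lf * Real.exp (-W ^ 2 / 2) +
      Lf' * (h + 4 * (√K / μ₀ * ‖t - μ • θ‖)) + 16 * (Lf + σ) / √(n * h)) := by
  have hμ_pos : 0 < μ := hμ₀.trans_le hμ
  set Δ := t - μ • θ
  set κ := l1norm (sqrtMul Q t) / μ
  have hκ : 0 ≤ κ := div_nonneg (l1norm_nonneg _) hμ_pos.le
  have hscale : μ⁻¹ * ‖sqrtMul Q Δ‖ ≤ √K / μ₀ * ‖Δ‖ := by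
    calc μ⁻¹ * ‖sqrtMul Q Δ‖ ≤ μ₀⁻¹ * (√K * ‖Δ‖) := by
          gcongr
          exact norm_sqrtMul_le hQ.posSemidef hK Δ
      _ = √K / μ₀ * ‖Δ‖ := by ring
  have hdir : ‖sqrtMul Q (θ - κ • normalize Q t)‖ = μ⁻¹ * ‖sqrtMul Q Δ‖ := by
    rw [sub_smul_normalize hQ hμ_pos.ne', sqrtMul_smul, norm_smul, norm_neg,
      Real.norm_of_nonneg (inv_nonneg.2 hμ_pos.le)]
  have hκh : κ * h ≤ h + μ⁻¹ * ‖sqrtMul Q Δ‖ := by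
    calc κ * h ≤ (μ + √d * ‖sqrtMul Q Δ‖) / μ * h := by
          refine mul_le_mul_of_nonneg_right ?_ hh.le
          exact div_le_div_of_nonneg_right (l1norm_sqrtMul_le hθ hμ_pos.le t) hμ_pos.le
      _ = h + √d * h * (μ⁻¹ * ‖sqrtMul Q Δ‖) := by field_simp
      _ ≤ h + 1 * (μ⁻¹ * ‖sqrtMul Q Δ‖) := by gcongr
      _ = h + μ⁻¹ * ‖sqrtMul Q Δ‖ := by rw [one_mul]
  have hwide : normalize Q t = 0 ∨ h ≤ ‖sqrtMul Q (normalize Q t)‖ :=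
    (normalize_eq_zero_or_one_le_mul_norm Q t).imp_right fun h1 => by
      calc h ≤ h * (√d * ‖sqrtMul Q (normalize Q t)‖) := le_mul_of_one_le_right hh.le h1
        _ = √d * h * ‖sqrtMul Q (normalize Q t)‖ := by ring
        _ ≤ ‖sqrtMul Q (normalize Q t)‖ := mul_le_of_le_one_left (norm_nonneg _) hdh
  refine (risk_le hQ.posSemidef hn hf hν hσ hh hh1 hW (norm_sqrtMul_normalize_le_one Q t) hwide
    hκ).trans (ENNReal.ofReal_le_ofReal ?_)
  have hbias : κ * h + 3 * ‖sqrtMul Q (θ - κ • normalize Q t)‖ ≤ h + 4 * (√K / μ₀ * ‖Δ‖) := by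
    linarith
  have := hf.deriv_nonneg
  gcongr

end NormalizedDirection

section Rates

variable {n d : ℕ} {B V δ τ : ℝ}

lemma bandwidth_pos (hn : 0 < n) : 0 < (n : ℝ) ^ (-(1 : ℝ) / 3) :=
  Real.rpow_pos_of_pos (Nat.cast_pos.2 hn) _

lemma bandwidth_le_one (hn : 0 < n) : (n : ℝ) ^ (-(1 : ℝ) / 3) ≤ 1 :=
  Real.rpow_le_one_of_one_le_of_nonpos (Nat.one_le_cast.2 hn) (by norm_num)

lemma bandwidth_pow_three (n : ℕ) : ((n : ℝ) ^ (-(1 : ℝ) / 3)) ^ 3 = (n : ℝ)⁻¹ := by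
  rw [← Real.rpow_natCast, ← Real.rpow_mul n.cast_nonneg]
  norm_num [Real.rpow_neg_one]

lemma sqrt_natCast_mul_bandwidth (hn : 0 < n) :
    √(n * (n : ℝ) ^ (-(1 : ℝ) / 3)) = ((n : ℝ) ^ (-(1 : ℝ) / 3))⁻¹ := by
  have hh := bandwidth_pos hn
  have hcube := bandwidth_pow_three n
  set h := (n : ℝ) ^ (-(1 : ℝ) / 3)
  rw [Real.sqrt_eq_iff_eq_sq (by positivity) (by positivity), ← inv_inv (n : ℝ), ← hcube]
  field_simp

lemma exp_neg_truncation_sq_le (hn : 0 < n) :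
    Real.exp (-(2 * √(Real.log n)) ^ 2 / 2) ≤ (n : ℝ) ^ (-(1 : ℝ) / 3) := by
  have hlog : 0 ≤ Real.log n := Real.log_natCast_nonneg n
  rw [mul_pow, Real.sq_sqrt hlog, Real.rpow_def_of_pos (Nat.cast_pos.2 hn)]
  exact Real.exp_le_exp.2 (by linarith)

lemma log_two_mul_div_pos (hd : 0 < d) (hδ : 0 < δ) (hδ1 : δ < 1) :
    0 < Real.log (2 * d / δ) := by
  have hd1 : (1 : ℝ) ≤ d := Nat.one_le_cast.2 hd
  exact Real.log_pos ((one_lt_div hδ).2 (by linarith))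

lemma log_two_mul_div_mul_bandwidth_le (hn : 0 < n) (hd : 0 < d) (hδ : 0 < δ)
    (hB : Real.log (1 / δ) ≤ B * (n : ℝ) ^ ((1 : ℝ) / 3))
    (hdh : √d * (n : ℝ) ^ (-(1 : ℝ) / 3) ≤ 1) :
    Real.log (2 * d / δ) * (n : ℝ) ^ (-(1 : ℝ) / 3) ≤ 3 + B := by
  have hh := bandwidth_pos hn
  have hinv : (n : ℝ) ^ ((1 : ℝ) / 3) = ((n : ℝ) ^ (-(1 : ℝ) / 3))⁻¹ := by
    rw [← Real.rpow_neg n.cast_nonneg]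
    norm_num
  rw [hinv] at hB
  set h := (n : ℝ) ^ (-(1 : ℝ) / 3)
  have : (0 : ℝ) < d := Nat.cast_pos.2 hd
  have hlog : Real.log (2 * d) ≤ 2 * (√2 * √d) := by
    rw [← Real.sqrt_mul zero_le_two]
    have hle := Real.log_le_sub_one_of_pos (Real.sqrt_pos.2 (by positivity : (0 : ℝ) < 2 * d))
    rw [Real.log_sqrt (by positivity)] at hle
    linarith
  have hsqrt_two : 2 * √2 ≤ 3 := by
    nlinarith [Real.sq_sqrt (zero_le_two (α := ℝ)), Real.sqrt_nonneg 2]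
  calc Real.log (2 * d / δ) * h = (Real.log (2 * d) + Real.log (1 / δ)) * h := by
        rw [← Real.log_mul (by positivity) (by positivity), mul_one_div]
    _ ≤ (2 * (√2 * √d) + B * h⁻¹) * h := by gcongr
    _ = 2 * √2 * (√d * h) + B := by field_simp
    _ ≤ 3 * 1 + B := by gcongr
    _ = 3 + B := by rw [mul_one]

lemma truncation_pos (hn : 0 < n) (hV : 0 < V) {l : ℝ} (hl : 0 < l) : 0 < √(3 * V * n / l) := by
  have : (0 : ℝ) < n := Nat.cast_pos.2 hn
  positivity

lemma div_truncation_le (hn : 0 < n) (hV : 0 < V) {l : ℝ} (hl : 0 < l)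
    (hlB : l * (n : ℝ) ^ (-(1 : ℝ) / 3) ≤ B) :
    V / √(3 * V * n / l) ≤ √(V * B / 3) * (n : ℝ) ^ (-(1 : ℝ) / 3) := by
  have : (0 : ℝ) < n := Nat.cast_pos.2 hn
  have hh := bandwidth_pos hn
  have hcube := bandwidth_pow_three n
  set h := (n : ℝ) ^ (-(1 : ℝ) / 3)
  have hB : 0 ≤ B := le_trans (by positivity) hlB
  refine (sq_le_sq₀ (by positivity) (by positivity)).1 ?_
  calc (V / √(3 * V * n / l)) ^ 2 = V * l / 3 * (n : ℝ)⁻¹ := by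
        rw [div_pow, Real.sq_sqrt (by positivity)]
        field_simp
    _ = V * (l * h) / 3 * h ^ 2 := by rw [← hcube]; ring
    _ ≤ V * B / 3 * h ^ 2 := by gcongr
    _ = (√(V * B / 3) * h) ^ 2 := by rw [mul_pow, Real.sq_sqrt (by positivity)]

lemma inv_natCast_le_bandwidth_sq (hn : 0 < n) :
    (n : ℝ)⁻¹ ≤ ((n : ℝ) ^ (-(1 : ℝ) / 3)) ^ 2 := by
  rw [← bandwidth_pow_three n]
  exact pow_le_pow_of_le_one (bandwidth_pos hn).le (bandwidth_le_one hn) (by norm_num)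

lemma sqrt_mul_div_add_sq_le (hn : 0 < n) {ρ R : ℝ} (hV : 0 ≤ V) (hρ0 : 0 ≤ ρ)
    (hρ : ρ ≤ R * (n : ℝ) ^ (-(1 : ℝ) / 3)) :
    √(d * (V / n + ρ ^ 2)) ≤ √(V + R ^ 2) * (√d * (n : ℝ) ^ (-(1 : ℝ) / 3)) := by
  have hh := bandwidth_pos hn
  have hinv := inv_natCast_le_bandwidth_sq hn
  set h := (n : ℝ) ^ (-(1 : ℝ) / 3)
  refine Real.sqrt_le_iff.2 ⟨by positivity, ?_⟩
  calc d * (V / n + ρ ^ 2) ≤ d * (V * h ^ 2 + (R * h) ^ 2) := by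
        rw [div_eq_mul_inv]
        gcongr
    _ = (√(V + R ^ 2) * (√d * h)) ^ 2 := by
        rw [mul_pow √_, mul_pow √(d : ℝ), Real.sq_sqrt (by positivity), Real.sq_sqrt d.cast_nonneg]
        ring

end Rates

/-- The constant in `risk_normalize_le_errorConst_mul`, the mean prediction error bound in terms of
the bandwidth and of the error of the estimated index. -/
noncomputable def errorConst (Lf Lf' σ Cmax μ₀ : ℝ) : ℝ :=
  18 * Lf + 16 * σ + Lf' + 4 * Lf' * (√Cmax / μ₀)

section PluginRate

variable {n d : ℕ} {m θ : EuclideanSpace ℝ (Fin d)} {Q : Matrix (Fin d) (Fin d) ℝ} {f : ℝ → ℝ}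
  {Lf Lf' σ Cmax μ₀ μ : ℝ} {ν : Fin n → Measure ℝ} [∀ i, IsProbabilityMeasure (ν i)]

lemma errorConst_nonneg (hf : IsLink Lf Lf' f) (hσ : 0 ≤ σ) (hμ₀ : 0 < μ₀) :
    0 ≤ errorConst Lf Lf' σ Cmax μ₀ := by
  have := hf.nonneg
  have := hf.deriv_nonneg
  rw [errorConst]
  positivity

lemma risk_normalize_le_errorConst_mul (hQ : Q.PosDef)
    (hC : ∀ j, hQ.isHermitian.eigenvalues j ≤ Cmax) (hn : 0 < n) (hf : IsLink Lf Lf' f)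
    (hν : ∀ i, IsNoiseLaw σ (ν i)) (hσ : 0 ≤ σ) (hdh : √d * (n : ℝ) ^ (-(1 : ℝ) / 3) ≤ 1)
    (hθ : l1norm (sqrtMul Q θ) = 1) (hμ₀ : 0 < μ₀) (hμ : μ₀ ≤ μ) (t : EuclideanSpace ℝ (Fin d)) :
    risk f θ m Q ((n : ℝ) ^ (-(1 : ℝ) / 3)) (2 * √(Real.log n)) ν (normalize Q t) ≤
      ENNReal.ofReal (errorConst Lf Lf' σ Cmax μ₀ *
        (‖t - μ • θ‖ + (n : ℝ) ^ (-(1 : ℝ) / 3))) := by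
  refine (risk_normalize_le hQ hC hn hf hν hσ (bandwidth_pos hn) (bandwidth_le_one hn) hdh
    (by positivity) hθ hμ₀ hμ t).trans (ENNReal.ofReal_le_ofReal ?_)
  have hLf := hf.nonneg
  have hLf' := hf.deriv_nonneg
  have hh := bandwidth_pos hn
  have hexp := exp_neg_truncation_sq_le hn
  rw [sqrt_natCast_mul_bandwidth hn, div_inv_eq_mul]
  set h := (n : ℝ) ^ (-(1 : ℝ) / 3)
  set e := ‖t - μ • θ‖
  have : 0 ≤ e := norm_nonneg _
  calc _ ≤ 2 * Lf * h + Lf' * (h + 4 * (√Cmax / μ₀ * e)) + 16 * (Lf + σ) * h := by gcongr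
    _ = (18 * Lf + 16 * σ + Lf') * h + 4 * Lf' * (√Cmax / μ₀) * e := by ring
    _ = errorConst Lf Lf' σ Cmax μ₀ * (e + h) -
        ((18 * Lf + 16 * σ + Lf') * e + 4 * Lf' * (√Cmax / μ₀) * h) := by
        rw [errorConst]
        ring
    _ ≤ errorConst Lf Lf' σ Cmax μ₀ * (e + h) := sub_le_self _ (by positivity)

end PluginRate

section IndexError

variable {Ω : Type*} [MeasurableSpace Ω] {P : Measure Ω} [IsProbabilityMeasure P] {n d : ℕ}
  {m θ : EuclideanSpace ℝ (Fin d)} {Q : Matrix (Fin d) (Fin d) ℝ} {f : ℝ → ℝ}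
  {Lf Lf' σ M B V δ τ c : ℝ} {x : Fin n → Ω → EuclideanSpace ℝ (Fin d)}
  {η : Fin n → Ω → ℝ}

/-- The constant in the `√d * n ^ (-1/3)` bounds on the error of the Stein estimator, both in mean
and with high probability, when the truncated variables have second moment at most `V`. -/
noncomputable def indexErrorConst (V B : ℝ) : ℝ :=
  5 * √(V * (3 + B) / 3) + √(V + √(V * (3 + B) / 3) ^ 2)

lemma indexErrorConst_nonneg (V B : ℝ) : 0 ≤ indexErrorConst V B := by
  rw [indexErrorConst]
  positivity

lemma natCast_mul_exp_truncation_eq (hn : 0 < n) (hd : 0 < d) (hV : 0 < V) (hδ : 0 < δ)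
    (hδ1 : δ < 1) (hτ : τ = √(3 * V * n / Real.log (2 * d / δ))) :
    d * (2 * Real.exp (n * (2 * V / τ ^ 2 - 5 * (V / τ) / τ))) = δ := by
  have : (0 : ℝ) < n := Nat.cast_pos.2 hn
  have : (0 : ℝ) < d := Nat.cast_pos.2 hd
  have hl := log_two_mul_div_pos hd hδ hδ1
  have hexponent : n * (2 * V / τ ^ 2 - 5 * (V / τ) / τ) = -Real.log (2 * d / δ) := by
    calc n * (2 * V / τ ^ 2 - 5 * (V / τ) / τ) = -3 * (n * V / τ ^ 2) := by ring
      _ = -Real.log (2 * d / δ) := by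
          rw [hτ, Real.sq_sqrt (by positivity)]
          field_simp
  rw [hexponent, Real.exp_neg, Real.exp_log (by positivity)]
  field_simp

lemma one_sub_le_measureReal_le {g : Ω → ℝ} (h : P.real {ω | c < g ω} ≤ δ) :
    1 - δ ≤ P.real {ω | g ω ≤ c} := by
  have hunion := measureReal_union_le (μ := P) {ω | c < g ω} {ω | g ω ≤ c}
  have huniv : {ω | c < g ω} ∪ {ω | g ω ≤ c} = Set.univ :=
    Set.eq_univ_of_forall fun ω => lt_or_ge c (g ω)
  rw [huniv, probReal_univ] at hunion
  linarith

variable (h : IsSample m Q σ x η P)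
  (hf : IsLink Lf Lf' f) (hQ : Q.PosDef) (hn : 0 < n) (hd : 0 < d)
  (hscore : ∀ j, ∫ u, score (gaussianDensity m Q) u j ^ 2 ∂multivariateGaussian m Q ≤ M)
  (hV : 0 < (σ ^ 2 + Lf ^ 2) * M) (hδ : 0 < δ) (hδ1 : δ < 1)
  (hB : Real.log (1 / δ) ≤ B * (n : ℝ) ^ ((1 : ℝ) / 3))
  (hdh : √d * (n : ℝ) ^ (-(1 : ℝ) / 3) ≤ 1)
  (hτ : τ = √(3 * ((σ ^ 2 + Lf ^ 2) * M) * n / Real.log (2 * d / δ)))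
include h hf hQ hn hd hscore hV hδ hδ1 hB hdh hτ

lemma one_sub_le_measureReal_norm_steinEstimator_sub_le :
    1 - δ ≤ P.real {ω | ‖steinEstimator (score (gaussianDensity m Q)) τ (fun i => x i ω)
        (fun i => f (inner ℝ (x i ω) θ) + η i ω)
        - (∫ u, deriv f (inner ℝ u θ) ∂multivariateGaussian m Q) • θ‖ ≤
      indexErrorConst ((σ ^ 2 + Lf ^ 2) * M) B * (√d * (n : ℝ) ^ (-(1 : ℝ) / 3))} := by
  have hl := log_two_mul_div_pos hd hδ hδ1
  have hratio := div_truncation_le hn hV hl (log_two_mul_div_mul_bandwidth_le hn hd hδ hB hdh)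
  rw [← hτ] at hratio
  have hτ_pos : 0 < τ := hτ ▸ truncation_pos hn hV hl
  have htail := measureReal_norm_steinEstimator_sub_gt_le (θ := θ) h hf hQ hn hτ_pos hscore
    (s := 5 * ((σ ^ 2 + Lf ^ 2) * M / τ)) (by positivity)
  rw [natCast_mul_exp_truncation_eq hn hd hV hδ hδ1 hτ] at htail
  have hh := bandwidth_pos hn
  refine (one_sub_le_measureReal_le htail).trans (measureReal_mono fun ω hω => ?_)
  set V := (σ ^ 2 + Lf ^ 2) * M
  set b := (n : ℝ) ^ (-(1 : ℝ) / 3)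
  calc _ ≤ √d * (5 * (V / τ)) := hω
    _ ≤ √d * (5 * (√(V * (3 + B) / 3) * b)) := by gcongr
    _ = 5 * √(V * (3 + B) / 3) * (√d * b) := by ring
    _ ≤ indexErrorConst V B * (√d * b) := by
        rw [indexErrorConst]
        gcongr
        exact le_add_of_nonneg_right (Real.sqrt_nonneg _)

lemma lintegral_norm_steinEstimator_sub_le_indexErrorConst (hM : 0 ≤ M) :
    ∫⁻ ω, ENNReal.ofReal ‖steinEstimator (score (gaussianDensity m Q)) τ (fun i => x i ω)
        (fun i => f (inner ℝ (x i ω) θ) + η i ω)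
        - (∫ u, deriv f (inner ℝ u θ) ∂multivariateGaussian m Q) • θ‖ ∂P ≤
      ENNReal.ofReal
        (indexErrorConst ((σ ^ 2 + Lf ^ 2) * M) B * (√d * (n : ℝ) ^ (-(1 : ℝ) / 3))) := by
  have hl := log_two_mul_div_pos hd hδ hδ1
  have hratio := div_truncation_le hn hV hl (log_two_mul_div_mul_bandwidth_le hn hd hδ hB hdh)
  rw [← hτ] at hratio
  have hτ_pos : 0 < τ := hτ ▸ truncation_pos hn hV hl
  refine (lintegral_norm_steinEstimator_sub_le h hf hQ hn hτ_pos hM hscore).trans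
    (ENNReal.ofReal_le_ofReal ?_)
  refine (sqrt_mul_div_add_sq_le hn hV.le (by positivity) hratio).trans ?_
  have := bandwidth_pos hn
  rw [indexErrorConst]
  gcongr
  exact le_add_of_nonneg_left (by positivity)

end IndexError

section EstimatedDirection

variable {Ω : Type*} [MeasurableSpace Ω] {P : Measure Ω} [IsProbabilityMeasure P] {n d : ℕ}
  {m θ : EuclideanSpace ℝ (Fin d)} {Q : Matrix (Fin d) (Fin d) ℝ} {f : ℝ → ℝ}
  {Lf Lf' σ M Cmax μ₀ B δ τ c : ℝ} {X : Ω → EuclideanSpace ℝ (Fin d)}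

lemma indepFun_steinEstimator {x : Fin n ⊕ Fin n → Ω → EuclideanSpace ℝ (Fin d)}
    {η : Fin n ⊕ Fin n → Ω → ℝ} (h : IsSample m Q σ x η P) (hf : Measurable f) (hQ : Q.PosDef)
    (hτ : 0 ≤ τ) (hX : AEMeasurable X P) (hXind : IndepFun X (fun ω i => (x i ω, η i ω)) P) :
    IndepFun (fun ω => steinEstimator (score (gaussianDensity m Q)) τ (fun i => x (Sum.inl i) ω)
        fun i => f (inner ℝ (x (Sum.inl i) ω) θ) + η (Sum.inl i) ω)
      (fun ω => ((fun i => (x (Sum.inr i) ω, η (Sum.inr i) ω)), X ω)) P := by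
  have hpair := fun i => (h.hasLaw i).aemeasurable.prodMk (h.aemeasurable_noise i)
  have hbatches := indepFun_inl_inr hpair h.iIndepFun_pair
  have hX_batches := hXind.comp (ψ := fun w : Fin n ⊕ Fin n → EuclideanSpace ℝ (Fin d) × ℝ =>
    ((fun i => w (Sum.inl i)), fun i => w (Sum.inr i))) measurable_id (by fun_prop)
  have hind := indepFun_prodMk_of_indepFun hX (h.precomp Sum.inl_injective).aemeasurable_pair
    (h.precomp Sum.inr_injective).aemeasurable_pair hbatches hX_batches
  exact hind.comp (φ := fun w : Fin n → EuclideanSpace ℝ (Fin d) × ℝ =>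
    steinEstimator (score (gaussianDensity m Q)) τ (fun i => (w i).1)
      fun i => f (inner ℝ (w i).1 θ) + (w i).2)
    ((measurable_steinEstimator hQ hτ).comp (f := fun w : Fin n → EuclideanSpace ℝ (Fin d) × ℝ =>
      ((fun i => (w i).1), fun i => f (inner ℝ (w i).1 θ) + (w i).2)) (by fun_prop)) measurable_id

variable {x : Fin n → Ω → EuclideanSpace ℝ (Fin d)} {η : Fin n → Ω → ℝ}

lemma IsSample.integrable_predictionError_and_integral_le (h : IsSample m Q σ x η P)
    (hf : Measurable f) (hX : HasLaw X (multivariateGaussian m Q) P)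
    (hXind : IndepFun X (fun ω i => (x i ω, η i ω)) P) {ϑ : Ω → EuclideanSpace ℝ (Fin d)}
    (hϑ : AEMeasurable ϑ P) (hϑind : IndepFun ϑ (fun ω => ((fun i => (x i ω, η i ω)), X ω)) P)
    (hc : 0 ≤ c) (hrisk : ∫⁻ ω, risk f θ m Q ((n : ℝ) ^ (-(1 : ℝ) / 3)) (2 * √(Real.log n))
      (fun i => P.map (η i)) (ϑ ω) ∂P ≤ ENNReal.ofReal c) :
    Integrable (fun ω => predictionError f θ m (ϑ ω) (fun i => x i ω)
        (fun i => f (inner ℝ (x i ω) θ) + η i ω) (X ω)) P ∧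
      ∫ ω, predictionError f θ m (ϑ ω) (fun i => x i ω)
        (fun i => f (inner ℝ (x i ω) θ) + η i ω) (X ω) ∂P ≤ c := by
  refine integrable_and_integral_le_of_lintegral_le
    (h.aemeasurable_predictionError hf hX.aemeasurable hϑ) (fun ω => abs_nonneg _) hc ?_
  rwa [h.lintegral_predictionError_eq_lintegral_risk hf hX hXind hϑ hϑind]

lemma IsSample.predictionError_bounds_of_risk_le (h : IsSample m Q σ x η P)
    (hf : Measurable f) (hX : HasLaw X (multivariateGaussian m Q) P)
    (hXind : IndepFun X (fun ω i => (x i ω, η i ω)) P) {ϑ : Ω → EuclideanSpace ℝ (Fin d)}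
    (hϑ : AEMeasurable ϑ P) (hϑind : IndepFun ϑ (fun ω => ((fun i => (x i ω, η i ω)), X ω)) P)
    (hc : 0 ≤ c)
    (htail : 1 - δ ≤ P.real {ω | risk f θ m Q ((n : ℝ) ^ (-(1 : ℝ) / 3)) (2 * √(Real.log n))
      (fun i => P.map (η i)) (ϑ ω) ≤ ENNReal.ofReal c})
    (hmean : ∫⁻ ω, risk f θ m Q ((n : ℝ) ^ (-(1 : ℝ) / 3)) (2 * √(Real.log n))
      (fun i => P.map (η i)) (ϑ ω) ∂P ≤ ENNReal.ofReal c) :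
    1 - δ ≤ P.real {ω |
        Integrable (fun ω' => predictionError f θ m (ϑ ω) (fun i => x i ω')
          (fun i => f (inner ℝ (x i ω') θ) + η i ω') (X ω')) P ∧
        ∫ ω', predictionError f θ m (ϑ ω) (fun i => x i ω')
          (fun i => f (inner ℝ (x i ω') θ) + η i ω') (X ω') ∂P ≤ c} ∧
      Integrable (fun ω => predictionError f θ m (ϑ ω) (fun i => x i ω)
        (fun i => f (inner ℝ (x i ω) θ) + η i ω) (X ω)) P ∧
      ∫ ω, predictionError f θ m (ϑ ω) (fun i => x i ω)
        (fun i => f (inner ℝ (x i ω) θ) + η i ω) (X ω) ∂P ≤ c := by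
  refine ⟨htail.trans (measureReal_mono fun ω hω => ?_),
    h.integrable_predictionError_and_integral_le hf hX hXind hϑ hϑind hc hmean⟩
  refine h.integrable_predictionError_and_integral_le hf hX hXind aemeasurable_const
    (indepFun_const_left _ _) hc ?_
  rwa [lintegral_const, measure_univ, mul_one]

/-- The constant of the theorem: plug-in error for `√d * n ^ (-1/3) ≤ 1`, and the trivial bound on
the prediction error otherwise. -/
noncomputable def predictionConst (Lf Lf' σ M Cmax μ₀ B : ℝ) : ℝ :=
  errorConst Lf Lf' σ Cmax μ₀ * (1 + indexErrorConst ((σ ^ 2 + Lf ^ 2) * M) B) + (2 * Lf + σ)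

lemma predictionConst_nonneg (hf : IsLink Lf Lf' f) (hσ : 0 ≤ σ) (hμ₀ : 0 < μ₀) :
    0 ≤ predictionConst Lf Lf' σ M Cmax μ₀ B := by
  have := errorConst_nonneg (Cmax := Cmax) hf hσ hμ₀
  have := indexErrorConst_nonneg ((σ ^ 2 + Lf ^ 2) * M) B
  have := hf.nonneg
  rw [predictionConst]
  positivity

lemma errorConst_mul_add_le_predictionConst_mul (hf : IsLink Lf Lf' f) (hσ : 0 ≤ σ)
    (hμ₀ : 0 < μ₀) {b e s : ℝ} (hs : 0 ≤ s) (hbs : b ≤ s)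
    (he : e ≤ indexErrorConst ((σ ^ 2 + Lf ^ 2) * M) B * s) :
    errorConst Lf Lf' σ Cmax μ₀ * (e + b) ≤ predictionConst Lf Lf' σ M Cmax μ₀ B * s := by
  have := hf.nonneg
  calc errorConst Lf Lf' σ Cmax μ₀ * (e + b)
      ≤ errorConst Lf Lf' σ Cmax μ₀ * (indexErrorConst ((σ ^ 2 + Lf ^ 2) * M) B * s + s) :=
        mul_le_mul_of_nonneg_left (by linarith) (errorConst_nonneg hf hσ hμ₀)
    _ = predictionConst Lf Lf' σ M Cmax μ₀ B * s - (2 * Lf + σ) * s := by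
        rw [predictionConst]
        ring
    _ ≤ predictionConst Lf Lf' σ M Cmax μ₀ B * s := sub_le_self _ (by positivity)

variable {ν : Fin n → Measure ℝ} [∀ i, IsProbabilityMeasure (ν i)]

lemma risk_le_predictionConst_mul (hf : IsLink Lf Lf' f) (hσ : 0 ≤ σ)
    (hν : ∀ i, IsNoiseLaw σ (ν i)) (hμ₀ : 0 < μ₀) {b W s : ℝ} (hb : 0 < b) (hs : 1 ≤ s)
    (ϑ : EuclideanSpace ℝ (Fin d)) :
    risk f θ m Q b W ν ϑ ≤ ENNReal.ofReal (predictionConst Lf Lf' σ M Cmax μ₀ B * s) := by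
  refine (risk_le_two_mul_add hf hν hσ hb).trans (ENNReal.ofReal_le_ofReal ?_)
  have := errorConst_nonneg (Cmax := Cmax) hf hσ hμ₀
  have := indexErrorConst_nonneg ((σ ^ 2 + Lf ^ 2) * M) B
  calc 2 * Lf + σ ≤ predictionConst Lf Lf' σ M Cmax μ₀ B :=
        le_add_of_nonneg_left (by positivity)
    _ ≤ predictionConst Lf Lf' σ M Cmax μ₀ B * s :=
        le_mul_of_one_le_right (predictionConst_nonneg hf hσ hμ₀) hs

variable (h : IsSample m Q σ x η P)
  (hf : IsLink Lf Lf' f) (hσ : 0 ≤ σ) (hν : ∀ i, IsNoiseLaw σ (ν i)) (hn : 0 < n)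
  (hV : 0 < (σ ^ 2 + Lf ^ 2) * M) (hμ₀ : 0 < μ₀) (hQ : Q.PosDef)
  (hC : ∀ j, hQ.isHermitian.eigenvalues j ≤ Cmax)
  (hscore : ∀ j, ∫ u, score (gaussianDensity m Q) u j ^ 2 ∂multivariateGaussian m Q ≤ M)
  (hθ : l1norm (sqrtMul Q θ) = 1)
  (hμ : μ₀ ≤ ∫ u, deriv f (inner ℝ u θ) ∂multivariateGaussian m Q) (hδ : 0 < δ) (hδ1 : δ < 1)
  (hB : Real.log (1 / δ) ≤ B * (n : ℝ) ^ ((1 : ℝ) / 3))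
  (hτ : τ = √(3 * ((σ ^ 2 + Lf ^ 2) * M) * n / Real.log (2 * d / δ)))
include h hf hσ hν hn hV hμ₀ hC hscore hθ hμ hδ hδ1 hB hτ

lemma one_sub_le_measureReal_risk_normalize_steinEstimator_le :
    1 - δ ≤ P.real {ω | risk f θ m Q ((n : ℝ) ^ (-(1 : ℝ) / 3)) (2 * √(Real.log n)) ν
        (normalize Q (steinEstimator (score (gaussianDensity m Q)) τ (fun i => x i ω)
          fun i => f (inner ℝ (x i ω) θ) + η i ω)) ≤
      ENNReal.ofReal (predictionConst Lf Lf' σ M Cmax μ₀ B *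
        (√d * (n : ℝ) ^ (-(1 : ℝ) / 3)))} := by
  have hd := pos_of_l1norm_sqrtMul_eq_one hθ
  have hh := bandwidth_pos hn
  have hh_le := le_mul_of_one_le_left hh.le (Real.one_le_sqrt.2 (Nat.one_le_cast.2 hd))
  obtain hdh | hdh := le_total (√d * (n : ℝ) ^ (-(1 : ℝ) / 3)) 1
  · refine (one_sub_le_measureReal_norm_steinEstimator_sub_le (θ := θ) h hf hQ hn hd hscore hV hδ
      hδ1 hB hdh hτ).trans (measureReal_mono fun ω hω => ?_)
    exact (risk_normalize_le_errorConst_mul hQ hC hn hf hν hσ hdh hθ hμ₀ hμ _).trans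
      (ENNReal.ofReal_le_ofReal (errorConst_mul_add_le_predictionConst_mul hf hσ hμ₀
        (by positivity) hh_le hω))
  · simp only [risk_le_predictionConst_mul hf hσ hν hμ₀ hh hdh, Set.ofPred_true, probReal_univ]
    linarith

lemma lintegral_risk_normalize_steinEstimator_le (hM : 0 ≤ M) :
    ∫⁻ ω, risk f θ m Q ((n : ℝ) ^ (-(1 : ℝ) / 3)) (2 * √(Real.log n)) ν
        (normalize Q (steinEstimator (score (gaussianDensity m Q)) τ (fun i => x i ω)
          fun i => f (inner ℝ (x i ω) θ) + η i ω)) ∂P ≤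
      ENNReal.ofReal (predictionConst Lf Lf' σ M Cmax μ₀ B *
        (√d * (n : ℝ) ^ (-(1 : ℝ) / 3))) := by
  have hd := pos_of_l1norm_sqrtMul_eq_one hθ
  have hh := bandwidth_pos hn
  have hh_le := le_mul_of_one_le_left hh.le (Real.one_le_sqrt.2 (Nat.one_le_cast.2 hd))
  obtain hdh | hdh := le_total (√d * (n : ℝ) ^ (-(1 : ℝ) / 3)) 1
  · have herr := lintegral_norm_steinEstimator_sub_le_indexErrorConst (θ := θ) h hf hQ hn hd hscore
      hV hδ hδ1 hB hdh hτ hM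
    have hG := indexErrorConst_nonneg ((σ ^ 2 + Lf ^ 2) * M) B
    refine (lintegral_mono fun ω =>
      risk_normalize_le_errorConst_mul hQ hC hn hf hν hσ hdh hθ hμ₀ hμ _).trans ?_
    refine (lintegral_ofReal_const_mul_le (errorConst_nonneg hf hσ hμ₀)
      (lintegral_ofReal_add_le measurable_const (by positivity) hh.le herr
        (lintegral_ofReal_const_le _))).trans (ENNReal.ofReal_le_ofReal
          (errorConst_mul_add_le_predictionConst_mul hf hσ hμ₀ (by positivity) hh_le le_rfl))
  · exact (lintegral_mono fun ω => risk_le_predictionConst_mul hf hσ hν hμ₀ hh hdh _).trans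
      (lintegral_ofReal_const_le _)

end EstimatedDirection

lemma pos_of_natCast_pow_le_mul {d n k : ℕ} {A : ℝ} (hd : 0 < d) (h : (d : ℝ) ^ k ≤ A * n) :
    0 < n := by
  refine Nat.pos_of_ne_zero fun hn => (pow_pos (Nat.cast_pos.2 hd) k : 0 < (d : ℝ) ^ k).not_ge ?_
  rwa [hn, Nat.cast_zero, mul_zero] at h

end SingleIndex

open SingleIndex in
theorem theorem6_general (Lf Lf' σ M Cmax μ₀ B : ℝ) (hLf : 0 < Lf) (hσ : 0 ≤ σ) (hM : 0 < M)
    (hμ₀ : 0 < μ₀) :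
    ∃ C : ℝ, ∀ (n d : ℕ), 0 < n →
      ∀ (f : ℝ → ℝ), ContDiff ℝ 1 f → (∀ t, |f t| ≤ Lf) → (∀ t, |deriv f t| ≤ Lf') →
      ∀ (m : EuclideanSpace ℝ (Fin d)) (Q : Matrix (Fin d) (Fin d) ℝ) (hQ : Q.PosDef),
        (∀ j, hQ.isHermitian.eigenvalues j ≤ Cmax) →
        (∀ j, ∫ x, (score (gaussianDensity m Q) x j) ^ 2 ∂(multivariateGaussian m Q) ≤ M) →
      ∀ (θ : EuclideanSpace ℝ (Fin d)), l1norm (sqrtMul Q θ) = 1 →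
        μ₀ ≤ ∫ x, deriv f (inner ℝ x θ) ∂(multivariateGaussian m Q) →
      ∀ (Ω : Type*) [MeasurableSpace Ω] (P : Measure Ω) [IsProbabilityMeasure P]
        (x : Fin n ⊕ Fin n → Ω → EuclideanSpace ℝ (Fin d)) (η y : Fin n ⊕ Fin n → Ω → ℝ)
        (X : Ω → EuclideanSpace ℝ (Fin d)),
        (∀ i, HasLaw (x i) (multivariateGaussian m Q) P) →
        (∀ i, MemLp (η i) 2 P ∧ ∫ ω, η i ω ∂P = 0 ∧ variance (η i) P ≤ σ ^ 2) →
        (∀ i, IndepFun (x i) (η i) P) →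
        iIndepFun (fun i ω => (x i ω, η i ω)) P →
        HasLaw X (multivariateGaussian m Q) P →
        IndepFun X (fun ω i => (x i ω, η i ω)) P →
        (∀ i ω, y i ω = f (inner ℝ (x i ω) θ) + η i ω) →
      ∀ (δ τ : ℝ), 0 < δ → δ < 1 → Real.log (1 / δ) ≤ B * (n : ℝ) ^ ((1 : ℝ) / 3) →
        τ = Real.sqrt (3 * (σ ^ 2 + Lf ^ 2) * M * n / Real.log (2 * d / δ)) →
      ∀ (θhat : Ω → EuclideanSpace ℝ (Fin d)),
        (∀ ω, IsMinOn (steinObjective (score (gaussianDensity m Q)) τ 0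
          (fun i => x (Sum.inl i) ω) (fun i => y (Sum.inl i) ω)) Set.univ (θhat ω)) →
      (1 - δ ≤ P.real {ω |
          Integrable (fun ω' => predictionError f θ m (normalize Q (θhat ω))
            (fun i => x (Sum.inr i) ω') (fun i => y (Sum.inr i) ω') (X ω')) P ∧
          ∫ ω', predictionError f θ m (normalize Q (θhat ω))
            (fun i => x (Sum.inr i) ω') (fun i => y (Sum.inr i) ω') (X ω') ∂P
              ≤ C * (Real.sqrt d * (n : ℝ) ^ (-(1 : ℝ) / 3))}) ∧
      Integrable (fun ω => predictionError f θ m (normalize Q (θhat ω))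
          (fun i => x (Sum.inr i) ω) (fun i => y (Sum.inr i) ω) (X ω)) P ∧
      ∫ ω, predictionError f θ m (normalize Q (θhat ω))
          (fun i => x (Sum.inr i) ω) (fun i => y (Sum.inr i) ω) (X ω) ∂P
            ≤ C * (Real.sqrt d * (n : ℝ) ^ (-(1 : ℝ) / 3)) := by
  refine ⟨predictionConst Lf Lf' σ M Cmax μ₀ B, fun n d hn f hf hfb hfb' m Q hQ hC hscore θ hθ hμ
    Ω _ P _ x η y X hx hη hxη hind hX hXind hy δ τ hδ hδ1 hB hτ θhat hmin => ?_⟩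
  have hlink : IsLink Lf Lf' f := ⟨hf, hfb, hfb'⟩
  have sample : IsSample m Q σ x η P := ⟨hx, hη, hxη, hind⟩
  have first := sample.precomp Sum.inl_injective
  have second := sample.precomp Sum.inr_injective
  obtain rfl : y = fun i ω => f (inner ℝ (x i ω) θ) + η i ω := funext₂ hy
  obtain rfl := funext fun ω => eq_steinEstimator_of_isMinOn (hmin ω)
  rw [mul_assoc 3] at hτ
  have hτ₀ : 0 ≤ τ := hτ ▸ Real.sqrt_nonneg _
  have hV : 0 < (σ ^ 2 + Lf ^ 2) * M := by positivity
  have := fun i => Measure.isProbabilityMeasure_map (second.aemeasurable_noise i)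
  have hf_meas := hf.continuous.measurable
  exact second.predictionError_bounds_of_risk_le hf_meas hX
    (hXind.comp measurable_id (measurable_pi_lambda _ fun i => measurable_pi_apply (Sum.inr i)))
    (measurable_normalize.comp_aemeasurable (first.aemeasurable_steinEstimator hf_meas hQ hτ₀))
    ((indepFun_steinEstimator sample hf_meas hQ hτ₀ hX.aemeasurable hXind).comp
      measurable_normalize measurable_id)
    (mul_nonneg (predictionConst_nonneg hlink hσ hμ₀) (by positivity))
    (one_sub_le_measureReal_risk_normalize_steinEstimator_le first hlink hσ second.isNoiseLaw hn hV
      hμ₀ hQ hC hscore hθ hμ hδ hδ1 hB hτ)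
    (lintegral_risk_normalize_steinEstimator_le first hlink hσ second.isNoiseLaw hn hV hμ₀ hQ hC
      hscore hθ hμ hδ hδ1 hB hτ hM.le)

open SingleIndex in
theorem theorem6
    -- the constants on which the bound may depend
    (Lf Lf' σ M Cmax μ₀ A B : ℝ) (hLf : 0 < Lf) (hLf' : 0 < Lf') (hσ : 0 ≤ σ) (hM : 0 < M)
    (hCmax : 0 < Cmax) (hμ₀ : 0 < μ₀) (hA : 0 < A) (hB : 0 < B) :
    ∃ C : ℝ, ∀ (n d : ℕ), (d : ℝ) ^ 6 ≤ A * n →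
      -- the single index model: link function, Gaussian design, true parameter
      ∀ (f : ℝ → ℝ), ContDiff ℝ 1 f → (∀ t, |f t| ≤ Lf) → (∀ t, |deriv f t| ≤ Lf') →
      ∀ (m : EuclideanSpace ℝ (Fin d)) (Q : Matrix (Fin d) (Fin d) ℝ) (hQ : Q.PosDef),
        (∀ j, hQ.isHermitian.eigenvalues j ≤ Cmax) →
        (∀ j, ∫ x, (score (gaussianDensity m Q) x j) ^ 2 ∂(multivariateGaussian m Q) ≤ M) →
      ∀ (θ : EuclideanSpace ℝ (Fin d)), l1norm (sqrtMul Q θ) = 1 →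
        μ₀ ≤ ∫ x, deriv f (inner ℝ x θ) ∂(multivariateGaussian m Q) →
      -- `2 n` independent samples, in two batches, and an independent new context `X`
      ∀ (Ω : Type*) [MeasurableSpace Ω] (P : Measure Ω) [IsProbabilityMeasure P]
        (x : Fin n ⊕ Fin n → Ω → EuclideanSpace ℝ (Fin d)) (η y : Fin n ⊕ Fin n → Ω → ℝ)
        (X : Ω → EuclideanSpace ℝ (Fin d)),
        (∀ i, HasLaw (x i) (multivariateGaussian m Q) P) →
        (∀ i, MemLp (η i) 2 P ∧ ∫ ω, η i ω ∂P = 0 ∧ variance (η i) P ≤ σ ^ 2) →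
        (∀ i, IndepFun (x i) (η i) P) →
        iIndepFun (fun i ω => (x i ω, η i ω)) P →
        HasLaw X (multivariateGaussian m Q) P →
        IndepFun X (fun ω i => (x i ω, η i ω)) P →
        (∀ i ω, y i ω = f (inner ℝ (x i ω) θ) + η i ω) →
      -- the Stein estimator from the first batch
      ∀ (δ τ : ℝ), 0 < δ → δ < 1 → Real.log (1 / δ) ≤ B * (n : ℝ) ^ ((1 : ℝ) / 3) →
        τ = Real.sqrt (3 * (σ ^ 2 + Lf ^ 2) * M * n / Real.log (2 * d / δ)) →
      ∀ (θhat : Ω → EuclideanSpace ℝ (Fin d)),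
        (∀ ω, IsMinOn (steinObjective (score (gaussianDensity m Q)) τ 0
          (fun i => x (Sum.inl i) ω) (fun i => y (Sum.inl i) ω)) Set.univ (θhat ω)) →
      -- expectation over `X` and the second batch, for a realization of the first batch
      (1 - δ ≤ P.real {ω |
          Integrable (fun ω' => predictionError f θ m (normalize Q (θhat ω))
            (fun i => x (Sum.inr i) ω') (fun i => y (Sum.inr i) ω') (X ω')) P ∧
          ∫ ω', predictionError f θ m (normalize Q (θhat ω))
            (fun i => x (Sum.inr i) ω') (fun i => y (Sum.inr i) ω') (X ω') ∂P
              ≤ C * (Real.sqrt d * (n : ℝ) ^ (-(1 : ℝ) / 3))}) ∧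
      -- expectation over all the randomness
      Integrable (fun ω => predictionError f θ m (normalize Q (θhat ω))
          (fun i => x (Sum.inr i) ω) (fun i => y (Sum.inr i) ω) (X ω)) P ∧
      ∫ ω, predictionError f θ m (normalize Q (θhat ω))
          (fun i => x (Sum.inr i) ω) (fun i => y (Sum.inr i) ω) (X ω) ∂P
            ≤ C * (Real.sqrt d * (n : ℝ) ^ (-(1 : ℝ) / 3)) := by
  obtain ⟨C, hbound⟩ := theorem6_general Lf Lf' σ M Cmax μ₀ B hLf hσ hM hμ₀
  exact ⟨C, fun n d hnd f hf hfb hfb' m Q hQ hC hscore θ hθ =>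
    hbound n d (pos_of_natCast_pow_le_mul (pos_of_l1norm_sqrtMul_eq_one hθ) hnd) f hf hfb hfb' m Q
      hQ hC hscore θ hθ⟩
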